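/- Let $D\equiv 1 \pmod 4$ be a prime, let $F=\mathbb Q(\sqrt D)$, and let $K=F(\sqrt\Delta)$ ($\Delta\in F$) be a non-biquadratic quartic CM field with maximal real subfield $F$. Assume that $$\mathcal O_K=\mathcal O_F+\mathcal O_F\,\frac{w+\sqrt\Delta}{2}\quad\text{for some } w\in\mathcal O_F,$$ and that $\tilde D:=\Delta\Delta'\equiv 1\pmod 4$ is squarefree, where $\Delta'$ is the Galois conjugate of $\Delta$ in $F$. Let $\Phi$ be a CM type of $K$, let $\tilde K$ be the reflex field of $(K,\Phi)$ (a quartic CM field with real quadratic subfield $\tilde F=\mathbb Q(\sqrt{\tilde D})$), let $d_{\tilde K/\tilde F}$ be the relative discriminant, and let $M=K\tilde K$ be the Galois closure of $K$ over $\mathbb Q$. Let $p$ be a prime and let $m>0$ be a squarefree integer with $(m,2D\tilde Dp)=1$. Define $b_m(p)$ by $$b_m(p)\log p=\sum_{\mathfrak p\mid p}\ \sum_{\substack{t=\frac{n+m\sqrt{\tilde D}}{2D}\in d_{\tilde K/\tilde F}^{-1}\\ n\in\mathbb Z,\ |n|<m\sqrt{\tilde D}}}B_t(\mathfrak p),$$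 where $\mathfrak p$ runs over the primes of $\tilde F$ above $p$, where $B_t(\mathfrak p)=0$ if $\mathfrak p$ is split in $\tilde K$ and $B_t(\mathfrak p)=(\operatorname{ord}_{\mathfrak p}t+1)\,\rho(t\,d_{\tilde K/\tilde F}\,\mathfrak p^{-1})\log|\mathfrak p|$ otherwise, $|\mathfrak p|$ is the norm of $\mathfrak p$, and $\rho(\mathfrak a)=\#\{\mathfrak A\subset\mathcal O_{\tilde K}: N_{\tilde K/\tilde F}\mathfrak A=\mathfrak a\}$. For an integer $n$ with $0<n<m\sqrt{\tilde D}$ and $\frac{m^2\tilde D-n^2}{D}\in\mathbb Z_{>0}$ and for a sign $\mu=\pm1$, let $T_m(\mu n)=\begin{pmatrix}a&b\\b&c\end{pmatrix}\in\frac1m\mathrm{Sym}_2(\mathbb Z)$ be the positive definite matrix with $$ac-b^2=\frac{m^2\tilde D-n^2}{Dm^2},\qquad \Delta=\frac{2\mu\frac nm-Dc-(2b+Dc)\sqrt D}{2},\qquad -\mu\frac nm=a+Db+\frac{D^2-D}{4}c .$$ It is unique if it exists; it exists for both signs if $D\mid n$, and for exactly one sign if $D\nmid n$. Let $\sum_\mu$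 denote the sum over the signs for which it exists. Put $t_l=\operatorname{ord}_l\frac{m^2\tilde D-n^2}{4Dm^2}$ for a prime $l$, and let $(\ ,\ )_l$ be the Hilbert symbol over $\mathbb Q_l$. Then $$b_m(p)=\sum_{\substack{0<n<m\sqrt{\tilde D}\\ \frac{m^2\tilde D-n^2}{4D}\in p\mathbb Z_{>0}}}\Big(\operatorname{ord}_p\frac{m^2\tilde D-n^2}{4D}+1\Big)\sum_\mu\ \prod_{l\mid\frac{m^2\tilde D-n^2}{4D}}b_l(p,\mu n,m),$$ where the product is over primes $l$ and the local factors, for $l\mid\frac{m^2\tilde D-n^2}{4D}$, are as follows. (1) If $l\nmid m$, then $T_m(\mu n)$ is $\mathbb Z_l$-equivalent to $\operatorname{diag}(\alpha_l,\alpha_l^{-1}\det T_m(\mu n))$ with some $\alpha_l\in\mathbb Z_l^*$, and, for any such $\alpha_l$, $$b_l(p,\mu n,m)=\begin{cases}\frac{1-(-\alpha_p,p)_p^{t_p}}2&\text{if } l=p,\\ t_l+1&\text{if } l\ne p,\ (-\alpha_l,l)_l=1,\\ \frac{1+(-1)^{t_l}}2&\text{if } l\ne p,\ (-\alpha_l,l)_l=-1.\end{cases}$$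 (2) If $l\mid m$ and $t_l=0$, then $$b_l(p,\mu n,m)=\begin{cases}4&\text{if } l \text{ splits completely in } M,\\ 2&\text{if } l\text{ is inert in }\tilde F\text{ and } l\mathcal O_{\tilde F}\text{ is split in }\tilde K,\\ 0&\text{otherwise.}\end{cases}$$ (3) If $l\mid m$ is split in $F$ and $t_l>0$, then $T_m(\mu n)$ is $\mathbb Z_l$-equivalent to $\operatorname{diag}(\alpha_l,\alpha_l^{-1}\det T_m(\mu n))$ with some $\alpha_l\in\mathbb Z_l^*$, and, for any such $\alpha_l$, $b_l(p,\mu n,m)=0$ if $(-\alpha_l,l)_l=-1$ and $b_l(p,\mu n,m)=2(t_l+2)$ if $(-\alpha_l,l)_l=1$. (4) If $l\mid m$ is inert in $F$ and $t_l>0$, then $T_m(\mu n)$ is $\mathbb Z_l$-equivalent to $\operatorname{diag}(\alpha_l,\alpha_l^{-1}\det T_m(\mu n))$ with some $\alpha_l\in\mathbb Z_l^*$, and, for any such $\alpha_l$, $b_l(p,\mu n,m)=1-(-1)^{t_l}$ if $(-\alpha_l,l)_l=-1$ and $b_l(p,\mu n,m)=0$ if $(-\alpha_l,l)_l=1$.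 -/

import Mathlib

open scoped NumberField nonZeroDivisors

noncomputable section

namespace CMIntersection

/-! ### Splitting of primes, relative discriminant, and the ideal counting function -/

section Relative

variable (E L : Type*) [Field E] [NumberField E] [Field L] [NumberField L] [Algebra E L]

/-- The relative discriminant `d_{L/E}`, an ideal of `𝓞 E`: the norm of the relative different. -/
def relDiscr : Ideal (𝓞 E) :=
  Ideal.relNorm (𝓞 E) (differentIdeal (𝓞 E) (𝓞 L))

/-- `ρ(𝔞)`: the number of ideals `𝔄` of `𝓞 L` whose relative norm is `𝔞`. It vanishes if the
fractional ideal `𝔞` is not integral. -/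
def rho (𝔞 : FractionalIdeal (𝓞 E)⁰ E) : ℕ :=
  Nat.card {A : Ideal (𝓞 L) // ((Ideal.relNorm (𝓞 E) A : Ideal (𝓞 E)) :
    FractionalIdeal (𝓞 E)⁰ E) = 𝔞}

/-- For a quadratic extension of number fields `L / E`: the (prime) ideal `𝔭` of `𝓞 E` is split
in `L`, that is, exactly two primes of `L` lie above it. -/
def IsSplit (𝔭 : Ideal (𝓞 E)) : Prop :=
  (Ideal.primesOver 𝔭 (𝓞 L)).ncard = 2

open Classical in
/-- `B_t(𝔭)`, for `t` in `E` and a prime `𝔭` of `E`. -/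
def Bterm (t : E) (𝔭 : IsDedekindDomain.HeightOneSpectrum (𝓞 E)) : ℝ :=
  if IsSplit E L 𝔭.asIdeal then 0
  else
    ((FractionalIdeal.count E 𝔭 (FractionalIdeal.spanSingleton (𝓞 E)⁰ t) : ℝ) + 1) *
      (rho E L (FractionalIdeal.spanSingleton (𝓞 E)⁰ t *
        (relDiscr E L : FractionalIdeal (𝓞 E)⁰ E) *
        (𝔭.asIdeal : FractionalIdeal (𝓞 E)⁰ E)⁻¹) : ℝ) *
      Real.log (Ideal.absNorm 𝔭.asIdeal)

end Relative

/-- The rational prime `l` is inert in the number field `E`. -/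
def IsInertPrime (E : Type*) [Field E] (l : ℕ) : Prop :=
  (Ideal.span {(l : 𝓞 E)}).IsPrime

/-- The rational prime `l` splits completely in the number field `E`: there are `[E : ℚ]`
primes above it. For quadratic `E` this says that `l` is split. -/
def SplitsCompletely (E : Type*) [Field E] [CharZero E] (l : ℕ) : Prop :=
  (Ideal.primesOver (Ideal.span {(l : ℤ)}) (𝓞 E)).ncard = Module.finrank ℚ E

/-! ### The CM field, its reflex field and the number `b_m(p)` -/

/-- A field generated over `ℚ` by two square roots of rational numbers. -/
def IsBiquadratic (K : Type*) [Field K] [CharZero K] : Prop :=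
  ∃ (a b : ℚ) (x y : K), x ^ 2 = (a : K) ∧ y ^ 2 = (b : K) ∧
    IntermediateField.adjoin ℚ {x, y} = ⊤

section Reflex

variable {K : Type*} [Field K] [NumberField K]

/-- A CM type: it contains exactly one embedding of each pair of complex conjugate embeddings. -/
def IsCMType (Φ : Finset (K →+* ℂ)) : Prop :=
  ∀ φ : K →+* ℂ, φ ∈ Φ ↔ NumberField.ComplexEmbedding.conjugate φ ∉ Φ

/-- The reflex field `K̃` of `(K, Φ)`: the subfield of `ℂ` generated by the type traces. -/
def reflexField (Φ : Finset (K →+* ℂ)) : IntermediateField ℚ ℂ :=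
  IntermediateField.adjoin ℚ (Set.range fun z : K => ∑ φ ∈ Φ, φ z)

/-- The Galois closure `M` of `K` over `ℚ`, in `ℂ`; for a non-biquadratic quartic CM field it is
the composite `K K̃`. -/
abbrev galoisClosure (K : Type*) [Field K] [NumberField K] : IntermediateField ℚ ℂ :=
  IntermediateField.normalClosure ℚ K ℂ

lemma reflexField_le (Φ : Finset (K →+* ℂ)) : reflexField Φ ≤ galoisClosure K := by
  refine IntermediateField.adjoin_le_iff.2 ?_
  rintro _ ⟨z, rfl⟩
  refine sum_mem fun φ _ => ?_
  exact (AlgHom.fieldRange_le_normalClosure φ.toRatAlgHom) ⟨z, rfl⟩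

instance reflexField_numberField (Φ : Finset (K →+* ℂ)) : NumberField (reflexField Φ) where
  to_charZero := inferInstance
  to_finiteDimensional :=
    FiniteDimensional.of_injective
      (IntermediateField.inclusion (reflexField_le Φ)).toLinearMap
      (IntermediateField.inclusion (reflexField_le Φ)).injective

/-- The subfield `F̃ = ℚ(√D̃)` of the reflex field. -/
def tildeF (Φ : Finset (K →+* ℂ)) (Dt : ℕ) : IntermediateField ℚ (reflexField Φ) :=
  IntermediateField.adjoin ℚ {x | (x : ℂ) = (Real.sqrt Dt : ℂ)}

/-- The elements `t = (n + m √D̃) / (2D)` of `d_{K̃/F̃}⁻¹` with `n ∈ ℤ`, `|n| < m √D̃`. -/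
def tSet (Φ : Finset (K →+* ℂ)) (D Dt m : ℕ) : Set (tildeF Φ Dt) :=
  {t | t ∈ ((relDiscr (tildeF Φ Dt) (reflexField Φ) :
        FractionalIdeal (𝓞 (tildeF Φ Dt))⁰ (tildeF Φ Dt))⁻¹) ∧
      ∃ n : ℤ, |(n : ℝ)| < m * Real.sqrt Dt ∧
        ((t : reflexField Φ) : ℂ) = ((n : ℂ) + m * (Real.sqrt Dt : ℂ)) / (2 * D)}

/-- The number `b_m(p)`, defined by `b_m(p) log p = ∑_{𝔭 ∣ p} ∑_t B_t(𝔭)`. -/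
def bm (Φ : Finset (K →+* ℂ)) (D Dt m p : ℕ) : ℝ :=
  (∑ᶠ (𝔭 : IsDedekindDomain.HeightOneSpectrum (𝓞 (tildeF Φ Dt)))
      (_ : (p : 𝓞 (tildeF Φ Dt)) ∈ 𝔭.asIdeal),
    ∑ᶠ (t : tildeF Φ Dt) (_ : t ∈ tSet Φ D Dt m),
      Bterm (tildeF Φ Dt) (reflexField Φ) t 𝔭) / Real.log p

end Reflex

/-! ### The matrices `T_m(μ n)` -/

/-- The conditions that determine the matrix `T_m(μ n)`. Here `F = ℚ(√D)`, `s = √D`, `Δ ∈ F`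
has norm `D̃`, and `n₁ = n / m`. -/
structure IsTm {F : Type*} [Field F] [CharZero F] (D Dt : ℕ) (s Δ : F) (m n : ℕ) (μ : ℤˣ)
    (T : Matrix (Fin 2) (Fin 2) ℚ) : Prop where
  symm : T.IsSymm
  posDef : (T.map (fun x : ℚ => (x : ℝ))).PosDef
  integral : ∀ i j, ∃ k : ℤ, (m : ℚ) * T i j = k
  det_eq : T.det = ((m : ℚ) ^ 2 * Dt - (n : ℚ) ^ 2) / (D * (m : ℚ) ^ 2)
  delta_eq : Δ = (((2 * ((μ : ℤ) : ℚ) * (n / m) - D * T 1 1 : ℚ) : F) -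
    ((2 * T 0 1 + D * T 1 1 : ℚ) : F) * s) / 2
  trace_eq : -(((μ : ℤ) : ℚ) * (n / m)) =
    T 0 0 + D * T 0 1 + ((D : ℚ) ^ 2 - D) / 4 * T 1 1

open Classical in
/-- The matrix `T_m(μ n)`. -/
def Tm {F : Type*} [Field F] [CharZero F] (D Dt : ℕ) (s Δ : F) (m n : ℕ) (μ : ℤˣ) :
    Matrix (Fin 2) (Fin 2) ℚ :=
  if h : ∃ T, IsTm D Dt s Δ m n μ T then h.choose else 0

/-- The matrix `T_m(μ n)` is unique. -/
lemma IsTm.unique {F : Type*} [Field F] [CharZero F] {D Dt : ℕ} (hD : D.Prime) {s Δ : F}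
    (hs : s ^ 2 = D) {m n : ℕ} {μ : ℤˣ} {T T' : Matrix (Fin 2) (Fin 2) ℚ}
    (h : IsTm D Dt s Δ m n μ T) (h' : IsTm D Dt s Δ m n μ T') : T = T' := by
  have hirr : ∀ a b : ℚ, (a : F) = b * s → a = 0 ∧ b = 0 := by
    intro a b hab
    by_cases hb : b = 0
    · subst hb
      simpa using hab
    · exfalso
      have h1 : a ^ 2 = b ^ 2 * (D : ℚ) := by
        have : ((a ^ 2 : ℚ) : F) = ((b ^ 2 * (D : ℚ) : ℚ) : F) := by
          push_cast
          rw [hab, mul_pow, hs]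
        exact_mod_cast this
      have h2 : IsSquare ((D : ℕ) : ℚ) := ⟨a / b, by field_simp; linarith⟩
      rw [Rat.isSquare_natCast_iff] at h2
      exact hD.prime.not_isSquare h2
  have hD0 : (D : ℚ) ≠ 0 := by exact_mod_cast hD.ne_zero
  have key : ((D * T' 1 1 - D * T 1 1 : ℚ) : F) =
      ((2 * T 0 1 + D * T 1 1 - (2 * T' 0 1 + D * T' 1 1) : ℚ) : F) * s := by
    have := h.delta_eq.symm.trans h'.delta_eq
    push_cast at this ⊢
    linear_combination 2 * this
  obtain ⟨k1, k2⟩ := hirr _ _ key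
  have e11 : T 1 1 = T' 1 1 := by
    have : (D : ℚ) * (T' 1 1 - T 1 1) = 0 := by linear_combination k1
    rcases mul_eq_zero.1 this with h0 | h0
    · exact absurd h0 hD0
    · linarith
  have e01 : T 0 1 = T' 0 1 := by
    rw [e11] at k2
    linarith
  have e00 : T 0 0 = T' 0 0 := by
    have := h.trace_eq.symm.trans h'.trace_eq
    rw [e11, e01] at this
    linarith
  have e10 : T 1 0 = T' 1 0 := by
    rw [← h.symm.apply 0 1, ← h'.symm.apply 0 1] at e01
    exact e01
  ext i j
  fin_cases i <;> fin_cases j <;> assumption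

open Classical in
/-- The signs over which the sum `∑_μ` runs: both signs if `D ∣ n`, and otherwise the sign for
which `T_m(μ n)` exists. -/
def signs {F : Type*} [Field F] [CharZero F] (D Dt : ℕ) (s Δ : F) (m n : ℕ) : Finset ℤˣ :=
  Finset.univ.filter fun μ => D ∣ n ∨ ∃ T, IsTm D Dt s Δ m n μ T

/-! ### The local factors -/

instance factPrime (l : Nat.Primes) : Fact (l : ℕ).Prime := ⟨l.2⟩

open Classical in
/-- The Hilbert symbol `(a, b)_l` over `ℚ_l`. -/
def hilbertSymbol (l : ℕ) [Fact l.Prime] (a b : ℚ_[l]) : ℤ :=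
  if ∃ x y z : ℚ_[l], (x ≠ 0 ∨ y ≠ 0 ∨ z ≠ 0) ∧ z ^ 2 = a * x ^ 2 + b * y ^ 2 then 1 else -1

/-- `T` is `ℤ_l`-equivalent to `diag(α, α⁻¹ det T)`. -/
def IsEquivDiag (l : ℕ) [Fact l.Prime] (T : Matrix (Fin 2) (Fin 2) ℚ) (α : ℤ_[l]ˣ) : Prop :=
  ∃ g : GL (Fin 2) ℤ_[l],
    (g : Matrix (Fin 2) (Fin 2) ℤ_[l]).map (fun x => (x : ℚ_[l])) *
        T.map (fun x => (x : ℚ_[l])) *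
        ((g : Matrix (Fin 2) (Fin 2) ℤ_[l]).map (fun x => (x : ℚ_[l]))).transpose =
      Matrix.diagonal ![((α : ℤ_[l]) : ℚ_[l]), ((α : ℤ_[l]) : ℚ_[l])⁻¹ * (T.det : ℚ_[l])]

/-- The integers `n` with `0 < n < m √D̃` and `(m² D̃ - n²) / (4D) ∈ p ℤ_{>0}`. -/
def nRange (D Dt m p : ℕ) : Finset ℕ :=
  (Finset.range (m * Dt + 1)).filter fun n =>
    0 < n ∧ n ^ 2 < m ^ 2 * Dt ∧ 4 * D * p ∣ m ^ 2 * Dt - n ^ 2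

/-- `(m² D̃ - n²) / (4D)`; only used for `n ∈ nRange D Dt m p`, where the division is exact. -/
def quot (D Dt m n : ℕ) : ℕ := (m ^ 2 * Dt - n ^ 2) / (4 * D)

/-- `t_l = ord_l ((m² D̃ - n²) / (4 D m²))`. -/
def tOrd (D Dt m n l : ℕ) : ℤ :=
  padicValRat l (((m : ℚ) ^ 2 * Dt - (n : ℚ) ^ 2) / (4 * D * (m : ℚ) ^ 2))

open Classical in
/-- The local factor `b_l(p, μ n, m)`, in which `ε` stands for the Hilbert symbol `(-α_l, l)_l`.
If `l ∣ m` and `t_l = 0`, it does not depend on `ε`. The last branch does not occur for primes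
`l ∤ D`, which are split or inert in `F = ℚ(√D)`. -/
def localFactor {K : Type*} [Field K] [NumberField K] (Φ : Finset (K →+* ℂ))
    (D Dt m p n l : ℕ) (ε : ℤ) : ℚ :=
  if ¬ l ∣ m then
    if l = p then (1 - (ε : ℚ) ^ tOrd D Dt m n l) / 2
    else if ε = 1 then tOrd D Dt m n l + 1
    else (1 + (-1) ^ tOrd D Dt m n l) / 2
  else if tOrd D Dt m n l = 0 then
    if SplitsCompletely (galoisClosure K) l then 4
    else if IsInertPrime (tildeF Φ Dt) l ∧
      IsSplit (tildeF Φ Dt) (reflexField Φ) (Ideal.span {(l : 𝓞 (tildeF Φ Dt))}) then 2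
    else 0
  else if SplitsCompletely (NumberField.maximalRealSubfield K) l then
    if ε = 1 then 2 * (tOrd D Dt m n l + 2) else 0
  else if IsInertPrime (NumberField.maximalRealSubfield K) l then
    if ε = -1 then 1 - (-1) ^ tOrd D Dt m n l else 0
  else 0

end CMIntersection

end

open scoped NumberField nonZeroDivisors

noncomputable section

namespace CMIntersection

/-! ### Splitting of primes in a quadratic Galois extension of Dedekind domains -/

section QuadraticGalois

open scoped Pointwise

variable {A B : Type*} [CommRing A] [IsDedekindDomain A] [CommRing B] [IsDedekindDomain B]
  [Algebra A B] [Module.Finite A B] [Module.IsTorsionFree A B]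
  (G : Type*) [Group G] [Finite G] [MulSemiringAction G B] [IsGaloisGroup G A B]

/-! Write Δ = (x + y√D)/2, so that x² − D y² = 4 D̃, and δ = √Δ. Let σ₁, σ₂ be the members of Φ with
√D ↦ √D and √D ↦ −√D, and put r = σ₁δ·σ₂δ = ±√D̃, ξ = σ₁δ + σ₂δ, ζ = √D (σ₁δ − σ₂δ), η = (ζ − ξ)/2.
Then ξ² = x + 2r, ζ² = D(x − 2r), ξζ = D y, F̃ = ℚ(r) and K̃ = F̃(ξ). Type traces of elements of 𝓞_K
show that ξ, ζ and η become divisible by 2 after adding rational integers, so ξ², ζ², η² are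
discriminants of integral quadratic polynomials generating K̃ over F̃ (`exists_reflexDatum`).
Outside 𝔡 = (D, x + 2r) one of ξ², η² is a unit, while 𝔡 ramifies; hence d = 𝔡, a prime of norm D,
and 𝔡𝔡' = (D) for 𝔡' = (D, x − 2r) (`relDiscr_eq`).

Up to sign, t = (m r − k)/(2D) for an integer k, and t ∈ d⁻¹ means 2 ∣ m + k and D ∣ 2k − m x. With
ω = (1 + r)/2 and e = (m + k)/2 one has (mω − e) = I𝔡', so I = t d is integral of norm (m² D̃ −
k²)/(4D). The congruence modulo D is exactly the integrality of the entry C of m T_m(k) = (A, B; B,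
C), so the sum over t is a sum over the pairs (n, μ) with k = μn (`tSet_eq_image`, `mem_signs_iff`,
`finsum_numeratorSet`).

The ideals of norm I𝔭⁻¹ are counted prime by prime (`normCount_prod`): a prime v with exponent j
contributes j + 1 if it splits in K̃, and otherwise 1 or 0 as j is even or odd. If l ∤ m, then mω −
e is primitive at l, so one prime v above l divides I; it has degree one and exponent ord_l N(I). If
l ∣ m and l ∣ N(I), then I = l I₁ with I₁ the numerator belonging to m/l and k/l. For t_l > 0 one
prime v above l has exponent t_l + 1 and its conjugate has exponent 1; for t_l = 0 all primes above
l have exponent 1. At v₀ ∣ p the exponent drops by one, and the term vanishes if v₀ splits.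

It remains to read the splitting of v from T. Since mω − e ∈ v, the elements mη² and mζ² are
congruent modulo 4v to −A and −D²C, so v splits iff −mA (or −mD²C) is a square modulo 4l. As AC − B²
is divisible by 4l, completing the square shows that −α_l lies in the same square class, whence v
splits iff (−α_l, l)_l = 1 (`isEquivDiag_and_split_iff`). Finally (x + 2r)(x − 2r) = D y² shows that
v and its conjugate behave alike iff D is a square modulo l (`split_conj_iff`), and the conjugates
of ξ generate M, which translates complete splitting in M (`splitsCompletely_iff`). -/

lemma ncard_mul_ramification_mul_inertia (hG : Nat.card G = 2) (p : Ideal A) [p.IsPrime]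
    (P : Ideal B) [P.IsPrime] [P.LiesOver p] :
    (p.primesOver B).ncard * (P.ramificationIdx A * P.inertiaDeg A) = 2 := by
  rw [← Ideal.ramificationIdxIn_eq_ramificationIdx p P G,
    ← Ideal.inertiaDegIn_eq_inertiaDeg p P G,
    Ideal.ncard_primesOver_mul_ramificationIdxIn_mul_inertiaDegIn p B G, hG]

include G in
lemma ncard_primesOver_eq_one_or_two (hG : Nat.card G = 2) (p : Ideal A) [p.IsPrime] :
    (p.primesOver B).ncard = 1 ∨ (p.primesOver B).ncard = 2 := by
  obtain ⟨P⟩ := (inferInstance : Nonempty (Ideal.primesOver p B))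
  have h := ncard_mul_ramification_mul_inertia G hG p P.1
  exact (Nat.dvd_prime Nat.prime_two).1 (Dvd.intro _ h)

-- The group permutes the two roots φ and a − φ; if no element exchanged them, φ would be invariant
-- and hence come from A.
omit [IsDedekindDomain A] [IsDedekindDomain B] [Module.Finite A B] [Module.IsTorsionFree A B]
  [Finite G] in
lemma exists_conj_eq_sub [IsDomain B] {a b : A} {φ : B}
    (hφ : φ ^ 2 - algebraMap A B a * φ + algebraMap A B b = 0)
    (hφA : φ ∉ (algebraMap A B).range) : ∃ g : G, g • φ = algebraMap A B a - φ := by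
  by_contra! hne
  have hG := (inferInstance : IsGaloisGroup G A B)
  have hcomm := hG.commutes
  have hinv := hG.isInvariant
  apply hφA
  have hfix : ∀ g : G, g • φ = φ := by
    intro g
    have h1 : (g • φ) ^ 2 - algebraMap A B a * (g • φ) + algebraMap A B b = 0 := by
      have := congrArg (fun u => g • u) hφ
      simpa [smul_add, smul_sub, smul_mul', smul_algebraMap, smul_pow'] using this
    have h2 : (g • φ - φ) * (g • φ - (algebraMap A B a - φ)) = 0 := by
      linear_combination h1 - hφ
    rcases mul_eq_zero.1 h2 with h | h
    · exact sub_eq_zero.1 h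
    · exact absurd (sub_eq_zero.1 h) (hne g)
  obtain ⟨c, hc⟩ := hinv.isInvariant φ hfix
  exact ⟨c, hc⟩

include G in
/-- A root of the minimal polynomial modulo `p` forces `p` to split, if the discriminant is
prime to `p`. -/
lemma ncard_primesOver_eq_two_of_root (hG : Nat.card G = 2) (p : Ideal A) [p.IsPrime]
    {a b : A} {φ : B} (hφ : φ ^ 2 - algebraMap A B a * φ + algebraMap A B b = 0)
    (hφA : φ ∉ (algebraMap A B).range) (hd : a ^ 2 - 4 * b ∉ p) {z : A}
    (hz : z ^ 2 - a * z + b ∈ p) : (p.primesOver B).ncard = 2 := by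
  refine (ncard_primesOver_eq_one_or_two G hG p).resolve_left fun h1 => ?_
  have hGal := (inferInstance : IsGaloisGroup G A B)
  have hcomm := hGal.commutes
  obtain ⟨P, hP⟩ := Set.ncard_eq_one.1 h1
  have hPm : P ∈ p.primesOver B := hP ▸ Set.mem_singleton P
  have := hPm.1
  have := hPm.2
  obtain ⟨g, hg⟩ := exists_conj_eq_sub (A := A) G hφ hφA
  have hgP : g • P = P := by
    have : g • P ∈ p.primesOver B := ⟨inferInstance, inferInstance⟩
    rw [hP] at this
    exact this
  have hmem : ∀ u ∈ P, g • u ∈ P := fun u hu => by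
    have := Ideal.smul_mem_pointwise_smul g u P hu
    rwa [hgP] at this
  have hprod : (φ - algebraMap A B z) * (φ - algebraMap A B (a - z)) ∈ P := by
    have h2 : algebraMap A B (z ^ 2 - a * z + b) ∈ P := (Ideal.mem_of_liesOver P p _).1 hz
    have h3 : (φ - algebraMap A B z) * (φ - algebraMap A B (a - z)) =
        -algebraMap A B (z ^ 2 - a * z + b) := by
      simp only [map_add, map_sub, map_mul, map_pow]
      linear_combination hφ
    rw [h3]
    exact neg_mem h2
  -- The only prime P above p is stable under g, so together with φ − z (or φ − (a − z)) it contains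
  -- its conjugate. The difference is 2φ − a, whose square is the discriminant.
  have key : 2 * φ - algebraMap A B a ∈ P := by
    rcases (inferInstance : P.IsPrime).mem_or_mem hprod with h | h
    · have h' := hmem _ h
      rw [smul_sub, hg, smul_algebraMap] at h'
      have := sub_mem h h'
      convert this using 1
      ring
    · have h' := hmem _ h
      rw [smul_sub, hg, smul_algebraMap] at h'
      have := sub_mem h h'
      convert this using 1
      simp only [map_sub]
      ring
  apply hd
  rw [Ideal.mem_of_liesOver P p]
  have h4 : algebraMap A B (a ^ 2 - 4 * b) = (2 * φ - algebraMap A B a) ^ 2 := by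
    simp only [map_sub, map_mul, map_pow, map_ofNat]
    linear_combination (-4) * hφ
  rw [h4]
  exact Ideal.pow_mem_of_mem P key 2 two_pos

omit [IsDedekindDomain A] [IsDedekindDomain B] [Module.Finite A B]
  [Module.IsTorsionFree A B] in
lemma exists_sub_mem_of_inertiaDeg_eq_one (p : Ideal A) [p.IsMaximal] (P : Ideal B) [P.IsMaximal]
    [P.LiesOver p] (h : P.inertiaDeg A = 1) (φ : B) : ∃ z : A, φ - algebraMap A B z ∈ P := by
  let : Field (A ⧸ p) := Ideal.Quotient.field p
  rw [Ideal.inertiaDeg_eq_of_isMaximal p P] at h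
  have h1 : (1 : B ⧸ P) ≠ 0 := one_ne_zero
  obtain ⟨c, hc⟩ := (finrank_eq_one_iff_of_nonzero' (1 : B ⧸ P) h1).1 h (Ideal.Quotient.mk P φ)
  obtain ⟨z, rfl⟩ := Ideal.Quotient.mk_surjective c
  refine ⟨z, ?_⟩
  rw [← Ideal.Quotient.eq_zero_iff_mem, map_sub, ← hc, Algebra.smul_def, mul_one,
    Ideal.Quotient.algebraMap_mk_of_liesOver, sub_self]

omit [IsDedekindDomain A] [IsDedekindDomain B] [Module.Finite A B]
  [Module.IsTorsionFree A B] in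
lemma exists_root_of_inertiaDeg_eq_one (p : Ideal A) [p.IsMaximal] (P : Ideal B) [P.IsMaximal]
    [P.LiesOver p] (h : P.inertiaDeg A = 1) {a b : A} {φ : B}
    (hφ : φ ^ 2 - algebraMap A B a * φ + algebraMap A B b = 0) :
    ∃ z : A, z ^ 2 - a * z + b ∈ p := by
  obtain ⟨z, hz⟩ := exists_sub_mem_of_inertiaDeg_eq_one p P h φ
  refine ⟨z, ?_⟩
  rw [Ideal.mem_of_liesOver P p]
  have : algebraMap A B (z ^ 2 - a * z + b) =
      (φ - algebraMap A B z) * (algebraMap A B a - φ - algebraMap A B z) := by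
    simp only [map_add, map_sub, map_mul, map_pow]
    linear_combination hφ
  rw [this]
  exact P.mul_mem_right _ hz

include G in
lemma inertiaDeg_eq_one_of_split (hG : Nat.card G = 2) (p : Ideal A) [p.IsPrime]
    (h : (p.primesOver B).ncard = 2) (P : Ideal B) [P.IsPrime] [P.LiesOver p] :
    P.inertiaDeg A = 1 := by
  have h2 := ncard_mul_ramification_mul_inertia G hG p P
  rw [h] at h2
  have h3 : P.ramificationIdx A * P.inertiaDeg A = 1 := by omega
  exact Nat.eq_one_of_mul_eq_one_left h3

include G in
/-- The splitting criterion. -/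
lemma ncard_primesOver_eq_two_iff (hG : Nat.card G = 2) (p : Ideal A) [p.IsMaximal] (hp0 : p ≠ ⊥)
    {a b : A} {φ : B} (hφ : φ ^ 2 - algebraMap A B a * φ + algebraMap A B b = 0)
    (hφA : φ ∉ (algebraMap A B).range) (hd : a ^ 2 - 4 * b ∉ p) :
    (p.primesOver B).ncard = 2 ↔ ∃ z : A, z ^ 2 - a * z + b ∈ p := by
  refine ⟨fun h => ?_, fun ⟨z, hz⟩ => ncard_primesOver_eq_two_of_root G hG p hφ hφA hd hz⟩
  obtain ⟨P⟩ := (inferInstance : Nonempty (Ideal.primesOver p B))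
  have hP0 : P.1 ≠ ⊥ := Ideal.ne_bot_of_liesOver_of_ne_bot hp0 P.1
  have : P.1.IsMaximal := Ring.DimensionLEOne.maximalOfPrime hP0 P.2.1
  exact exists_root_of_inertiaDeg_eq_one p P.1
    (inertiaDeg_eq_one_of_split G hG p h P.1) hφ

-- Residue degree one would give a root of the polynomial modulo p, and a root forces splitting. So
-- the residue degree is two, which leaves no room for ramification.
include G in
lemma inertiaDeg_eq_two_of_not_split (hG : Nat.card G = 2) (p : Ideal A) [p.IsMaximal]
    (hp0 : p ≠ ⊥)
    {a b : A} {φ : B} (hφ : φ ^ 2 - algebraMap A B a * φ + algebraMap A B b = 0)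
    (hφA : φ ∉ (algebraMap A B).range) (hd : a ^ 2 - 4 * b ∉ p)
    (h : (p.primesOver B).ncard ≠ 2) (P : Ideal B) [P.IsPrime] [P.LiesOver p] :
    P.ramificationIdx A = 1 ∧ P.inertiaDeg A = 2 := by
  have hP0 : P ≠ ⊥ := Ideal.ne_bot_of_liesOver_of_ne_bot hp0 P
  have : P.IsMaximal := Ring.DimensionLEOne.maximalOfPrime hP0 ‹_›
  have h2 := ncard_mul_ramification_mul_inertia G hG p P
  rw [(ncard_primesOver_eq_one_or_two G hG p).resolve_right h, one_mul] at h2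
  have hf : P.inertiaDeg A ≠ 1 := fun hf => by
    obtain ⟨z, hz⟩ := exists_root_of_inertiaDeg_eq_one p P hf hφ
    exact h (ncard_primesOver_eq_two_of_root G hG p hφ hφA hd hz)
  have hf2 := ((Nat.dvd_prime Nat.prime_two).1 (Dvd.intro_left _ h2)).resolve_left hf
  rw [hf2] at h2
  exact ⟨by omega, hf2⟩

include G in
lemma map_eq_mul_of_split (hG : Nat.card G = 2) (p : Ideal A) [p.IsMaximal] (hp0 : p ≠ ⊥)
    (h : (p.primesOver B).ncard = 2) :
    ∃ P Q : Ideal B, P.IsPrime ∧ Q.IsPrime ∧ P.LiesOver p ∧ Q.LiesOver p ∧ P ≠ Q ∧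
      p.primesOver B = {P, Q} ∧ p.map (algebraMap A B) = P * Q := by
  classical
  obtain ⟨P, Q, hPQ, hS⟩ := Set.ncard_eq_two.1 h
  have hP : P ∈ p.primesOver B := hS ▸ by simp
  have hQ : Q ∈ p.primesOver B := hS ▸ by simp
  have := hP.1; have := hP.2; have := hQ.1; have := hQ.2
  refine ⟨P, Q, hP.1, hQ.1, hP.2, hQ.2, hPQ, hS, ?_⟩
  have he : ∀ R ∈ p.primesOver B, R.ramificationIdx A = 1 := fun R hR => by
    have := hR.1; have := hR.2
    have h2 := ncard_mul_ramification_mul_inertia G hG p R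
    rw [h] at h2
    exact Nat.eq_one_of_mul_eq_one_right (by omega : R.ramificationIdx A * R.inertiaDeg A = 1)
  have := (Ideal.map_algebraMap_eq_finsetProd_pow (R := B) (p := p) (by simpa using hp0))
  have hSf : (p.primesOver B).toFinset = {P, Q} := by ext; simp [hS]
  rw [this, hSf, Finset.prod_pair hPQ, he P hP, he Q hQ, pow_one, pow_one]

include G in
lemma map_eq_of_inert (hG : Nat.card G = 2) (p : Ideal A) [p.IsMaximal] (hp0 : p ≠ ⊥)
    {a b : A} {φ : B} (hφ : φ ^ 2 - algebraMap A B a * φ + algebraMap A B b = 0)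
    (hφA : φ ∉ (algebraMap A B).range) (hd : a ^ 2 - 4 * b ∉ p)
    (h : (p.primesOver B).ncard ≠ 2) :
    ∃ P : Ideal B, P.IsPrime ∧ P.LiesOver p ∧ p.map (algebraMap A B) = P := by
  classical
  have h1 := (ncard_primesOver_eq_one_or_two G hG p).resolve_right h
  obtain ⟨P, hS⟩ := Set.ncard_eq_one.1 h1
  have hP : P ∈ p.primesOver B := hS ▸ by simp
  have := hP.1; have := hP.2
  refine ⟨P, hP.1, hP.2, ?_⟩
  have := (Ideal.map_algebraMap_eq_finsetProd_pow (R := B) (p := p) (by simpa using hp0))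
  have hSf : (p.primesOver B).toFinset = {P} := by ext; simp [hS]
  rw [this, hSf, Finset.prod_singleton,
    (inertiaDeg_eq_two_of_not_split G hG p hp0 hφ hφA hd h P).1, pow_one]

end QuadraticGalois

/-! ### Counting ideals of given relative norm -/

section RelativeNormCount

variable {A B : Type*} [CommRing A] [IsDedekindDomain A] [CommRing B] [IsDedekindDomain B]
  [Algebra A B] [Module.Finite A B] [Module.IsTorsionFree A B]

variable (B) in
/-- The number of ideals of `B` with relative norm `I`. -/
def normCount (I : Ideal A) : ℕ := Nat.card {J : Ideal B // Ideal.relNorm A J = I}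

variable (B) in
/-- The number of ideals with relative norm `p ^ k` if `p` is an unramified prime of a quadratic
extension. -/
def localCount (p : Ideal A) (k : ℕ) : ℕ :=
  open Classical in if (p.primesOver B).ncard = 2 then k + 1 else if Even k then 1 else 0

variable (B) in
/-- Above `p`, the extension is generated by a root of a quadratic polynomial with discriminant
prime to `p`. -/
def IsGood (p : Ideal A) : Prop :=
  ∃ (a b : A) (φ : B), φ ^ 2 - algebraMap A B a * φ + algebraMap A B b = 0 ∧
    φ ∉ (algebraMap A B).range ∧ a ^ 2 - 4 * b ∉ p

lemma map_relNorm_le (J : Ideal B) : (Ideal.relNorm A J).map (algebraMap A B) ≤ J :=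
  Ideal.map_le_iff_le_comap.2 (Ideal.relNorm_le_comap A J)

lemma isCoprime_of_relNorm {J K : Ideal B}
    (h : IsCoprime (Ideal.relNorm A J) (Ideal.relNorm A K)) : IsCoprime J K := by
  rw [Ideal.isCoprime_iff_sup_eq] at h ⊢
  rw [eq_top_iff, ← Ideal.map_top (algebraMap A B), ← h, Ideal.map_sup]
  exact sup_le_sup (map_relNorm_le J) (map_relNorm_le K)

lemma relNorm_sup_dvd (J : Ideal B) (I : Ideal A) :
    Ideal.relNorm A (J ⊔ I.map (algebraMap A B)) ∣ I ^ Module.finrank A B := by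
  rw [← Ideal.relNorm_algebraMap B I]
  exact map_dvd _ (Ideal.dvd_iff_le.2 le_sup_right)

/-- Multiplication of ideals is the bijection; its inverse sends J to the pair J + I₁B, J + I₂B. The
norm of J + IᵢB divides a power of Iᵢ, so coprimality identifies the two norms. -/
lemma normCount_mul {I₁ I₂ : Ideal A} (h : IsCoprime I₁ I₂) :
    normCount B (I₁ * I₂) = normCount B I₁ * normCount B I₂ := by
  unfold normCount
  rw [← Nat.card_prod]
  symm
  refine Nat.card_congr (Equiv.ofBijective
    (fun x : {J : Ideal B // Ideal.relNorm A J = I₁} × {J : Ideal B // Ideal.relNorm A J = I₂} =>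
      (⟨x.1.1 * x.2.1, by rw [map_mul, x.1.2, x.2.2]⟩ :
        {J : Ideal B // Ideal.relNorm A J = I₁ * I₂})) ⟨?_, ?_⟩)
  · rintro ⟨⟨J₁, h₁⟩, ⟨J₂, h₂⟩⟩ ⟨⟨K₁, h₁'⟩, ⟨K₂, h₂'⟩⟩ he
    have he' : J₁ * J₂ = K₁ * K₂ := congrArg Subtype.val he
    have c1 : IsCoprime J₁ K₂ := isCoprime_of_relNorm (by rwa [h₁, h₂'])
    have c2 : IsCoprime K₁ J₂ := isCoprime_of_relNorm (by rwa [h₁', h₂])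
    have e1 : J₁ = K₁ := dvd_antisymm
      (c1.dvd_of_dvd_mul_right (Dvd.intro _ he')) (c2.dvd_of_dvd_mul_right (Dvd.intro _ he'.symm))
    have e2 : J₂ = K₂ := dvd_antisymm
      (c2.symm.dvd_of_dvd_mul_left (Dvd.intro_left _ he'))
      (c1.symm.dvd_of_dvd_mul_left (Dvd.intro_left _ he'.symm))
    subst e1 e2
    rfl
  · rintro ⟨J, hJ⟩
    set J₁ := J ⊔ I₁.map (algebraMap A B) with hJ₁
    set J₂ := J ⊔ I₂.map (algebraMap A B) with hJ₂
    have hmul : J₁ * J₂ = J := by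
      apply le_antisymm
      · have h3 : I₁.map (algebraMap A B) * I₂.map (algebraMap A B) ≤ J := by
          rw [← Ideal.map_mul, ← hJ]
          exact map_relNorm_le J
        rw [hJ₁, hJ₂, Ideal.sup_mul, Ideal.mul_sup, Ideal.mul_sup]
        exact sup_le (sup_le Ideal.mul_le_right Ideal.mul_le_left)
          (sup_le Ideal.mul_le_right h3)
      · have htop : I₁.map (algebraMap A B) ⊔ I₂.map (algebraMap A B) = ⊤ := by
          rw [← Ideal.map_sup, Ideal.isCoprime_iff_sup_eq.1 h, Ideal.map_top]
        calc J = J * (I₁.map (algebraMap A B) ⊔ I₂.map (algebraMap A B)) := by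
              rw [htop, Ideal.mul_top]
          _ ≤ J₁ * J₂ := by
              rw [Ideal.mul_sup]
              refine sup_le ?_ ?_
              · rw [mul_comm]
                exact Ideal.mul_mono le_sup_right le_sup_left
              · exact Ideal.mul_mono le_sup_left le_sup_right
    have hN : Ideal.relNorm A J₁ * Ideal.relNorm A J₂ = I₁ * I₂ := by rw [← map_mul, hmul, hJ]
    have c1 : IsCoprime (Ideal.relNorm A J₁) I₂ :=
      (h.pow_left).of_isCoprime_of_dvd_left (relNorm_sup_dvd J I₁)
    have c2 : IsCoprime I₁ (Ideal.relNorm A J₂) :=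
      (h.pow_right).of_isCoprime_of_dvd_right (relNorm_sup_dvd J I₂)
    have e1 : Ideal.relNorm A J₁ = I₁ := dvd_antisymm
      (c1.dvd_of_dvd_mul_right (Dvd.intro _ hN)) (c2.dvd_of_dvd_mul_right (Dvd.intro _ hN.symm))
    have e2 : Ideal.relNorm A J₂ = I₂ := dvd_antisymm
      (c2.symm.dvd_of_dvd_mul_left (Dvd.intro_left _ hN))
      (c1.symm.dvd_of_dvd_mul_left (Dvd.intro_left _ hN.symm))
    exact ⟨⟨⟨J₁, e1⟩, ⟨J₂, e2⟩⟩, Subtype.ext hmul⟩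

lemma normCount_one : normCount B (1 : Ideal A) = 1 := by
  unfold normCount
  have : ∀ J : Ideal B, Ideal.relNorm A J = 1 ↔ J = ⊤ := by
    intro J
    refine ⟨fun h => ?_, fun h => by rw [h, Ideal.relNorm_top, Ideal.one_eq_top]⟩
    have := map_relNorm_le (A := A) J
    rwa [h, Ideal.one_eq_top, Ideal.map_top, top_le_iff] at this
  simp_rw [this]
  exact Nat.card_unique

lemma pow_left_inj_of_maximal (p : Ideal A) [p.IsMaximal] (hp0 : p ≠ ⊥) {i j : ℕ}
    (h : p ^ i = p ^ j) : i = j :=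
  (Ideal.pow_right_strictAnti p hp0 (Ideal.IsMaximal.ne_top ‹_›)).injective h

variable [PerfectField (FractionRing A)]
variable (G : Type*) [Group G] [Finite G] [MulSemiringAction G B] [IsGaloisGroup G A B]

-- An ideal of norm p^k divides (pB)^k, so only primes above p occur in it. If pB = PQ, the
-- candidates are P^i Q^(k − i); if pB is a prime P, the norm of P^i is p^(2i).
include G in
lemma normCount_pow (hG : Nat.card G = 2) (p : Ideal A) [p.IsMaximal] (hp0 : p ≠ ⊥)
    (hgood : IsGood B p) (k : ℕ) : normCount B (p ^ k) = localCount B p k := by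
  have hmaxl : ∀ P : Ideal B, P.IsPrime → P.LiesOver p → P ≠ ⊥ ∧ P.IsMaximal := by
    intro P h1 h2
    have hP0 : P ≠ ⊥ := Ideal.ne_bot_of_liesOver_of_ne_bot hp0 P
    exact ⟨hP0, Ring.DimensionLEOne.maximalOfPrime hP0 h1⟩
  have hdvd : ∀ J : Ideal B, Ideal.relNorm A J = p ^ k → J ∣ (p.map (algebraMap A B)) ^ k := by
    intro J hJ
    rw [← Ideal.map_pow, ← hJ, Ideal.dvd_iff_le]
    exact map_relNorm_le J
  obtain ⟨a, b, φ, hφ, hφA, hd⟩ := hgood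
  unfold localCount
  split_ifs with hs he
  · obtain ⟨P, Q, hP, hQ, hPp, hQp, hPQ, -, hmap⟩ := map_eq_mul_of_split G hG p hp0 hs
    obtain ⟨hP0, hPm⟩ := hmaxl P hP hPp
    obtain ⟨hQ0, hQm⟩ := hmaxl Q hQ hQp
    have nP : Ideal.relNorm A P = p := by
      rw [Ideal.relNorm_eq_pow_of_isMaximal P p, inertiaDeg_eq_one_of_split G hG p hs P, pow_one]
    have nQ : Ideal.relNorm A Q = p := by
      rw [Ideal.relNorm_eq_pow_of_isMaximal Q p, inertiaDeg_eq_one_of_split G hG p hs Q, pow_one]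
    have hPpr : Prime P := Ideal.prime_of_isPrime hP0 hP
    have hQpr : Prime Q := Ideal.prime_of_isPrime hQ0 hQ
    have hcard : Nat.card (Fin (k + 1)) = k + 1 := by simp
    rw [← hcard]
    unfold normCount
    symm
    refine Nat.card_congr (Equiv.ofBijective (fun i : Fin (k + 1) =>
      (⟨P ^ (i : ℕ) * Q ^ (k - i), by
        rw [map_mul, map_pow, map_pow, nP, nQ, ← pow_add, Nat.add_sub_of_le (by omega)]⟩ :
        {J : Ideal B // Ideal.relNorm A J = p ^ k})) ⟨?_, ?_⟩)
    · have key : ∀ i j : ℕ, i < j → j ≤ k → P ^ i * Q ^ (k - i) ≠ P ^ j * Q ^ (k - j) := by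
        intro i j hij hjk h
        have h1 : P ^ (i + 1) ∣ P ^ i * Q ^ (k - i) := by
          rw [h]
          exact (pow_dvd_pow P (by omega)).mul_right _
        rw [pow_succ, mul_dvd_mul_iff_left (pow_ne_zero _ hPpr.ne_zero)] at h1
        have h2 := hPpr.dvd_of_dvd_pow h1
        exact hPQ (hQm.eq_of_le hPm.ne_top (Ideal.dvd_iff_le.1 h2)).symm
      intro i j hij
      have hij' : P ^ (i : ℕ) * Q ^ (k - i) = P ^ (j : ℕ) * Q ^ (k - j) := congrArg Subtype.val hij
      rcases lt_trichotomy (i : ℕ) j with h | h | h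
      · exact absurd hij' (key _ _ h (by omega))
      · exact Fin.ext h
      · exact absurd hij'.symm (key _ _ h (by omega))
    · rintro ⟨J, hJ⟩
      have h1 := hdvd J hJ
      rw [hmap, mul_pow] at h1
      obtain ⟨J₁, J₂, h₁, h₂, rfl⟩ := exists_dvd_and_dvd_of_dvd_mul h1
      obtain ⟨i, -, hi⟩ := (dvd_prime_pow hPpr _).1 h₁
      obtain ⟨j, -, hj⟩ := (dvd_prime_pow hQpr _).1 h₂
      rw [associated_iff_eq] at hi hj
      subst hi hj
      rw [map_mul, map_pow, map_pow, nP, nQ, ← pow_add] at hJ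
      have := pow_left_inj_of_maximal p hp0 hJ
      exact ⟨⟨i, by omega⟩, Subtype.ext (by simp [← this])⟩
  all_goals
    obtain ⟨P, hP, hPp, hmap⟩ := map_eq_of_inert G hG p hp0 hφ hφA hd hs
    obtain ⟨hP0, hPm⟩ := hmaxl P hP hPp
    have nP : Ideal.relNorm A P = p ^ 2 := by
      rw [Ideal.relNorm_eq_pow_of_isMaximal P p,
        (inertiaDeg_eq_two_of_not_split G hG p hp0 hφ hφA hd hs P).2]
    have hall : ∀ J : Ideal B, Ideal.relNorm A J = p ^ k → ∃ i, J = P ^ i ∧ 2 * i = k := by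
      intro J hJ
      have h1 := hdvd J hJ
      rw [hmap] at h1
      obtain ⟨i, -, hi⟩ := (dvd_prime_pow (Ideal.prime_of_isPrime hP0 hP) _).1 h1
      rw [associated_iff_eq] at hi
      subst hi
      rw [map_pow, nP, ← pow_mul] at hJ
      exact ⟨i, rfl, pow_left_inj_of_maximal p hp0 hJ⟩
    unfold normCount
  · obtain ⟨c, hc⟩ := he
    rw [Nat.card_eq_one_iff_unique]
    refine ⟨⟨fun ⟨J, hJ⟩ ⟨J', hJ'⟩ => ?_⟩, ⟨⟨P ^ c, by rw [map_pow, nP, ← pow_mul, hc]; ring_nf⟩⟩⟩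
    obtain ⟨i, hi, hik⟩ := hall J hJ
    obtain ⟨i', hi', hik'⟩ := hall J' hJ'
    have : i = i' := by omega
    subst this
    exact Subtype.ext (hi.trans hi'.symm)
  · rw [Nat.card_eq_zero]
    left
    refine ⟨fun ⟨J, hJ⟩ => ?_⟩
    obtain ⟨i, -, hik⟩ := hall J hJ
    exact he ⟨i, by omega⟩

include G in
lemma normCount_prod (hG : Nat.card G = 2)
    (S : Finset (IsDedekindDomain.HeightOneSpectrum A))
    (hgood : ∀ v ∈ S, IsGood B v.asIdeal) (k : IsDedekindDomain.HeightOneSpectrum A → ℕ) :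
    normCount B (∏ v ∈ S, v.asIdeal ^ k v) = ∏ v ∈ S, localCount B v.asIdeal (k v) := by
  classical
  induction S using Finset.induction_on with
  | empty => simpa using normCount_one (A := A) (B := B)
  | insert v S hv ih =>
    rw [Finset.prod_insert hv, Finset.prod_insert hv, normCount_mul,
      normCount_pow G hG v.asIdeal v.ne_bot (hgood v (by simp)), ih fun w hw => hgood w (by simp [hw])]
    refine IsCoprime.pow_left (IsCoprime.prod_right fun w hw => IsCoprime.pow_right ?_)
    rw [Ideal.isCoprime_iff_sup_eq]
    refine Ideal.IsMaximal.coprime_of_ne inferInstance inferInstance fun h => hv ?_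
    rwa [IsDedekindDomain.HeightOneSpectrum.ext h]

end RelativeNormCount

/-! ### Exponents of primes in ideals -/

section Factorization

open IsDedekindDomain

variable {A : Type*} [CommRing A] [IsDedekindDomain A]

/-- The exponent of `v` in the factorization of `I`. -/
def ordI (v : HeightOneSpectrum A) (I : Ideal A) : ℕ := multiplicity v.asIdeal I

lemma HeightOneSpectrum.prime' (v : HeightOneSpectrum A) : Prime v.asIdeal :=
  Ideal.prime_of_isPrime v.ne_bot v.isPrime

lemma ordI_eq {v : HeightOneSpectrum A} {k : ℕ} {c : Ideal A} (hc : ¬ v.asIdeal ∣ c) :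
    ordI v (v.asIdeal ^ k * c) = k := by
  refine multiplicity_eq_of_dvd_of_not_dvd (Dvd.intro _ rfl) ?_
  rw [pow_succ, mul_dvd_mul_iff_left (pow_ne_zero _ v.ne_bot)]
  exact hc

lemma exists_eq_pow_ordI_mul (v : HeightOneSpectrum A) {I : Ideal A} (hI : I ≠ ⊥) :
    ∃ c, I = v.asIdeal ^ ordI v I * c ∧ ¬ v.asIdeal ∣ c := by
  have hf : FiniteMultiplicity v.asIdeal I :=
    FiniteMultiplicity.of_prime_left (HeightOneSpectrum.prime' v) hI
  exact hf.exists_eq_pow_mul_and_not_dvd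

lemma ordI_eq_zero {v : HeightOneSpectrum A} {I : Ideal A} (h : ¬ v.asIdeal ∣ I) :
    ordI v I = 0 := by
  simpa using ordI_eq (k := 0) h

lemma ordI_mul (v : HeightOneSpectrum A) {I J : Ideal A} (hI : I ≠ ⊥) (hJ : J ≠ ⊥) :
    ordI v (I * J) = ordI v I + ordI v J := by
  obtain ⟨c, hc, hvc⟩ := exists_eq_pow_ordI_mul v hI
  obtain ⟨d, hd, hvd⟩ := exists_eq_pow_ordI_mul v hJ
  have h : I * J = v.asIdeal ^ (ordI v I + ordI v J) * (c * d) := by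
    conv_lhs => rw [hc, hd]
    ring
  conv_lhs => rw [h]
  exact ordI_eq fun h' => ((HeightOneSpectrum.prime' v).dvd_or_dvd h').elim hvc hvd

lemma not_dvd_of_ne {v w : HeightOneSpectrum A} (h : v ≠ w) : ¬ v.asIdeal ∣ w.asIdeal := by
  intro hd
  exact h (HeightOneSpectrum.ext
    (w.isMaximal.eq_of_le v.isMaximal.ne_top (Ideal.dvd_iff_le.1 hd)).symm)

lemma ordI_self (v : HeightOneSpectrum A) : ordI v v.asIdeal = 1 := by
  have h : ¬ v.asIdeal ∣ 1 := (HeightOneSpectrum.prime' v).not_dvd_one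
  simpa using ordI_eq (k := 1) h

lemma ordI_of_ne {v w : HeightOneSpectrum A} (h : v ≠ w) : ordI v w.asIdeal = 0 :=
  ordI_eq_zero (not_dvd_of_ne h)

lemma eq_prod_pow_ordI {I : Ideal A} (hI : I ≠ ⊥) (S : Finset (HeightOneSpectrum A))
    (hS : ∀ v : HeightOneSpectrum A, v.asIdeal ∣ I → v ∈ S) :
    I = ∏ v ∈ S, v.asIdeal ^ ordI v I := by
  conv_lhs => rw [← Ideal.finprod_heightOneSpectrum_pow_multiplicity hI]
  refine finprod_eq_prod_of_mulSupport_subset _ fun v hv => ?_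
  by_contra h
  refine hv ?_
  have := ordI_eq_zero fun hd => h (hS v hd)
  unfold ordI at this
  simp only [this, pow_zero]

lemma count_coeIdeal (K : Type*) [Field K] [Algebra A K] [IsFractionRing A K]
    (v : HeightOneSpectrum A) {I : Ideal A} (hI : I ≠ ⊥) :
    FractionalIdeal.count K v (I : FractionalIdeal A⁰ K) = ordI v I := by
  classical
  obtain ⟨c, hc, hvc⟩ := exists_eq_pow_ordI_mul v hI
  have hc0 : c ≠ ⊥ := by
    rintro rfl
    exact hvc (dvd_zero _)
  have hc0' : (c : FractionalIdeal A⁰ K) ≠ 0 := by simpa using hc0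
  have hv0 : ((v.asIdeal ^ ordI v I : Ideal A) : FractionalIdeal A⁰ K) ≠ 0 := by
    simpa using pow_ne_zero _ v.ne_bot
  conv_lhs => rw [hc, FractionalIdeal.coeIdeal_mul]
  rw [FractionalIdeal.count_mul K v hv0 hc0', FractionalIdeal.coeIdeal_pow,
    FractionalIdeal.count_pow_self, FractionalIdeal.count_coe K v hc0]
  have := (Associates.count_ne_zero_iff_dvd hc0 (HeightOneSpectrum.irreducible v)).not.2 hvc
  simpa using this

end Factorization

/-! ### The ring of integers of a quadratic field with discriminant ≡ 1 mod 4 -/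

section QuadraticField

lemma exists_add_mul_of_finrank_two {k E : Type*} [Field k] [Field E] [Algebra k E]
    (h2 : Module.finrank k E = 2) {r : E} (hr : r ∉ (algebraMap k E).range) (z : E) :
    ∃ p q : k, z = algebraMap k E p + algebraMap k E q * r := by
  have hli : LinearIndependent k ![(1 : E), r] := by
    rw [LinearIndependent.pair_iff]
    intro s t hst
    simp only [Algebra.smul_def, mul_one] at hst
    by_cases ht : t = 0
    · subst ht
      simpa using hst
    · refine absurd ⟨-s / t, ?_⟩ hr
      have ht' : algebraMap k E t ≠ 0 := by simpa using ht
      rw [map_div₀, map_neg, div_eq_iff ht']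
      linear_combination -hst
  have hfd : FiniteDimensional k E := Module.finite_of_finrank_pos (by omega)
  have hspan := hli.span_eq_top_of_card_eq_finrank (by simp [h2])
  have hz : z ∈ Submodule.span k (Set.range ![(1 : E), r]) := hspan ▸ Submodule.mem_top
  simp only [Matrix.range_cons, Matrix.range_empty, Set.union_empty, Set.singleton_union] at hz
  obtain ⟨p, q, h⟩ := Submodule.mem_span_pair.1 hz
  exact ⟨p, q, by rw [← h, Algebra.smul_def, Algebra.smul_def, mul_one]⟩

lemma exists_algEquiv_neg {k E : Type*} [Field k] [CharZero k] [Field E] [Algebra k E]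
    (h2 : Module.finrank k E = 2) {r : E} (hr : r ∉ (algebraMap k E).range) {d : k}
    (hd : r ^ 2 = algebraMap k E d) : ∃ τ : E ≃ₐ[k] E, τ r = -r := by
  have : Algebra.IsQuadraticExtension k E := ⟨h2⟩
  have hcard : Nat.card (E ≃ₐ[k] E) = 2 := by rw [IsGalois.card_aut_eq_finrank, h2]
  by_contra! hne
  have hsub : ∀ τ : E ≃ₐ[k] E, τ = 1 := by
    intro τ
    have h1 : (τ r) ^ 2 = r ^ 2 := by rw [← map_pow, hd, AlgEquiv.commutes]
    have h3 : τ r = r := (sq_eq_sq_iff_eq_or_eq_neg.1 h1).resolve_right (hne τ)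
    ext z
    obtain ⟨p, q, rfl⟩ := exists_add_mul_of_finrank_two h2 hr z
    simp [h3]
  have : Subsingleton (E ≃ₐ[k] E) := ⟨fun a b => (hsub a).trans (hsub b).symm⟩
  rw [Nat.card_of_subsingleton (1 : E ≃ₐ[k] E)] at hcard
  omega

variable {E : Type*} [Field E] [NumberField E]

/-- The ring of integers of the quadratic field `E` is `ℤ + ℤ ω` with `ω² - ω + c = 0`. -/
structure QuadraticBasis (c : ℤ) (ω : 𝓞 E) : Prop where
  finrank : Module.finrank ℚ E = 2
  eq : ω ^ 2 - ω + c = 0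
  span : ∀ z : 𝓞 E, ∃ a b : ℤ, z = a + b * ω
  indep : ∀ a b : ℤ, (a : 𝓞 E) + b * ω = 0 → a = 0 ∧ b = 0

lemma Rat.exists_int_of_isIntegral {q : ℚ} (h : IsIntegral ℤ (q : E)) : ∃ k : ℤ, q = k := by
  have h1 : IsIntegral ℤ q := by
    refine (isIntegral_algebraMap_iff (algebraMap ℚ E).injective).1 (by simpa using h)
  obtain ⟨k, hk⟩ := IsIntegrallyClosed.isIntegral_iff.1 h1
  exact ⟨k, by simpa using hk.symm⟩

/-- If `q² d` is an integer with `d` squarefree, then `q` is an integer. -/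
lemma Rat.exists_int_of_sq_mul {d : ℕ} (hd : Squarefree d) {q : ℚ} {N : ℤ}
    (h : q ^ 2 * d = N) : ∃ k : ℤ, q = k := by
  have h1 : (q.den : ℤ) ^ 2 ∣ q.num ^ 2 * d := by
    refine ⟨N, ?_⟩
    have hden : (q.den : ℚ) ≠ 0 := by exact_mod_cast q.den_ne_zero
    have : (q.num : ℚ) ^ 2 * d = (q.den : ℚ) ^ 2 * N := by
      rw [← h]
      have hq : q * q.den = q.num := Rat.mul_den_eq_num q
      rw [← hq]
      ring
    exact_mod_cast this
  have h2 : (q.den : ℤ) ^ 2 ∣ (d : ℤ) := by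
    have hcop : IsCoprime ((q.den : ℤ) ^ 2) (q.num ^ 2) :=
      (Int.isCoprime_iff_gcd_eq_one.2 (by simpa [Int.gcd, Nat.coprime_comm] using q.reduced)).pow
    exact hcop.dvd_of_dvd_mul_left h1
  have h3 : q.den * q.den ∣ d := by
    rw [← sq]
    exact_mod_cast h2
  have h4 := Nat.isUnit_iff.1 (hd _ h3)
  exact ⟨q.num, by conv_lhs => rw [← Rat.num_div_den q, h4]; simp⟩

lemma not_mem_range_of_sq_eq {d : ℕ} (hd : Squarefree d) (hd1 : d ≠ 1) {r : E}
    (hr : r ^ 2 = (d : E)) : r ∉ (algebraMap ℚ E).range := by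
  rintro ⟨q, rfl⟩
  have h1 : q ^ 2 = (d : ℚ) := by
    have : ((q ^ 2 : ℚ) : E) = ((d : ℚ) : E) := by simpa using hr
    exact_mod_cast this
  have h2 : IsSquare ((d : ℕ) : ℚ) := ⟨q, by rw [← h1, sq]⟩
  rw [Rat.isSquare_natCast_iff] at h2
  obtain ⟨e, he⟩ := h2
  have := Nat.isUnit_iff.1 (hd e ⟨1, by simpa using he⟩)
  subst this
  exact hd1 (by simpa using he)

/-- For an integral z = p + q r, comparison with the conjugate p − q r makes 2p and (2q)² d
integers; since d is squarefree, 2q is an integer too. The norm then forces 2p and 2q to have the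
same parity. -/
lemma exists_quadraticBasis (h2 : Module.finrank ℚ E = 2) {d : ℕ} (hd : Squarefree d)
    (hd1 : d ≠ 1) (hd4 : d % 4 = 1) {r : E} (hr : r ^ 2 = (d : E)) :
    ∃ (c : ℤ) (ω : 𝓞 E), QuadraticBasis c ω ∧ (d : ℤ) = 1 - 4 * c ∧ 2 * algebraMap (𝓞 E) E ω - 1 = r := by
  have hrr := not_mem_range_of_sq_eq hd hd1 hr
  obtain ⟨τ, hτ⟩ := exists_algEquiv_neg h2 hrr (d := (d : ℚ)) (by simpa using hr)
  obtain ⟨c, hc⟩ : ∃ c : ℤ, (d : ℤ) = 1 - 4 * c := ⟨-((d : ℤ) / 4), by omega⟩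
  have hcE : (d : E) = 1 - 4 * c := by exact_mod_cast congrArg (Int.cast : ℤ → E) hc
  have hωeq : ((1 + r) / 2) ^ 2 - (1 + r) / 2 + (c : E) = 0 := by
    field_simp
    linear_combination hr + hcE
  have hωint : IsIntegral ℤ ((1 + r) / 2) := by
    refine ⟨Polynomial.X ^ 2 - Polynomial.X + Polynomial.C c, by monicity!, ?_⟩
    rw [Polynomial.eval₂_add, Polynomial.eval₂_C]
    simpa using hωeq
  obtain ⟨ω, hω⟩ : ∃ ω : 𝓞 E, algebraMap (𝓞 E) E ω = (1 + r) / 2 := ⟨⟨_, hωint⟩, rfl⟩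
  refine ⟨c, ω, ⟨h2, ?_, ?_, ?_⟩, hc, by rw [hω]; ring⟩
  · apply NumberField.RingOfIntegers.coe_injective
    simpa [hω] using hωeq
  · intro z
    obtain ⟨p, q, hz⟩ := exists_add_mul_of_finrank_two h2 hrr (algebraMap (𝓞 E) E z)
    simp only [eq_ratCast] at hz
    have hzi : IsIntegral ℤ (algebraMap (𝓞 E) E z) := z.isIntegral_coe
    have hτz : IsIntegral ℤ (τ (algebraMap (𝓞 E) E z)) := hzi.map (τ.toAlgHom.restrictScalars ℤ)
    have hτz' : τ (algebraMap (𝓞 E) E z) = p - q * r := by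
      rw [hz]
      simp [hτ]
      ring
    obtain ⟨P, hP⟩ : ∃ P : ℤ, 2 * p = P := by
      refine Rat.exists_int_of_isIntegral (E := E) ?_
      have := hzi.add hτz
      rw [hτz', hz] at this
      have e : ((2 * p : ℚ) : E) = p + q * r + (p - q * r) := by push_cast; ring
      rwa [e]
    obtain ⟨Q, hQ⟩ : ∃ Q : ℤ, 2 * q = Q := by
      obtain ⟨N, hN⟩ : ∃ N : ℤ, (2 * q) ^ 2 * d = N := by
        refine Rat.exists_int_of_isIntegral (E := E) ?_
        have := (hzi.sub hτz).pow 2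
        rw [hτz', hz] at this
        have e : (((2 * q) ^ 2 * d : ℚ) : E) = (p + q * r - (p - q * r)) ^ 2 := by
          push_cast
          linear_combination (-4 * (q : E) ^ 2) * hr
        rwa [e]
      exact Rat.exists_int_of_sq_mul hd hN
    obtain ⟨N, hN⟩ : ∃ N : ℤ, p ^ 2 - d * q ^ 2 = N := by
      refine Rat.exists_int_of_isIntegral (E := E) ?_
      have := hzi.mul hτz
      rw [hτz', hz] at this
      have e : ((p ^ 2 - d * q ^ 2 : ℚ) : E) = (p + q * r) * (p - q * r) := by
        push_cast
        linear_combination ((q : E) ^ 2) * hr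
      rwa [e]
    have hpar : P ^ 2 - d * Q ^ 2 = 4 * N := by
      have : ((P ^ 2 - d * Q ^ 2 : ℤ) : ℚ) = ((4 * N : ℤ) : ℚ) := by
        push_cast
        rw [← hP, ← hQ, ← hN]
        ring
      exact_mod_cast this
    -- As d ≡ 1 modulo 4, P² − d Q² = 4N gives P² ≡ Q² modulo 2.
    obtain ⟨a, ha⟩ : ∃ a, P - Q = 2 * a := by
      have h3 : Even (P ^ 2 - Q ^ 2) :=
        ⟨2 * N - 2 * c * Q ^ 2, by rw [hc] at hpar; linear_combination hpar⟩
      rcases Int.even_sub.1 h3 with h4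
      rw [Int.even_pow' two_ne_zero, Int.even_pow' two_ne_zero] at h4
      exact (even_iff_exists_two_mul.1 (Int.even_sub.2 h4))
    refine ⟨a, Q, ?_⟩
    apply NumberField.RingOfIntegers.coe_injective
    simp only [map_add, map_mul, map_intCast, hω]
    have hPE : 2 * (p : E) = P := by exact_mod_cast congrArg (Rat.cast : ℚ → E) hP
    have hQE : 2 * (q : E) = Q := by exact_mod_cast congrArg (Rat.cast : ℚ → E) hQ
    have haE : (P : E) - Q = 2 * a := by exact_mod_cast congrArg (Int.cast : ℤ → E) ha
    rw [hz]
    linear_combination (1 / 2) * hPE + (r / 2) * hQE + (1 / 2) * haE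
  · intro a b hab
    have hab' : (a : E) + b * ((1 + r) / 2) = 0 := by
      have := congrArg (algebraMap (𝓞 E) E) hab
      simpa [hω] using this
    by_cases hb : b = 0
    · subst hb
      simpa using hab'
    · refine absurd ⟨(-2 * a - b) / b, ?_⟩ hrr
      have hb' : (b : E) ≠ 0 := by exact_mod_cast hb
      simp only [eq_ratCast]
      push_cast
      rw [div_eq_iff hb']
      linear_combination (-2) * hab'

namespace QuadraticBasis

variable {c : ℤ} {ω : 𝓞 E} (h : QuadraticBasis c ω)
include h

lemma isGalois : IsGalois ℚ E := by
  have : Algebra.IsQuadraticExtension ℚ E := ⟨h.finrank⟩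
  infer_instance

lemma card_gal : Nat.card Gal(E/ℚ) = 2 := by
  have := h.isGalois
  rw [IsGalois.card_aut_eq_finrank, h.finrank]

lemma not_mem_range : ω ∉ (algebraMap ℤ (𝓞 E)).range := by
  rintro ⟨a, ha⟩
  have := h.indep (-a) 1 (by rw [← ha]; simp)
  exact one_ne_zero this.2

lemma eq_zero' : ω ^ 2 - algebraMap ℤ (𝓞 E) 1 * ω + algebraMap ℤ (𝓞 E) c = 0 := by
  simpa using h.eq

lemma intCast_dvd_iff (l a b : ℤ) : (l : 𝓞 E) ∣ a + b * ω ↔ l ∣ a ∧ l ∣ b := by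
  constructor
  · rintro ⟨z, hz⟩
    obtain ⟨a', b', rfl⟩ := h.span z
    have := h.indep (a - l * a') (b - l * b') (by push_cast; linear_combination hz)
    exact ⟨⟨a', by linarith [this.1]⟩, ⟨b', by linarith [this.2]⟩⟩
  · rintro ⟨⟨a', rfl⟩, ⟨b', rfl⟩⟩
    exact ⟨a' + b' * ω, by push_cast; ring⟩

lemma intCast_dvd_intCast (l a : ℤ) : (l : 𝓞 E) ∣ a ↔ l ∣ a := by
  have := h.intCast_dvd_iff l a 0
  simpa using this

end QuadraticBasis

end QuadraticField

/-! ### Rational primes in a quadratic field -/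

section PrimesOverInt

open IsDedekindDomain

lemma isMaximal_span_natCast {l : ℕ} (hl : l.Prime) : (Ideal.span {(l : ℤ)}).IsMaximal :=
  PrincipalIdealRing.isMaximal_of_irreducible (Nat.prime_iff_prime_int.1 hl).irreducible

lemma span_natCast_ne_bot {l : ℕ} (hl : l.Prime) : Ideal.span {(l : ℤ)} ≠ ⊥ := by
  simpa using hl.ne_zero

variable {E : Type*} [Field E] [NumberField E]

omit [NumberField E] in
lemma map_span_natCast (l : ℕ) :
    (Ideal.span {(l : ℤ)}).map (algebraMap ℤ (𝓞 E)) = Ideal.span {(l : 𝓞 E)} := by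
  rw [Ideal.map_span, Set.image_singleton]
  simp

omit [NumberField E] in
lemma liesOver_of_natCast_mem {l : ℕ} (hl : l.Prime) {P : Ideal (𝓞 E)} (hP : P ≠ ⊤)
    (h : (l : 𝓞 E) ∈ P) : P.LiesOver (Ideal.span {(l : ℤ)}) :=
  (Ideal.liesOver_span_iff hP (Nat.prime_iff_prime_int.1 hl)).2 (by simpa using h)

omit [NumberField E] in
lemma natCast_mem_of_liesOver (l : ℕ) (P : Ideal (𝓞 E)) [P.LiesOver (Ideal.span {(l : ℤ)})] :
    (l : 𝓞 E) ∈ P := by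
  have := (Ideal.mem_of_liesOver P (Ideal.span {(l : ℤ)}) l).1 (Ideal.mem_span_singleton_self _)
  simpa using this

omit [NumberField E] in
lemma exists_prime_natCast_mem (v : HeightOneSpectrum (𝓞 E)) :
    ∃ q : ℕ, q.Prime ∧ (q : 𝓞 E) ∈ v.asIdeal := by
  have : NeZero v.asIdeal := ⟨v.ne_bot⟩
  refine ⟨_, Nat.absNorm_under_prime v.asIdeal, ?_⟩
  have := Ideal.absNorm_mem (Ideal.under ℤ v.asIdeal)
  simpa [Ideal.mem_under] using this

lemma eq_of_natCast_mem {v : HeightOneSpectrum (𝓞 E)} {q l : ℕ} (hq : q.Prime) (hl : l.Prime)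
    (h1 : (q : 𝓞 E) ∈ v.asIdeal) (h2 : (l : 𝓞 E) ∈ v.asIdeal) : q = l := by
  by_contra hne
  have hc : IsCoprime (q : ℤ) (l : ℤ) := Nat.isCoprime_iff_coprime.2 ((Nat.coprime_primes hq hl).2 hne)
  obtain ⟨a, b, hab⟩ := hc
  apply v.isPrime.ne_top
  rw [Ideal.eq_top_iff_one]
  have : (1 : 𝓞 E) = a * q + b * l := by exact_mod_cast (congrArg (Int.cast : ℤ → 𝓞 E) hab).symm
  rw [this]
  exact add_mem (v.asIdeal.mul_mem_left _ h1) (v.asIdeal.mul_mem_left _ h2)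

lemma exists_dvd_of_dvd_absNorm {l : ℕ} (hl : l.Prime) {I : Ideal (𝓞 E)} (hI : I ≠ ⊥)
    (h : l ∣ Ideal.absNorm I) :
    ∃ v : HeightOneSpectrum (𝓞 E), (l : 𝓞 E) ∈ v.asIdeal ∧ v.asIdeal ∣ I := by
  have hfin := Ideal.finite_factors hI
  have hI' := eq_prod_pow_ordI hI hfin.toFinset fun v hv => by simpa using hv
  rw [hI', map_prod, hl.prime.dvd_finsetProd_iff] at h
  obtain ⟨v, hv, hlv⟩ := h
  rw [map_pow] at hlv
  have h1 := hl.dvd_of_dvd_pow hlv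
  obtain ⟨q, hq, hqv⟩ := exists_prime_natCast_mem v
  have := liesOver_of_natCast_mem hq v.isPrime.ne_top hqv
  rw [← Ideal.pow_inertiaDeg q v.asIdeal] at h1
  have h2 := (Nat.prime_dvd_prime_iff_eq hl hq).1 (hl.dvd_of_dvd_pow h1)
  exact ⟨v, h2 ▸ hqv, by simpa using hv⟩

namespace QuadraticBasis

variable {c : ℤ} {ω : 𝓞 E} (h : QuadraticBasis c ω)
include h

lemma ncard_eq_two_iff {l : ℕ} (hl : l.Prime) (hd : ¬ (l : ℤ) ∣ 1 - 4 * c) :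
    ((Ideal.span {(l : ℤ)}).primesOver (𝓞 E)).ncard = 2 ↔ ∃ z : ℤ, (l : ℤ) ∣ z ^ 2 - z + c := by
  have := h.isGalois
  have := isMaximal_span_natCast hl
  rw [ncard_primesOver_eq_two_iff Gal(E/ℚ) h.card_gal _ (span_natCast_ne_bot hl)
    h.eq_zero' h.not_mem_range (by rwa [Ideal.mem_span_singleton, one_pow])]
  simp [Ideal.mem_span_singleton]

/-- Two different primes above `l`. -/
lemma mul_eq_span_of_ne {l : ℕ} (hl : l.Prime) {v w : HeightOneSpectrum (𝓞 E)}
    (hv : (l : 𝓞 E) ∈ v.asIdeal) (hw : (l : 𝓞 E) ∈ w.asIdeal) (hvw : v ≠ w) :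
    v.asIdeal * w.asIdeal = Ideal.span {(l : 𝓞 E)} ∧
      (∀ u : HeightOneSpectrum (𝓞 E), (l : 𝓞 E) ∈ u.asIdeal → u = v ∨ u = w) ∧
      ((Ideal.span {(l : ℤ)}).primesOver (𝓞 E)).ncard = 2 := by
  have := h.isGalois
  have := isMaximal_span_natCast hl
  have hmem : ∀ u : HeightOneSpectrum (𝓞 E), (l : 𝓞 E) ∈ u.asIdeal →
      u.asIdeal ∈ (Ideal.span {(l : ℤ)}).primesOver (𝓞 E) := fun u hu =>
    ⟨u.isPrime, liesOver_of_natCast_mem hl u.isPrime.ne_top hu⟩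
  have hne : v.asIdeal ≠ w.asIdeal := fun e => hvw (HeightOneSpectrum.ext e)
  have h2 : ((Ideal.span {(l : ℤ)}).primesOver (𝓞 E)).ncard = 2 := by
    refine (ncard_primesOver_eq_one_or_two Gal(E/ℚ) h.card_gal _).resolve_left fun h1 => ?_
    obtain ⟨P, hP⟩ := Set.ncard_eq_one.1 h1
    have e1 := hmem v hv
    have e2 := hmem w hw
    rw [hP] at e1 e2
    exact hne (e1.trans e2.symm)
  obtain ⟨P, Q, -, -, -, -, hPQ, hset, hmap⟩ :=
    map_eq_mul_of_split Gal(E/ℚ) h.card_gal _ (span_natCast_ne_bot hl) h2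
  rw [map_span_natCast] at hmap
  have e1 := hmem v hv
  have e2 := hmem w hw
  simp only [hset, Set.mem_insert_iff, Set.mem_singleton_iff] at e1 e2
  have hcase : (v.asIdeal = P ∧ w.asIdeal = Q) ∨ (v.asIdeal = Q ∧ w.asIdeal = P) := by
    rcases e1 with e1 | e1 <;> rcases e2 with e2 | e2
    · exact absurd (e1.trans e2.symm) hne
    · exact Or.inl ⟨e1, e2⟩
    · exact Or.inr ⟨e1, e2⟩
    · exact absurd (e1.trans e2.symm) hne
  refine ⟨?_, fun u hu => ?_, h2⟩
  · rcases hcase with ⟨e1, e2⟩ | ⟨e1, e2⟩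
    · rw [hmap, e1, e2]
    · rw [hmap, e1, e2, mul_comm]
  · have e3 := hmem u hu
    simp only [hset, Set.mem_insert_iff, Set.mem_singleton_iff] at e3
    rcases hcase with ⟨e1, e2⟩ | ⟨e1, e2⟩ <;> rcases e3 with e3 | e3
    · exact Or.inl (HeightOneSpectrum.ext (e3.trans e1.symm))
    · exact Or.inr (HeightOneSpectrum.ext (e3.trans e2.symm))
    · exact Or.inr (HeightOneSpectrum.ext (e3.trans e2.symm))
    · exact Or.inl (HeightOneSpectrum.ext (e3.trans e1.symm))

lemma absNorm_eq_of_ne {l : ℕ} (hl : l.Prime) {v w : HeightOneSpectrum (𝓞 E)}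
    (hv : (l : 𝓞 E) ∈ v.asIdeal) (hw : (l : 𝓞 E) ∈ w.asIdeal) (hvw : v ≠ w) :
    Ideal.absNorm v.asIdeal = l := by
  have := h.isGalois
  have := isMaximal_span_natCast hl
  have := liesOver_of_natCast_mem hl v.isPrime.ne_top hv
  rw [← Ideal.pow_inertiaDeg l v.asIdeal, inertiaDeg_eq_one_of_split Gal(E/ℚ) h.card_gal _
    (h.mul_eq_span_of_ne hl hv hw hvw).2.2 v.asIdeal, pow_one]

/-- An ideal not divisible by `l` is divisible by at most one prime above `l`, and that prime has
degree one. -/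
lemma exists_unique_prime {l : ℕ} (hl : l.Prime) {I : Ideal (𝓞 E)} (hI : I ≠ ⊥)
    (hlI : ¬ Ideal.span {(l : 𝓞 E)} ∣ I) (hdvd : l ∣ Ideal.absNorm I) :
    ∃ v : HeightOneSpectrum (𝓞 E), (l : 𝓞 E) ∈ v.asIdeal ∧ v.asIdeal ∣ I ∧
      Ideal.absNorm v.asIdeal = l ∧ ordI v I = padicValNat l (Ideal.absNorm I) ∧
      ∀ w : HeightOneSpectrum (𝓞 E), (l : 𝓞 E) ∈ w.asIdeal → w.asIdeal ∣ I → w = v := by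
  classical
  have := h.isGalois
  have := isMaximal_span_natCast hl
  have hlf : Fact l.Prime := ⟨hl⟩
  obtain ⟨v, hv, hvI⟩ := exists_dvd_of_dvd_absNorm hl hI hdvd
  have huniq : ∀ w : HeightOneSpectrum (𝓞 E), (l : 𝓞 E) ∈ w.asIdeal → w.asIdeal ∣ I → w = v := by
    intro w hw hwI
    by_contra hne
    apply hlI
    rw [← (h.mul_eq_span_of_ne hl hw hv hne).1]
    refine IsCoprime.mul_dvd ?_ hwI hvI
    rw [Ideal.isCoprime_iff_sup_eq]
    exact Ideal.IsMaximal.coprime_of_ne w.isMaximal v.isMaximal fun e =>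
      hne (HeightOneSpectrum.ext e)
  have hlies := liesOver_of_natCast_mem hl v.isPrime.ne_top hv
  -- If there is a second prime above l, both have degree one. If v is alone, degree two would mean
  -- v = (l), which does not divide I; so v has degree one, being ramified.
  have hnorm : Ideal.absNorm v.asIdeal = l := by
    by_cases hw : ∃ w : HeightOneSpectrum (𝓞 E), (l : 𝓞 E) ∈ w.asIdeal ∧ v ≠ w
    · obtain ⟨w, hw, hvw⟩ := hw
      exact h.absNorm_eq_of_ne hl hv hw hvw
    · push Not at hw
      have hset : (Ideal.span {(l : ℤ)}).primesOver (𝓞 E) = {v.asIdeal} := by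
        ext P
        constructor
        · rintro ⟨hP1, hP2⟩
          have hP0 := Ideal.ne_bot_of_liesOver_of_ne_bot (span_natCast_ne_bot hl) P
          exact (congrArg HeightOneSpectrum.asIdeal
            (hw ⟨P, hP1, hP0⟩ (natCast_mem_of_liesOver l P))).symm
        · rintro rfl
          exact ⟨v.isPrime, hlies⟩
      have hef := ncard_mul_ramification_mul_inertia Gal(E/ℚ) h.card_gal (Ideal.span {(l : ℤ)})
        v.asIdeal
      rw [hset, Set.ncard_singleton, one_mul] at hef
      rw [← Ideal.pow_inertiaDeg l v.asIdeal]
      rcases (Nat.dvd_prime Nat.prime_two).1 (Dvd.intro_left _ hef) with hf | hf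
      · rw [hf, pow_one]
      · exfalso
        rw [hf] at hef
        have he : v.asIdeal.ramificationIdx ℤ = 1 := by omega
        apply hlI
        have hprod := Ideal.map_algebraMap_eq_finsetProd_pow (R := 𝓞 E)
          (p := Ideal.span {(l : ℤ)}) (by simpa using hl.ne_zero)
        have hSf : ((Ideal.span {(l : ℤ)}).primesOver (𝓞 E)).toFinset = {v.asIdeal} := by
          ext; simp [hset]
        rw [hSf, Finset.prod_singleton, he, pow_one, map_span_natCast] at hprod
        rwa [hprod]
  refine ⟨v, hv, hvI, hnorm, ?_, huniq⟩
  obtain ⟨C, hC, hvC⟩ := exists_eq_pow_ordI_mul v hI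
  have hC0 : C ≠ ⊥ := by
    rintro rfl
    exact hvC (dvd_zero _)
  have hlC : ¬ l ∣ Ideal.absNorm C := by
    intro hd
    obtain ⟨w, hw, hwC⟩ := exists_dvd_of_dvd_absNorm hl hC0 hd
    have := huniq w hw (hC ▸ hwC.mul_left _)
    exact hvC (this ▸ hwC)
  have hn : Ideal.absNorm I = l ^ ordI v I * Ideal.absNorm C := by
    conv_lhs => rw [hC, map_mul, map_pow, hnorm]
  have hC0' : Ideal.absNorm C ≠ 0 := fun e => hC0 (Ideal.absNorm_eq_zero_iff.1 e)
  rw [hn, padicValNat.mul (pow_ne_zero _ hl.ne_zero) hC0', padicValNat.prime_pow,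
    padicValNat.eq_zero_of_not_dvd hlC, add_zero]

end QuadraticBasis

end PrimesOverInt

open IsDedekindDomain

/-! ### The quadratic extension generated by ξ: integrality and non-degeneracy -/

section Datum

set_option linter.unusedSectionVars false

variable {E L : Type*} [Field E] [NumberField E] [Field L] [NumberField L] [Algebra E L]

/-- The quadratic extension `L / E` of the quadratic field `E = ℚ(r)`, `r = 2 ω - 1`, `r² = D̃`,
generated by `ξ = √(x + 2 r)`; here `ζ = D y / ξ` and `η = (ζ - ξ) / 2`. -/
structure ReflexDatum (D Dt : ℕ) (x y c : ℤ) (ω : 𝓞 E) (ξ ζ η : 𝓞 L) : Prop where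
  basis : QuadraticBasis c ω
  finrank : Module.finrank E L = 2
  prime : D.Prime
  mod_four : D % 4 = 1
  disc : (Dt : ℤ) = 1 - 4 * c
  squarefree : Squarefree Dt
  norm_eq : x ^ 2 - D * y ^ 2 = 4 * Dt
  y_ne_zero : y ≠ 0
  sq_ξ : ξ ^ 2 = algebraMap (𝓞 E) (𝓞 L) (x + 2 * (2 * ω - 1))
  sq_ζ : ζ ^ 2 = algebraMap (𝓞 E) (𝓞 L) (D * (x - 2 * (2 * ω - 1)))
  ξ_mul_ζ : ξ * ζ = D * y
  two_η : 2 * η = ζ - ξ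
  ξ_not_mem : ξ ∉ (algebraMap (𝓞 E) (𝓞 L)).range
  int_ξ : ∃ (w : ℤ) (φ : 𝓞 L), 2 * φ = w + ξ
  int_ζ : ∃ (w : ℤ) (φ : 𝓞 L), 2 * φ = w + ζ
  int_η : ∃ (w : ℤ) (φ : 𝓞 L), 2 * φ = w + η

lemma algebraMap_coe (z : 𝓞 E) : algebraMap (𝓞 L) L (algebraMap (𝓞 E) (𝓞 L) z) =
    algebraMap E L (algebraMap (𝓞 E) E z) := rfl

lemma algebraMap_ringOfIntegers_injective :
    Function.Injective (algebraMap (𝓞 E) (𝓞 L)) := by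
  intro a b hab
  have := congrArg (algebraMap (𝓞 L) L) hab
  rw [algebraMap_coe, algebraMap_coe] at this
  exact NumberField.RingOfIntegers.coe_injective ((algebraMap E L).injective this)

variable (E) in
/-- An algebraic integer of `L` with a nonzero integral multiple in `E` lies in `E`. -/
lemma exists_eq_algebraMap_of_mul {θ : 𝓞 L} {n a : 𝓞 E} (hn : n ≠ 0)
    (h : algebraMap (𝓞 E) (𝓞 L) n * θ = algebraMap (𝓞 E) (𝓞 L) a) :
    ∃ b : 𝓞 E, θ = algebraMap (𝓞 E) (𝓞 L) b ∧ n * b = a := by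
  have hn' : algebraMap (𝓞 E) E n ≠ 0 := by simpa using hn
  have h1 : algebraMap (𝓞 L) L θ =
      algebraMap E L (algebraMap (𝓞 E) E a / algebraMap (𝓞 E) E n) := by
    have h2 := congrArg (algebraMap (𝓞 L) L) h
    rw [map_mul, algebraMap_coe, algebraMap_coe] at h2
    rw [map_div₀, eq_div_iff (by simpa using hn)]
    linear_combination h2
  have hint : IsIntegral ℤ (algebraMap (𝓞 E) E a / algebraMap (𝓞 E) E n) := by
    have h3 : IsIntegral ℤ (algebraMap (𝓞 L) L θ) := θ.isIntegral_coe
    rw [h1] at h3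
    exact (isIntegral_algebraMap_iff (algebraMap E L).injective).1 h3
  obtain ⟨b, hb⟩ : ∃ b : 𝓞 E, algebraMap (𝓞 E) E b =
    algebraMap (𝓞 E) E a / algebraMap (𝓞 E) E n := ⟨⟨_, hint⟩, rfl⟩
  refine ⟨b, NumberField.RingOfIntegers.coe_injective ?_, NumberField.RingOfIntegers.coe_injective ?_⟩
  · rw [h1, algebraMap_coe, hb]
  · rw [map_mul, hb, mul_div_cancel₀ _ hn']

/-- `(w + θ) / 2` is an algebraic integer with trace `w` and discriminant `β = θ²`. -/
def IsHalf (θ : 𝓞 L) (β : 𝓞 E) : Prop :=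
  ∃ (w : ℤ) (b : 𝓞 E) (φ : 𝓞 L), 2 * φ = w + θ ∧
    φ ^ 2 - algebraMap (𝓞 E) (𝓞 L) w * φ + algebraMap (𝓞 E) (𝓞 L) b = 0 ∧
    (w : 𝓞 E) ^ 2 - 4 * b = β ∧ φ ∉ (algebraMap (𝓞 E) (𝓞 L)).range

/-- The norm φ(w − φ) is integral and four times it equals w² − β ∈ 𝓞 E, so it already lies in 𝓞 E.
-/
lemma isHalf_of_sq {θ : 𝓞 L} {β : 𝓞 E} (hθ : θ ^ 2 = algebraMap (𝓞 E) (𝓞 L) β)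
    (hint : ∃ (w : ℤ) (φ : 𝓞 L), 2 * φ = w + θ)
    (hθE : θ ∉ (algebraMap (𝓞 E) (𝓞 L)).range) : IsHalf θ β := by
  obtain ⟨w, φ, hφ⟩ := hint
  have h1 : algebraMap (𝓞 E) (𝓞 L) 4 * (φ * (w - φ)) =
      algebraMap (𝓞 E) (𝓞 L) ((w : 𝓞 E) ^ 2 - β) := by
    rw [map_sub, ← hθ]
    simp only [map_pow, map_ofNat, map_intCast]
    linear_combination (2 * w - 2 * φ - θ - w) * hφ
  obtain ⟨b, hb, hb'⟩ := exists_eq_algebraMap_of_mul E (by norm_num) h1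
  refine ⟨w, b, φ, hφ, ?_, by linear_combination -hb', ?_⟩
  · rw [← hb]
    simp only [map_intCast]
    ring
  · rintro ⟨z, rfl⟩
    exact hθE ⟨2 * z - w, by simp only [map_sub, map_mul, map_ofNat, map_intCast]; linear_combination hφ⟩

lemma intCast_mem_iff {v : HeightOneSpectrum (𝓞 E)} {l : ℕ} (hl : l.Prime)
    (hv : (l : 𝓞 E) ∈ v.asIdeal) (n : ℤ) : (n : 𝓞 E) ∈ v.asIdeal ↔ (l : ℤ) ∣ n := by
  have := liesOver_of_natCast_mem hl v.isPrime.ne_top hv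
  have h := Ideal.mem_of_liesOver v.asIdeal (Ideal.span {(l : ℤ)}) n
  rw [Ideal.mem_span_singleton] at h
  simpa using h.symm

lemma intCast_mem_of_mul_mem {v : HeightOneSpectrum (𝓞 E)} {l : ℕ} (hl : l.Prime)
    (hv : (l : 𝓞 E) ∈ v.asIdeal) {n : ℤ} (hn : ¬ (l : ℤ) ∣ n) {z : 𝓞 E}
    (h : n * z ∈ v.asIdeal) : z ∈ v.asIdeal :=
  (v.isPrime.mem_or_mem h).resolve_left fun h' => hn ((intCast_mem_iff hl hv n).1 h')

namespace ReflexDatum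

variable {D Dt : ℕ} {x y c : ℤ} {ω : 𝓞 E} {ξ ζ η : 𝓞 L} (h : ReflexDatum D Dt x y c ω ξ ζ η)
include h

lemma two_lt : 2 < D := by
  have := h.prime.two_le
  have := h.mod_four
  omega

lemma r_sq : (2 * ω - 1) ^ 2 = (Dt : 𝓞 E) := by
  have h1 := congrArg (Int.cast : ℤ → 𝓞 E) h.disc
  push_cast at h1
  rw [h1]
  linear_combination 4 * h.basis.eq

lemma norm_eq' : (x : 𝓞 E) ^ 2 - D * y ^ 2 = 4 * Dt := by
  have h1 := congrArg (Int.cast : ℤ → 𝓞 E) h.norm_eq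
  push_cast at h1
  exact h1

lemma add_mul_sub : ((x : 𝓞 E) + 2 * (2 * ω - 1)) * (x - 2 * (2 * ω - 1)) = D * y ^ 2 := by
  linear_combination h.norm_eq' - 4 * h.r_sq

/-- An odd common prime factor q would give q² ∣ 4 D̃, although D̃ is squarefree. -/
lemma not_dvd_x_and_y {q : ℕ} (hq : q.Prime) (hq2 : q ≠ 2) : ¬ ((q : ℤ) ∣ x ∧ (q : ℤ) ∣ y) := by
  rintro ⟨⟨a, ha⟩, ⟨b, hb⟩⟩
  have h1 : (q : ℤ) ^ 2 ∣ 4 * Dt := ⟨a ^ 2 - D * b ^ 2, by rw [← h.norm_eq, ha, hb]; ring⟩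
  have h2 : IsCoprime ((q : ℤ) ^ 2) (4 : ℤ) := by
    have : IsCoprime (q : ℤ) (2 : ℤ) :=
      Nat.isCoprime_iff_coprime.2 ((Nat.coprime_primes hq Nat.prime_two).2 hq2)
    have h3 := this.pow (m := 2) (n := 2)
    norm_num at h3
    exact h3
  have h3 : q * q ∣ Dt := by
    have := h2.dvd_of_dvd_mul_left h1
    rw [← sq]
    exact_mod_cast this
  exact hq.one_lt.ne' (Nat.isUnit_iff.1 (h.squarefree q h3))

lemma D_sq_not_dvd : ¬ ((D : ℤ) ∣ x ∧ (D : ℤ) ∣ y) :=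
  h.not_dvd_x_and_y h.prime (by have := h.two_lt; omega)

lemma not_mem_of_mul_ξ {θ : 𝓞 L} {γ : 𝓞 E} (hγ : γ ≠ 0)
    (hθ : θ * ξ = algebraMap (𝓞 E) (𝓞 L) γ) : θ ∉ (algebraMap (𝓞 E) (𝓞 L)).range := by
  rintro ⟨b, rfl⟩
  have hb : b ≠ 0 := by
    rintro rfl
    rw [map_zero, zero_mul] at hθ
    exact hγ (algebraMap_ringOfIntegers_injective (by rw [← hθ, map_zero]))
  obtain ⟨d, hd, -⟩ := exists_eq_algebraMap_of_mul E hb hθ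
  exact h.ξ_not_mem ⟨d, hd.symm⟩

lemma Dy_ne_zero : ((D : 𝓞 E) * y) ≠ 0 := by
  have h1 := h.y_ne_zero
  have h2 := h.prime.ne_zero
  exact mul_ne_zero (by exact_mod_cast h2) (by exact_mod_cast h1)

lemma ζ_not_mem : ζ ∉ (algebraMap (𝓞 E) (𝓞 L)).range :=
  h.not_mem_of_mul_ξ h.Dy_ne_zero (by
    rw [mul_comm, h.ξ_mul_ζ]
    simp only [map_mul, map_natCast, map_intCast])

lemma two_γ_ne_zero : (D : 𝓞 E) * y - (x + 2 * (2 * ω - 1)) ≠ 0 := by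
  intro h0
  have := h.basis.indep (D * y - x + 2) (-4) (by push_cast; linear_combination h0)
  omega

lemma two_η_mul_ξ : 2 * η * ξ =
    algebraMap (𝓞 E) (𝓞 L) ((D : 𝓞 E) * y - (x + 2 * (2 * ω - 1))) := by
  rw [map_sub, ← h.sq_ξ]
  simp only [map_mul, map_natCast, map_intCast]
  linear_combination ξ * h.two_η + h.ξ_mul_ζ

lemma η_not_mem : η ∉ (algebraMap (𝓞 E) (𝓞 L)).range := by
  rintro ⟨z, hz⟩
  exact h.not_mem_of_mul_ξ h.two_γ_ne_zero h.two_η_mul_ξ ⟨2 * z, by rw [map_mul, hz, map_ofNat]⟩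

lemma exists_β_η : ∃ β : 𝓞 E, η ^ 2 = algebraMap (𝓞 E) (𝓞 L) β ∧
    4 * β = D * ((x : 𝓞 E) - 2 * (2 * ω - 1)) - 2 * D * y + (x + 2 * (2 * ω - 1)) := by
  refine exists_eq_algebraMap_of_mul E (by norm_num) ?_
  rw [map_add, map_sub, ← h.sq_ξ, ← h.sq_ζ]
  simp only [map_mul, map_natCast, map_intCast, map_ofNat]
  linear_combination (2 * η + ζ - ξ) * h.two_η - 2 * h.ξ_mul_ζ

lemma exists_γ : ∃ γ : 𝓞 E, η * ξ = algebraMap (𝓞 E) (𝓞 L) γ ∧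
    2 * γ = D * y - (x + 2 * (2 * ω - 1)) := by
  refine exists_eq_algebraMap_of_mul E (by norm_num) ?_
  rw [← h.two_η_mul_ξ, map_ofNat]
  ring

lemma isHalf_ξ : IsHalf ξ ((x : 𝓞 E) + 2 * (2 * ω - 1)) :=
  isHalf_of_sq h.sq_ξ h.int_ξ h.ξ_not_mem

lemma isHalf_ζ : IsHalf ζ ((D : 𝓞 E) * ((x : 𝓞 E) - 2 * (2 * ω - 1))) :=
  isHalf_of_sq h.sq_ζ h.int_ζ h.ζ_not_mem

lemma exists_isHalf_η : ∃ β : 𝓞 E, IsHalf η β ∧ η ^ 2 = algebraMap (𝓞 E) (𝓞 L) β ∧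
    4 * β = D * ((x : 𝓞 E) - 2 * (2 * ω - 1)) - 2 * D * y + (x + 2 * (2 * ω - 1)) := by
  obtain ⟨β, h1, h2⟩ := h.exists_β_η
  exact ⟨β, isHalf_of_sq h1 h.int_η h.η_not_mem, h1, h2⟩

lemma isGalois : IsGalois E L := by
  have : Algebra.IsQuadraticExtension E L := ⟨h.finrank⟩
  infer_instance

lemma card_gal : Nat.card Gal(L/E) = 2 := by
  have := h.isGalois
  rw [IsGalois.card_aut_eq_finrank, h.finrank]

end ReflexDatum

end Datum

open IsDedekindDomain

/-! ### The prime 𝔡 = (D, x + 2r) and the good primes away from it -/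

section Datum

set_option linter.unusedSectionVars false

variable {E L : Type*} [Field E] [NumberField E] [Field L] [NumberField L] [Algebra E L]

lemma IsHalf.isGood {θ : 𝓞 L} {β : 𝓞 E} (hθ : IsHalf θ β) {p : Ideal (𝓞 E)} (hp : β ∉ p) :
    IsGood (𝓞 L) p := by
  obtain ⟨w, b, φ, -, h1, h2, h3⟩ := hθ
  exact ⟨w, b, φ, h1, h3, by rwa [h2]⟩

variable (ω : 𝓞 E) in
/-- The ideal `(D, x + 2 r)`. -/
def dIdeal (D : ℕ) (x : ℤ) : Ideal (𝓞 E) := Ideal.span {(D : 𝓞 E), (x : 𝓞 E) + 2 * (2 * ω - 1)}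

variable (ω : 𝓞 E) in
/-- The conjugate ideal `(D, x - 2 r)`. -/
def dIdeal' (D : ℕ) (x : ℤ) : Ideal (𝓞 E) := Ideal.span {(D : 𝓞 E), (x : 𝓞 E) - 2 * (2 * ω - 1)}

namespace ReflexDatum

variable {D Dt : ℕ} {x y c : ℤ} {ω : 𝓞 E} {ξ ζ η : 𝓞 L} (h : ReflexDatum D Dt x y c ω ξ ζ η)
include h

/-- All products of generators are multiples of D because (x + 2r)(x − 2r) = D y². Conversely the
product contains D², 2Dx and D y², and D does not divide both x and y. -/
lemma dIdeal_mul : dIdeal ω D x * dIdeal' ω D x = Ideal.span {(D : 𝓞 E)} := by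
  have hD : (D : 𝓞 E) ∈ Ideal.span {(D : 𝓞 E)} := Ideal.mem_span_singleton_self _
  apply le_antisymm
  · rw [dIdeal, dIdeal', Ideal.span_pair_mul_span_pair, Ideal.span_le]
    rintro z (rfl | rfl | rfl | rfl)
    · exact Ideal.mul_mem_left _ _ hD
    · exact Ideal.mul_mem_right _ _ hD
    · exact Ideal.mul_mem_left _ _ hD
    · rw [h.add_mul_sub]
      exact Ideal.mul_mem_right _ _ hD
  · rw [Ideal.span_singleton_le_iff_mem]
    have m1 : (D : 𝓞 E) ∈ dIdeal ω D x := Ideal.subset_span (by simp)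
    have m2 : (D : 𝓞 E) ∈ dIdeal' ω D x := Ideal.subset_span (by simp)
    have m3 : (x : 𝓞 E) + 2 * (2 * ω - 1) ∈ dIdeal ω D x := Ideal.subset_span (by simp)
    have m4 : (x : 𝓞 E) - 2 * (2 * ω - 1) ∈ dIdeal' ω D x := Ideal.subset_span (by simp)
    have hDD := Ideal.mul_mem_mul m1 m2
    have hDx : (D : 𝓞 E) * (2 * x) ∈ dIdeal ω D x * dIdeal' ω D x := by
      have := add_mem (Ideal.mul_mem_mul m3 m2) (Ideal.mul_mem_mul m1 m4)
      convert this using 1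
      ring
    have hDy : (D : 𝓞 E) * y ^ 2 ∈ dIdeal ω D x * dIdeal' ω D x := by
      rw [← h.add_mul_sub]
      exact Ideal.mul_mem_mul m3 m4
    have hDp : Prime (D : ℤ) := Nat.prime_iff_prime_int.1 h.prime
    have key : ∀ n : ℤ, ¬ (D : ℤ) ∣ n → (D : 𝓞 E) * n ∈ dIdeal ω D x * dIdeal' ω D x →
        (D : 𝓞 E) ∈ dIdeal ω D x * dIdeal' ω D x := by
      intro n hn hm
      obtain ⟨a, b, hab⟩ := (hDp.irreducible.coprime_iff_not_dvd.2 hn)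
      have : (D : 𝓞 E) = a * (D * D) + b * (D * n) := by
        have := congrArg (Int.cast : ℤ → 𝓞 E) hab
        push_cast at this
        linear_combination -(D : 𝓞 E) * this
      rw [this]
      exact add_mem (Ideal.mul_mem_left _ _ hDD) (Ideal.mul_mem_left _ _ hm)
    by_cases hx : (D : ℤ) ∣ x
    · refine key (y ^ 2) (fun hy => h.D_sq_not_dvd ⟨hx, hDp.dvd_of_dvd_pow hy⟩) ?_
      push_cast
      exact hDy
    · refine key (2 * x) (fun h2 => ?_) (by push_cast; exact hDx)
      rcases hDp.dvd_or_dvd h2 with h3 | h3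
      · have := Int.le_of_dvd two_pos h3
        have := h.two_lt
        omega
      · exact hx h3

lemma not_D_dvd_four : ¬ (D : ℤ) ∣ 4 := by
  intro h3
  have h4 := (Nat.prime_iff_prime_int.1 h.prime).dvd_of_dvd_pow (show (D : ℤ) ∣ 2 ^ 2 from h3)
  have := Int.le_of_dvd two_pos h4
  have := h.two_lt
  omega

/-- The two norms multiply to D². If one of them were 1, the other ideal would be (D); but D does
not divide x ± 2r, whose coefficient at ω is ±4. -/
lemma absNorm_dIdeal : Ideal.absNorm (dIdeal ω D x) = D ∧ Ideal.absNorm (dIdeal' ω D x) = D := by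
  have hprod : Ideal.absNorm (dIdeal ω D x) * Ideal.absNorm (dIdeal' ω D x) = D ^ 2 := by
    rw [← map_mul, h.dIdeal_mul, Ideal.absNorm_span_singleton]
    have : ((D : ℤ) : 𝓞 E) = algebraMap ℤ (𝓞 E) D := by simp
    rw [← Int.cast_natCast (R := 𝓞 E), this, Algebra.norm_algebraMap, Int.natAbs_pow,
      NumberField.RingOfIntegers.rank, h.basis.finrank]
    simp
  have n1 : Ideal.absNorm (dIdeal ω D x) ≠ 1 := by
    intro h1
    rw [Ideal.absNorm_eq_one_iff] at h1
    have h2 := h.dIdeal_mul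
    rw [h1, Ideal.top_mul] at h2
    have m4 : (x : 𝓞 E) - 2 * (2 * ω - 1) ∈ dIdeal' ω D x := Ideal.subset_span (by simp)
    rw [h2, Ideal.mem_span_singleton] at m4
    have h3 := (h.basis.intCast_dvd_iff D (x + 2) (-4)).1 (by
      convert m4 using 1 <;> push_cast <;> ring)
    exact h.not_D_dvd_four (by simpa using h3.2)
  have n2 : Ideal.absNorm (dIdeal' ω D x) ≠ 1 := by
    intro h1
    rw [Ideal.absNorm_eq_one_iff] at h1
    have h2 := h.dIdeal_mul
    rw [h1, Ideal.mul_top] at h2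
    have m4 : (x : 𝓞 E) + 2 * (2 * ω - 1) ∈ dIdeal ω D x := Ideal.subset_span (by simp)
    rw [h2, Ideal.mem_span_singleton] at m4
    have h3 := (h.basis.intCast_dvd_iff D (x - 2) 4).1 (by
      convert m4 using 1 <;> push_cast <;> ring)
    exact h.not_D_dvd_four h3.2
  exact (Nat.Prime.mul_eq_prime_sq_iff h.prime n1 n2).1 hprod

lemma dIdeal_isPrime : (dIdeal ω D x).IsPrime :=
  Ideal.isPrime_of_irreducible_absNorm (by rw [h.absNorm_dIdeal.1]; exact h.prime)

lemma dIdeal_ne_bot : dIdeal ω D x ≠ ⊥ := fun h0 => h.prime.ne_zero (by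
  rw [← h.absNorm_dIdeal.1, h0, Ideal.absNorm_bot])

lemma dIdeal'_ne_bot : dIdeal' ω D x ≠ ⊥ := fun h0 => h.prime.ne_zero (by
  rw [← h.absNorm_dIdeal.2, h0, Ideal.absNorm_bot])

/-- Away from `(D, x + 2 r)`, one of the discriminants `ξ²` and `η²` is a unit. -/
lemma not_mem_or_not_mem {v : HeightOneSpectrum (𝓞 E)} (hv : v.asIdeal ≠ dIdeal ω D x) {β : 𝓞 E}
    (hβ : η ^ 2 = algebraMap (𝓞 E) (𝓞 L) β)
    (hβ4 : 4 * β = D * ((x : 𝓞 E) - 2 * (2 * ω - 1)) - 2 * D * y + (x + 2 * (2 * ω - 1))) :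
    (x : 𝓞 E) + 2 * (2 * ω - 1) ∉ v.asIdeal ∨ β ∉ v.asIdeal := by
  by_contra! hcon
  obtain ⟨h1, h2⟩ := hcon
  obtain ⟨γ, hγ, hγ2⟩ := h.exists_γ
  -- Here γ = ηξ satisfies γ² = ξ²η² and D y = 2γ + ξ²; a common prime of ξ² and η² therefore
  -- contains D y.
  have hγv : γ ∈ v.asIdeal := by
    have : γ ^ 2 = (x + 2 * (2 * ω - 1)) * β := by
      apply algebraMap_ringOfIntegers_injective (L := L)
      rw [map_pow, map_mul, ← h.sq_ξ, ← hβ, ← hγ]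
      ring
    exact v.isPrime.mem_of_pow_mem 2 (this ▸ Ideal.mul_mem_right _ _ h1)
  have hDy : (D : 𝓞 E) * y ∈ v.asIdeal := by
    have : (D : 𝓞 E) * y = 2 * γ + (x + 2 * (2 * ω - 1)) := by rw [hγ2]; ring
    rw [this]
    exact add_mem (Ideal.mul_mem_left _ _ hγv) h1
  obtain ⟨q, hq, hqv⟩ := exists_prime_natCast_mem v
  by_cases hqD : q = D
  · subst hqD
    apply hv
    have hle : dIdeal ω q x ≤ v.asIdeal := by
      rw [dIdeal, Ideal.span_le]
      rintro z (rfl | rfl)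
      · exact hqv
      · exact h1
    have hm : (dIdeal ω q x).IsMaximal :=
      Ring.DimensionLEOne.maximalOfPrime h.dIdeal_ne_bot h.dIdeal_isPrime
    exact (hm.eq_of_le v.isPrime.ne_top hle).symm
  · have hyq : (q : ℤ) ∣ y := by
      have hD : ¬ (q : ℤ) ∣ (D : ℤ) := fun hd =>
        hqD ((Nat.prime_dvd_prime_iff_eq hq h.prime).1 (by exact_mod_cast hd))
      have := intCast_mem_of_mul_mem hq hqv hD (z := (y : 𝓞 E)) (by exact_mod_cast hDy)
      exact (intCast_mem_iff hq hqv y).1 this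
    -- At q = 2 both x = 2x' and y = 2y' are even and η² ≡ x' + y' modulo 2, so x' ≡ y'; this
    -- contradicts that x'² − D y'² = D̃ is odd. At odd q the prime would divide both x and y.
    by_cases hq2 : q = 2
    · subst hq2
      obtain ⟨y', hy'⟩ := hyq
      have hxe : (2 : ℤ) ∣ x := by
        have hx2 : (2 : ℤ) ∣ x ^ 2 :=
          ⟨2 * Dt + 2 * D * y' ^ 2, by have := h.norm_eq; rw [hy'] at this; linear_combination this⟩
        exact Int.prime_two.dvd_of_dvd_pow hx2
      obtain ⟨x', hx'⟩ := hxe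
      have hDt : x' ^ 2 - D * y' ^ 2 = Dt := by
        have := h.norm_eq
        rw [hx', hy'] at this
        push_cast at this
        linarith
      obtain ⟨e, he⟩ : ∃ e : ℤ, (D : ℤ) = 1 + 4 * e := ⟨(D : ℤ) / 4, by
        have := h.mod_four
        omega⟩
      have hE : (D : 𝓞 E) = 1 + 4 * e := by exact_mod_cast congrArg (Int.cast : ℤ → 𝓞 E) he
      have hxE : (x : 𝓞 E) = 2 * x' := by exact_mod_cast congrArg (Int.cast : ℤ → 𝓞 E) hx'
      have hyE : (y : 𝓞 E) = 2 * y' := by exact_mod_cast congrArg (Int.cast : ℤ → 𝓞 E) hy'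
      have hβ' : β = 2 * (e * (x' - (2 * ω - 1)) - 2 * e * y' - y') + ((x' + y' : ℤ) : 𝓞 E) := by
        have h4 : (4 : 𝓞 E) ≠ 0 := by norm_num
        apply mul_left_cancel₀ h4
        rw [hβ4, hE, hxE, hyE]
        push_cast
        ring
      have h2v : (2 : 𝓞 E) ∈ v.asIdeal := by exact_mod_cast hqv
      have hxy : ((x' + y' : ℤ) : 𝓞 E) ∈ v.asIdeal := by
        rw [hβ'] at h2
        exact (Ideal.add_mem_iff_right _ (Ideal.mul_mem_right _ _ h2v)).1 h2
      have hxy2 := (intCast_mem_iff hq hqv _).1 hxy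
      obtain ⟨k, hk⟩ := hxy2
      have hx'' : x' = 2 * k - y' := by push_cast at hk; linarith
      rw [hx'', he] at hDt
      have := h.disc
      have h5 : (Dt : ℤ) = 2 * (2 * k ^ 2 - 2 * k * y' - 2 * e * y' ^ 2) := by
        linear_combination -hDt
      omega
    · refine h.not_dvd_x_and_y hq hq2 ⟨?_, hyq⟩
      have h3 : (D : 𝓞 E) * (x - 2 * (2 * ω - 1)) ∈ v.asIdeal := by
        have : (D : 𝓞 E) * (x - 2 * (2 * ω - 1)) =
            4 * β + 2 * (D * y) - (x + 2 * (2 * ω - 1)) := by rw [hβ4]; ring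
        rw [this]
        exact sub_mem (add_mem (Ideal.mul_mem_left _ _ h2) (Ideal.mul_mem_left _ _ hDy)) h1
      have hD : ¬ (q : ℤ) ∣ (D : ℤ) := fun hd =>
        hqD ((Nat.prime_dvd_prime_iff_eq hq h.prime).1 (by exact_mod_cast hd))
      have h4 := intCast_mem_of_mul_mem hq hqv hD (z := (x : 𝓞 E) - 2 * (2 * ω - 1))
        (by exact_mod_cast h3)
      have h5 : ((2 : ℤ) : 𝓞 E) * x ∈ v.asIdeal := by
        have := add_mem h1 h4
        convert this using 1
        push_cast
        ring
      have h6 : ¬ (q : ℤ) ∣ 2 := fun hd =>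
        hq2 ((Nat.prime_dvd_prime_iff_eq hq Nat.prime_two).1 (by exact_mod_cast hd))
      exact (intCast_mem_iff hq hqv x).1 (intCast_mem_of_mul_mem hq hqv h6 h5)

lemma isGood {v : HeightOneSpectrum (𝓞 E)} (hv : v.asIdeal ≠ dIdeal ω D x) :
    IsGood (𝓞 L) v.asIdeal := by
  obtain ⟨β, h1, h2, h3⟩ := h.exists_isHalf_η
  rcases h.not_mem_or_not_mem hv h2 h3 with h4 | h4
  · exact h.isHalf_ξ.isGood h4
  · exact h1.isGood h4

lemma dIdeal_isMaximal : (dIdeal ω D x).IsMaximal :=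
  Ring.DimensionLEOne.maximalOfPrime h.dIdeal_ne_bot h.dIdeal_isPrime

lemma D_mem_dIdeal : (D : 𝓞 E) ∈ dIdeal ω D x := Ideal.subset_span (by simp)

lemma add_mem_dIdeal : (x : 𝓞 E) + 2 * (2 * ω - 1) ∈ dIdeal ω D x := Ideal.subset_span (by simp)

lemma intCast_mem_dIdeal_iff (n : ℤ) : (n : 𝓞 E) ∈ dIdeal ω D x ↔ (D : ℤ) ∣ n :=
  intCast_mem_iff (v := ⟨dIdeal ω D x, h.dIdeal_isPrime, h.dIdeal_ne_bot⟩) h.prime h.D_mem_dIdeal n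

/-- An element of `E` with odd valuation at `(D, x + 2 r)` which is a square in `L`. -/
lemma exists_ramified : ∃ (θ : 𝓞 L) (β : 𝓞 E), IsHalf θ β ∧ θ ^ 2 = algebraMap (𝓞 E) (𝓞 L) β ∧
    β ∈ dIdeal ω D x ∧ β ∉ dIdeal ω D x ^ 2 := by
  have hp := h.dIdeal_isPrime
  have hpp : Prime (dIdeal ω D x) := Ideal.prime_of_isPrime h.dIdeal_ne_bot hp
  -- If D ∣ x, then x − 2r also lies in 𝔡, and x + 2r ∈ 𝔡² would give 𝔡³ ∣ 𝔡𝔡'(y²) with D ∤ y, hence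
  -- 𝔡² ∣ 𝔡', against the norms. If D ∤ x, then x − 2r ∉ 𝔡, so 𝔡 ∤ 𝔡' and D(x − 2r) has valuation
  -- one.
  by_cases hx : (D : ℤ) ∣ x
  · refine ⟨ξ, _, h.isHalf_ξ, h.sq_ξ, h.add_mem_dIdeal, fun hmem => ?_⟩
    have hx' : (x : 𝓞 E) ∈ dIdeal ω D x := (h.intCast_mem_dIdeal_iff x).2 hx
    have hsub : (x : 𝓞 E) - 2 * (2 * ω - 1) ∈ dIdeal ω D x := by
      have : (x : 𝓞 E) - 2 * (2 * ω - 1) = 2 * x - (x + 2 * (2 * ω - 1)) := by ring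
      rw [this]
      exact sub_mem (Ideal.mul_mem_left _ _ hx') h.add_mem_dIdeal
    have h3 : (D : 𝓞 E) * y ^ 2 ∈ dIdeal ω D x ^ 3 := by
      rw [← h.add_mul_sub, pow_succ]
      exact Ideal.mul_mem_mul hmem hsub
    have h4 : dIdeal ω D x ^ 3 ∣ dIdeal ω D x * (dIdeal' ω D x * Ideal.span {(y : 𝓞 E) ^ 2}) := by
      rw [← mul_assoc, h.dIdeal_mul, Ideal.span_singleton_mul_span_singleton, Ideal.dvd_iff_le,
        Ideal.span_singleton_le_iff_mem]
      exact h3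
    rw [pow_succ', mul_dvd_mul_iff_left hpp.ne_zero] at h4
    have h5 := hpp.pow_dvd_of_dvd_mul_right 2 (fun hd => by
      rw [Ideal.dvd_iff_le, Ideal.span_singleton_le_iff_mem] at hd
      have := hp.mem_of_pow_mem 2 hd
      exact h.D_sq_not_dvd ⟨hx, (h.intCast_mem_dIdeal_iff y).1 this⟩) h4
    have h6 := map_dvd Ideal.absNorm h5
    rw [map_pow, h.absNorm_dIdeal.1, h.absNorm_dIdeal.2] at h6
    have := Nat.le_of_dvd h.prime.pos h6
    have := h.two_lt
    nlinarith
  · refine ⟨ζ, _, h.isHalf_ζ, h.sq_ζ, Ideal.mul_mem_right _ _ h.D_mem_dIdeal, fun hmem => ?_⟩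
    have hsub : (x : 𝓞 E) - 2 * (2 * ω - 1) ∉ dIdeal ω D x := by
      intro hs
      have h2x : ((2 * x : ℤ) : 𝓞 E) ∈ dIdeal ω D x := by
        have : ((2 * x : ℤ) : 𝓞 E) = (x - 2 * (2 * ω - 1)) + (x + 2 * (2 * ω - 1)) := by
          push_cast
          ring
        rw [this]
        exact add_mem hs h.add_mem_dIdeal
      rcases (Nat.prime_iff_prime_int.1 h.prime).dvd_or_dvd
        ((h.intCast_mem_dIdeal_iff _).1 h2x) with h3 | h3
      · exact h.not_D_dvd_four (h3.trans (by norm_num))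
      · exact hx h3
    have h4 : dIdeal ω D x ^ 2 ∣
        dIdeal ω D x * (dIdeal' ω D x * Ideal.span {(x : 𝓞 E) - 2 * (2 * ω - 1)}) := by
      rw [← mul_assoc, h.dIdeal_mul, Ideal.span_singleton_mul_span_singleton, Ideal.dvd_iff_le,
        Ideal.span_singleton_le_iff_mem]
      exact hmem
    rw [pow_two, mul_dvd_mul_iff_left hpp.ne_zero] at h4
    rcases hpp.dvd_or_dvd h4 with h5 | h5
    · exact hsub (Ideal.dvd_iff_le.1 h5 (Ideal.subset_span (by simp)))
    · rw [Ideal.dvd_iff_le, Ideal.span_singleton_le_iff_mem] at h5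
      exact hsub h5

end ReflexDatum

end Datum

open IsDedekindDomain

/-! ### The relative discriminant equals 𝔡 -/

section Datum

set_option linter.unusedSectionVars false

attribute [local instance] FractionRing.liftAlgebra

variable {E L : Type*} [Field E] [NumberField E] [Field L] [NumberField L] [Algebra E L]

-- With f the minimal polynomial of φ = (w + θ)/2, the element f'(φ) = 2φ − w = θ lies in the
-- different. The norm of (θ) is (β), because its square is the norm of the ideal generated by β.
open Polynomial in
lemma IsHalf.mem_relDiscr (hEL : Module.finrank E L = 2) {θ : 𝓞 L} {β : 𝓞 E} (hθ : IsHalf θ β)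
    (hsq : θ ^ 2 = algebraMap (𝓞 E) (𝓞 L) β) : β ∈ relDiscr E L := by
  obtain ⟨w, b, φ, hφ, h1, h2, h3⟩ := hθ
  have hint : IsIntegral (𝓞 E) φ := Algebra.IsIntegral.isIntegral φ
  set f : (𝓞 E)[X] := X ^ 2 - C (w : 𝓞 E) * X + C b with hf
  have hfm : f.Monic := by rw [hf]; monicity!
  have hfd : f.natDegree = 2 := by rw [hf]; compute_degree!
  have hf0 : aeval φ f = 0 := by rw [hf]; simpa using h1
  have hmin : f = minpoly (𝓞 E) φ := by
    refine Polynomial.eq_of_monic_of_dvd_of_natDegree_le (minpoly.monic hint) hfm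
      (minpoly.isIntegrallyClosed_dvd hint hf0) ?_
    rw [hfd]
    exact (minpoly.two_le_natDegree_iff hint).2 h3
  have htop : Algebra.adjoin E {algebraMap (𝓞 L) L φ} = ⊤ := by
    rw [eq_top_iff]
    rintro z -
    have hr : algebraMap (𝓞 L) L φ ∉ (algebraMap E L).range := by
      rintro ⟨a, ha⟩
      have hai : IsIntegral ℤ a := by
        have h4 : IsIntegral ℤ (algebraMap (𝓞 L) L φ) := φ.isIntegral_coe
        rw [← ha] at h4
        exact (isIntegral_algebraMap_iff (algebraMap E L).injective).1 h4
      exact h3 ⟨⟨a, hai⟩, NumberField.RingOfIntegers.coe_injective ha⟩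
    obtain ⟨p, q, hz⟩ := exists_add_mul_of_finrank_two hEL hr z
    rw [hz]
    exact add_mem (Subalgebra.algebraMap_mem _ _)
      (mul_mem (Subalgebra.algebraMap_mem _ _) (Algebra.subset_adjoin rfl))
  have hdiff := aeval_derivative_mem_differentIdeal (𝓞 E) E L φ htop
  rw [← hmin, hf] at hdiff
  have hθd : θ ∈ differentIdeal (𝓞 E) (𝓞 L) := by
    convert hdiff using 1
    simp
    linear_combination -hφ
  have h5 : Ideal.relNorm (𝓞 E) (Ideal.span {θ}) ≤ relDiscr E L :=
    Ideal.relNorm_mono _ (by rwa [Ideal.span_singleton_le_iff_mem])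
  have h6 : Ideal.relNorm (𝓞 E) (Ideal.span {θ}) = Ideal.span {β} := by
    have h7 : (Ideal.relNorm (𝓞 E) (Ideal.span {θ})) ^ 2 = (Ideal.span {β}) ^ 2 := by
      have hfr : Module.finrank (𝓞 E) (𝓞 L) = 2 := by
        rw [← hEL]
        exact (IsFractionRing.finrank_eq (𝓞 E) E (𝓞 L) L).symm
      rw [← map_pow, Ideal.span_singleton_pow, hsq, ← Set.image_singleton, ← Ideal.map_span,
        Ideal.relNorm_algebraMap, hfr]
    exact (pow_left_inj two_ne_zero).1 h7
  rw [h6, Ideal.span_singleton_le_iff_mem] at h5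
  exact h5

namespace ReflexDatum

variable {D Dt : ℕ} {x y c : ℤ} {ω : 𝓞 E} {ξ ζ η : 𝓞 L} (h : ReflexDatum D Dt x y c ω ξ ζ η)
include h

/-- A square θ² = β of valuation one at 𝔡 forces P² ∣ 𝔡𝓞_L for a prime P above 𝔡. Such a ramified P
divides the different, and its norm lies in 𝔡. -/
lemma relDiscr_le : relDiscr E L ≤ dIdeal ω D x := by
  have hp := h.dIdeal_isPrime
  have hm := h.dIdeal_isMaximal
  have hpp : Prime (dIdeal ω D x) := Ideal.prime_of_isPrime h.dIdeal_ne_bot hp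
  obtain ⟨θ, β, -, hsq, hβ, hβ2⟩ := h.exists_ramified
  obtain ⟨J, hJ⟩ := Ideal.dvd_iff_le.2 ((Ideal.span_singleton_le_iff_mem _).2 hβ)
  have hJp : ¬ J ≤ dIdeal ω D x := by
    intro hle
    apply hβ2
    rw [← Ideal.span_singleton_le_iff_mem, hJ, pow_two]
    exact Ideal.mul_mono le_rfl hle
  obtain ⟨P⟩ := (inferInstance : Nonempty (Ideal.primesOver (dIdeal ω D x) (𝓞 L)))
  have hP := P.2.1
  have hPl := P.2.2
  have hP0 : P.1 ≠ ⊥ := Ideal.ne_bot_of_liesOver_of_ne_bot h.dIdeal_ne_bot P.1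
  have hPp : Prime P.1 := Ideal.prime_of_isPrime hP0 hP
  have hθP : θ ∈ P.1 := hP.mem_of_pow_mem 2 (by
    rw [hsq]
    exact (Ideal.mem_of_liesOver P.1 (dIdeal ω D x) β).1 hβ)
  have h2 : P.1 ^ 2 ∣ (dIdeal ω D x).map (algebraMap (𝓞 E) (𝓞 L)) *
      J.map (algebraMap (𝓞 E) (𝓞 L)) := by
    rw [← Ideal.map_mul, ← hJ, Ideal.map_span, Set.image_singleton, ← hsq, Ideal.dvd_iff_le,
      Ideal.span_singleton_le_iff_mem]
    exact Ideal.pow_mem_pow hθP 2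
  have h3 : ¬ P.1 ∣ J.map (algebraMap (𝓞 E) (𝓞 L)) := by
    rw [Ideal.dvd_iff_le, Ideal.map_le_iff_le_comap]
    intro hle
    exact hJp (hle.trans (Ideal.over_def P.1 (dIdeal ω D x)).ge)
  have h4 := hPp.pow_dvd_of_dvd_mul_right 2 h3 h2
  have h5 := pow_sub_one_dvd_differentIdeal (A := 𝓞 E) P.1 2 h.dIdeal_ne_bot h4
  rw [Ideal.dvd_iff_le] at h5
  simp only [Nat.add_one_sub_one, pow_one] at h5
  calc relDiscr E L ≤ Ideal.relNorm (𝓞 E) P.1 := Ideal.relNorm_mono _ h5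
    _ ≤ Ideal.comap (algebraMap (𝓞 E) (𝓞 L)) P.1 := Ideal.relNorm_le_comap _ _
    _ = dIdeal ω D x := (Ideal.over_def P.1 (dIdeal ω D x)).symm

/-- The discriminant contains ξ², η² and the element β of exact valuation one at 𝔡. The last bounds
the exponent of 𝔡 by one, and the first two exclude every other prime. -/
lemma relDiscr_eq : relDiscr E L = dIdeal ω D x := by
  obtain ⟨θ, β, hθ, hsq, hβ, hβ2⟩ := h.exists_ramified
  have hβm := hθ.mem_relDiscr h.finrank hsq
  obtain ⟨J, hJ⟩ := Ideal.dvd_iff_le.2 h.relDiscr_le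
  have hJ0 : relDiscr E L ≠ ⊥ := by
    intro h0
    rw [h0, Ideal.mem_bot] at hβm
    exact hβ2 (hβm ▸ zero_mem _)
  suffices hJt : J = ⊤ by rw [hJ, hJt, Ideal.mul_top]
  by_contra hne
  obtain ⟨M, hM, hJM⟩ := Ideal.exists_le_maximal J hne
  have hM0 : M ≠ ⊥ := by
    rintro rfl
    rw [le_bot_iff] at hJM
    rw [hJM, Ideal.mul_bot] at hJ
    exact hJ0 hJ
  let v : HeightOneSpectrum (𝓞 E) := ⟨M, hM.isPrime, hM0⟩
  have hle : relDiscr E L ≤ v.asIdeal := by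
    rw [hJ]
    exact Ideal.mul_le_right.trans hJM
  obtain ⟨βη, h1, h2, h3⟩ := h.exists_isHalf_η
  have hv : v.asIdeal = dIdeal ω D x := by
    by_contra hv
    rcases h.not_mem_or_not_mem hv h2 h3 with h4 | h4
    · exact h4 (hle (h.isHalf_ξ.mem_relDiscr h.finrank h.sq_ξ))
    · exact h4 (hle (h1.mem_relDiscr h.finrank h2))
  apply hβ2
  rw [pow_two]
  have : relDiscr E L ≤ dIdeal ω D x * dIdeal ω D x := by
    rw [hJ]
    exact Ideal.mul_mono le_rfl (hJM.trans hv.le)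
  exact this hβm

end ReflexDatum

end Datum

open IsDedekindDomain

/-! ### The integral ideals I = t d and their norms -/

section Datum

set_option linter.unusedSectionVars false

variable {E L : Type*} [Field E] [NumberField E] [Field L] [NumberField L] [Algebra E L]

namespace QuadraticBasis

variable {c : ℤ} {ω : 𝓞 E} (h : QuadraticBasis c ω)
include h

lemma exists_conj : ∃ g : Gal(E/ℚ), g • ω = 1 - ω := by
  have := h.isGalois
  simpa using exists_conj_eq_sub Gal(E/ℚ) h.eq_zero' h.not_mem_range

lemma norm_eq (a b : ℤ) : Algebra.norm ℤ ((a : 𝓞 E) + b * ω) = a ^ 2 + a * b + c * b ^ 2 := by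
  classical
  have hGal := h.isGalois
  obtain ⟨g, hg⟩ := h.exists_conj
  have hg1 : g ≠ 1 := by
    rintro rfl
    rw [one_smul] at hg
    have := (h.indep (-1) 2 (by push_cast; linear_combination hg)).2
    omega
  have huniv : (Finset.univ : Finset Gal(E/ℚ)) = {1, g} := by
    symm
    apply Finset.eq_univ_of_card
    rw [Finset.card_pair hg1.symm, ← Nat.card_eq_fintype_card, h.card_gal]
  have h1 := Algebra.norm_eq_prod_automorphisms ℚ (algebraMap (𝓞 E) E ((a : 𝓞 E) + b * ω))
  rw [huniv, Finset.prod_pair hg1.symm] at h1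
  have h2 : g (algebraMap (𝓞 E) E ((a : 𝓞 E) + b * ω)) =
      algebraMap (𝓞 E) E ((a : 𝓞 E) + b * (1 - ω)) := by
    have h3 : g • ((a : 𝓞 E) + b * ω) = (a : 𝓞 E) + b * (1 - ω) := by
      rw [smul_add, smul_mul', hg]
      congr 1
      · exact map_intCast (MulSemiringAction.toRingHom Gal(E/ℚ) (𝓞 E) g) a
      · congr 1
        exact map_intCast (MulSemiringAction.toRingHom Gal(E/ℚ) (𝓞 E) g) b
    rw [← h3]
    rfl
  rw [h2, AlgEquiv.one_apply, ← map_mul] at h1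
  have h4 : ((Algebra.norm ℤ ((a : 𝓞 E) + b * ω) : ℤ) : E) =
      ((a ^ 2 + a * b + c * b ^ 2 : ℤ) : E) := by
    have h5 := Algebra.coe_norm_int (K := E) ((a : 𝓞 E) + b * ω)
    have h6 : ((Algebra.norm ℤ ((a : 𝓞 E) + b * ω) : ℤ) : E) =
        (((Algebra.norm ℤ ((a : 𝓞 E) + b * ω) : ℤ) : ℚ) : E) := by push_cast; rfl
    rw [h6, h5, ← eq_ratCast (algebraMap ℚ E)]
    refine h1.trans ?_
    rw [← map_intCast (algebraMap (𝓞 E) E)]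
    congr 1
    push_cast
    linear_combination (-(b : 𝓞 E) ^ 2) * h.eq
  exact_mod_cast h4

lemma absNorm_span (a b : ℤ) : Ideal.absNorm (Ideal.span {(a : 𝓞 E) + b * ω}) =
    (a ^ 2 + a * b + c * b ^ 2).natAbs := by
  rw [Ideal.absNorm_span_singleton, h.norm_eq]

/-- Modulo v the generator ω is congruent to e/m, with m invertible modulo l; so the residue field
of v is the prime field. -/
lemma exists_int_sub_mem {v : HeightOneSpectrum (𝓞 E)} {l : ℕ} (hl : l.Prime)
    (hv : (l : 𝓞 E) ∈ v.asIdeal) {m e : ℤ} (hm : ¬ (l : ℤ) ∣ m)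
    (hτ : (m : 𝓞 E) * ω - e ∈ v.asIdeal) (z : 𝓞 E) : ∃ n : ℤ, z - n ∈ v.asIdeal := by
  obtain ⟨a, b, rfl⟩ := h.span z
  obtain ⟨p, q, hpq⟩ := (Nat.prime_iff_prime_int.1 hl).irreducible.coprime_iff_not_dvd.2 hm
  refine ⟨a + b * q * e, ?_⟩
  have hE : (p : 𝓞 E) * l + q * m = 1 := by exact_mod_cast congrArg (Int.cast : ℤ → 𝓞 E) hpq
  have : (a : 𝓞 E) + b * ω - ((a + b * q * e : ℤ) : 𝓞 E) =
      ((b : 𝓞 E) * ω * p) * l + ((b : 𝓞 E) * q) * ((m : 𝓞 E) * ω - e) := by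
    push_cast
    linear_combination (-(b : 𝓞 E) * ω) * hE
  rw [this]
  exact add_mem (Ideal.mul_mem_left _ _ hv) (Ideal.mul_mem_left _ _ hτ)

end QuadraticBasis

namespace ReflexDatum

variable {D Dt : ℕ} {x y c : ℤ} {ω : 𝓞 E} {ξ ζ η : 𝓞 L} (h : ReflexDatum D Dt x y c ω ξ ζ η)
include h

/-- The integral ideal `t d` for `t = (m r - k) / (2 D)`. -/
lemma exists_numerator {m k e : ℤ} (he : 2 * e = m + k) (hk : (D : ℤ) ∣ 2 * k - m * x) :
    ∃ I : Ideal (𝓞 E), Ideal.span {(m : 𝓞 E) * ω - e} = I * dIdeal' ω D x := by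
  have hmem : (m : 𝓞 E) * ω - e ∈ dIdeal' ω D x := by
    have hD : (D : 𝓞 E) ∈ dIdeal' ω D x := Ideal.subset_span (by simp)
    have hx : (x : 𝓞 E) - 2 * (2 * ω - 1) ∈ dIdeal' ω D x := Ideal.subset_span (by simp)
    -- From D ∣ 2k − m x one gets 4(mω − e) = 2(m r − k) ≡ −m(x − 2r) modulo D, and −d is an inverse
    -- of 4 modulo D = 1 + 4d.
    obtain ⟨C, hC⟩ := hk
    obtain ⟨d, hd⟩ : ∃ d : ℤ, (D : ℤ) = 1 + 4 * d := ⟨(D : ℤ) / 4, by have := h.mod_four; omega⟩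
    have hdE : (D : 𝓞 E) = 1 + 4 * d := by exact_mod_cast congrArg (Int.cast : ℤ → 𝓞 E) hd
    have heE : 2 * (e : 𝓞 E) = m + k := by exact_mod_cast congrArg (Int.cast : ℤ → 𝓞 E) he
    have hCE : 2 * (k : 𝓞 E) - m * x = D * C := by
      exact_mod_cast congrArg (Int.cast : ℤ → 𝓞 E) hC
    have : (m : 𝓞 E) * ω - e = (m * ω - e + d * C) * D + (d * m) * (x - 2 * (2 * ω - 1)) := by
      linear_combination (-m * ω + e) * hdE + 2 * d * heE + d * hCE
    rw [this]
    exact add_mem (Ideal.mul_mem_left _ _ hD) (Ideal.mul_mem_left _ _ hx)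
  obtain ⟨I, hI⟩ := Ideal.dvd_iff_le.2 ((Ideal.span_singleton_le_iff_mem _).2 hmem)
  exact ⟨I, by rw [hI, mul_comm]⟩

/-- The norm of mω − e is (k² − m² D̃)/4, negative by the bound on k, and 𝔡' accounts for a factor
D. -/
lemma absNorm_numerator {m k e : ℤ} (he : 2 * e = m + k) (hkm : k ^ 2 < m ^ 2 * Dt)
    {I : Ideal (𝓞 E)} (hI : Ideal.span {(m : 𝓞 E) * ω - e} = I * dIdeal' ω D x) :
    4 * (D : ℤ) * Ideal.absNorm I = m ^ 2 * Dt - k ^ 2 := by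
  have h1 := congrArg Ideal.absNorm hI
  have h2 : (m : 𝓞 E) * ω - e = ((-e : ℤ) : 𝓞 E) + m * ω := by push_cast; ring
  rw [map_mul, h.absNorm_dIdeal.2, h2, h.basis.absNorm_span] at h1
  have h3 : 4 * ((-e) ^ 2 + (-e) * m + c * m ^ 2) = k ^ 2 - m ^ 2 * Dt := by
    rw [h.disc]
    have hk : k = 2 * e - m := by linarith
    rw [hk]
    ring
  have h4 : (((-e) ^ 2 + (-e) * m + c * m ^ 2).natAbs : ℤ) =
      -((-e) ^ 2 + (-e) * m + c * m ^ 2) := Int.ofNat_natAbs_of_nonpos (by linarith)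
  have h5 := congrArg (Nat.cast : ℕ → ℤ) h1
  rw [h4] at h5
  push_cast at h5
  linarith

/-- The coefficient m of ω makes mω − e primitive at l. This is what limits I to at most one prime
above l. -/
lemma numerator_not_dvd {m e : ℤ} {l : ℕ} (hlm : ¬ (l : ℤ) ∣ m) {I : Ideal (𝓞 E)}
    (hI : Ideal.span {(m : 𝓞 E) * ω - e} = I * dIdeal' ω D x) :
    ¬ Ideal.span {(l : 𝓞 E)} ∣ I := by
  intro hd
  have h1 : Ideal.span {(l : 𝓞 E)} ∣ Ideal.span {(m : 𝓞 E) * ω - e} := hI ▸ hd.mul_right _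
  rw [Ideal.dvd_iff_le, Ideal.span_singleton_le_span_singleton] at h1
  have h2 := (h.basis.intCast_dvd_iff l (-e) m).1 (by
    convert h1 using 1 <;> push_cast <;> ring)
  exact hlm h2.2

/-- Otherwise 𝔡𝔡' = (D) would divide mω − e. Consequently the ramified prime never enters the count
of ideals. -/
lemma numerator_dIdeal_not_dvd {m e : ℤ} (hDm : ¬ (D : ℤ) ∣ m) {I : Ideal (𝓞 E)}
    (hI : Ideal.span {(m : 𝓞 E) * ω - e} = I * dIdeal' ω D x) : ¬ dIdeal ω D x ∣ I := by
  intro hd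
  have h1 : Ideal.span {(D : 𝓞 E)} ∣ Ideal.span {(m : 𝓞 E) * ω - e} := by
    rw [hI, ← h.dIdeal_mul]
    exact mul_dvd_mul_right hd _
  rw [Ideal.dvd_iff_le, Ideal.span_singleton_le_span_singleton] at h1
  have h2 := (h.basis.intCast_dvd_iff D (-e) m).1 (by
    convert h1 using 1 <;> push_cast <;> ring)
  exact hDm h2.2

lemma numerator_smul {m e l : ℤ} {I I₁ : Ideal (𝓞 E)}
    (hI : Ideal.span {((l * m : ℤ) : 𝓞 E) * ω - ((l * e : ℤ) : 𝓞 E)} = I * dIdeal' ω D x)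
    (hI₁ : Ideal.span {(m : 𝓞 E) * ω - e} = I₁ * dIdeal' ω D x) :
    I = Ideal.span {(l : 𝓞 E)} * I₁ := by
  have h1 : I * dIdeal' ω D x = Ideal.span {(l : 𝓞 E)} * I₁ * dIdeal' ω D x := by
    rw [mul_assoc, ← hI₁, ← hI, Ideal.span_singleton_mul_span_singleton]
    congr 2
    push_cast
    ring
  exact mul_right_cancel₀ h.dIdeal'_ne_bot h1

end ReflexDatum

end Datum

open IsDedekindDomain

/-! ### Splitting of primes in L as a congruence modulo 4l -/

section Split

set_option linter.unusedSectionVars false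

variable {E L : Type*} [Field E] [NumberField E] [Field L] [NumberField L] [Algebra E L]

section

variable {c : ℤ} {ω : 𝓞 E} (hb : QuadraticBasis c ω) [IsGalois E L]
  (hG : Nat.card Gal(L/E) = 2)
  {l : ℕ} (hl : l.Prime) {v : HeightOneSpectrum (𝓞 E)} (hv : (l : 𝓞 E) ∈ v.asIdeal)
  (hres : ∀ z : 𝓞 E, ∃ n : ℤ, z - n ∈ v.asIdeal)
  {θ : 𝓞 L} {β : 𝓞 E}

-- Modulo 4 the square of m w is m²β, that is mJ. This square root modulo 4 is needed in the
-- comparison with the Hilbert symbol.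
include hb in
lemma IsHalf.exists_four_dvd (hθ : IsHalf θ β) {m J : ℤ} {σ : 𝓞 E}
    (hσ : (m : 𝓞 E) * β - J = 4 * σ) : ∃ g : ℤ, 4 ∣ g ^ 2 - m * J := by
  obtain ⟨w, b, φ, -, -, h2, -⟩ := hθ
  refine ⟨m * w, (hb.intCast_dvd_intCast 4 _).1 ⟨m ^ 2 * b + m * σ, ?_⟩⟩
  push_cast
  linear_combination (m : 𝓞 E) ^ 2 * h2 + m * hσ

include hG hres in
lemma IsHalf.split_iff_exists_int (hβ : β ∉ v.asIdeal) {w : ℤ} {b : 𝓞 E} {φ : 𝓞 L}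
    (h1 : φ ^ 2 - algebraMap (𝓞 E) (𝓞 L) w * φ + algebraMap (𝓞 E) (𝓞 L) b = 0)
    (h2 : (w : 𝓞 E) ^ 2 - 4 * b = β) (h3 : φ ∉ (algebraMap (𝓞 E) (𝓞 L)).range) :
    (v.asIdeal.primesOver (𝓞 L)).ncard = 2 ↔ ∃ z : ℤ, (z : 𝓞 E) ^ 2 - w * z + b ∈ v.asIdeal := by
  have := v.isMaximal
  rw [ncard_primesOver_eq_two_iff Gal(L/E) hG v.asIdeal v.ne_bot h1 h3 (by rwa [h2])]
  refine ⟨fun ⟨z, hz⟩ => ?_, fun ⟨z, hz⟩ => ⟨z, hz⟩⟩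
  obtain ⟨n, hn⟩ := hres z
  refine ⟨n, ?_⟩
  have : (n : 𝓞 E) ^ 2 - w * n + b = (z ^ 2 - w * z + b) - (z + n - w) * (z - n) := by ring
  rw [this]
  exact sub_mem hz (Ideal.mul_mem_left _ _ hn)

include hb hG hl hv hres in
/-- The splitting of a prime of degree one above `l`, as a condition modulo `4 l`. -/
lemma IsHalf.split_iff (hθ : IsHalf θ β) {m J : ℤ} (hm : ¬ (l : ℤ) ∣ m) (hJ : ¬ (l : ℤ) ∣ J)
    {σ : 𝓞 E} (hσ : (m : 𝓞 E) * β - J = 4 * σ) (hσv : σ ∈ v.asIdeal) :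
    (v.asIdeal.primesOver (𝓞 L)).ncard = 2 ↔ ∃ g : ℤ, (4 * l : ℤ) ∣ g ^ 2 - m * J := by
  have hlI := Nat.prime_iff_prime_int.1 hl
  obtain ⟨w, b, φ, -, h1, h2, h3⟩ := hθ
  have hβ : β ∉ v.asIdeal := by
    intro hβ
    apply hJ
    rw [← intCast_mem_iff hl hv]
    have : (J : 𝓞 E) = m * β - 4 * σ := by linear_combination -hσ
    rw [this]
    exact sub_mem (Ideal.mul_mem_left _ _ hβ) (Ideal.mul_mem_left _ _ hσv)
  -- Completing the square: since σ ∈ v, an integer z is a root of the polynomial modulo v iff m(2z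
  -- − w) is a square root of mJ modulo 4l.
  have key : ∀ z : ℤ, ((m ^ 2 * (2 * z - w) ^ 2 - m * J : ℤ) : 𝓞 E) =
      4 * (m ^ 2 * ((z : 𝓞 E) ^ 2 - w * z + b) + m * σ) := by
    intro z
    push_cast
    linear_combination (m : 𝓞 E) ^ 2 * h2 + m * hσ
  have hu : ∀ z : ℤ, ∃ u : ℤ, m ^ 2 * (2 * z - w) ^ 2 - m * J = 4 * u ∧
      (u : 𝓞 E) = m ^ 2 * ((z : 𝓞 E) ^ 2 - w * z + b) + m * σ := by
    intro z
    obtain ⟨u, hu⟩ := (hb.intCast_dvd_intCast 4 (m ^ 2 * (2 * z - w) ^ 2 - m * J)).1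
      ⟨_, by rw [key z]; push_cast; rfl⟩
    refine ⟨u, hu, ?_⟩
    have h4 : (4 : 𝓞 E) ≠ 0 := by norm_num
    apply mul_left_cancel₀ h4
    rw [← key z, hu]
    push_cast
    rfl
  rw [IsHalf.split_iff_exists_int hG hres hβ h1 h2 h3]
  constructor
  · rintro ⟨z, hz⟩
    obtain ⟨u, hu1, hu2⟩ := hu z
    have : (l : ℤ) ∣ u := by
      rw [← intCast_mem_iff hl hv, hu2]
      exact add_mem (Ideal.mul_mem_left _ _ hz) (Ideal.mul_mem_left _ _ hσv)
    refine ⟨m * (2 * z - w), ?_⟩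
    rw [mul_pow, hu1]
    exact mul_dvd_mul_left 4 this
  · rintro ⟨g, hg⟩
    -- For l = 2 the choice z = 0 works because all odd squares agree modulo 8. For odd l one solves
    -- m(2z − w) ≡ g modulo l with q an inverse of 2m.
    obtain ⟨z, hz⟩ : ∃ z : ℤ, (4 * l : ℤ) ∣ 4 * (m ^ 2 * (2 * z - w) ^ 2 - m * J) ∧
        (l = 2 → (4 * l : ℤ) ∣ m ^ 2 * (2 * z - w) ^ 2 - m * J) := by
      by_cases hl2 : l = 2
      · subst hl2
        refine ⟨0, ?_⟩
        have h8 : (8 : ℤ) ∣ m ^ 2 * (2 * 0 - w) ^ 2 - m * J := by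
          obtain ⟨u, hu1, -⟩ := hu 0
          have hJo : m * J % 2 = 1 := by
            rw [Int.mul_emod]
            have : m % 2 = 1 := by omega
            have : J % 2 = 1 := by omega
            simp [*]
          have ho : (m * w) % 2 = 1 := by
            by_contra hcon
            have he : (2 : ℤ) ∣ (m * w) ^ 2 := dvd_pow (by omega) two_ne_zero
            have : (m * w) ^ 2 = m ^ 2 * (2 * 0 - w) ^ 2 := by ring
            omega
          have hgo : g % 2 = 1 := by
            by_contra hcon
            have he : (2 : ℤ) ∣ g ^ 2 := dvd_pow (by omega) two_ne_zero
            push_cast at hg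
            omega
          have e1 := Int.sq_mod_four_eq_one_of_odd (Int.odd_iff.2 ho)
          have e2 : (8 : ℤ) ∣ (m * w) ^ 2 - g ^ 2 := by
            have a1 := Int.eight_dvd_sq_sub_one_of_odd (Int.odd_iff.2 ho)
            have a2 := Int.eight_dvd_sq_sub_one_of_odd (Int.odd_iff.2 hgo)
            omega
          have e3 : m ^ 2 * (2 * 0 - w) ^ 2 - m * J = ((m * w) ^ 2 - g ^ 2) + (g ^ 2 - m * J) := by
            ring
          rw [e3]
          exact dvd_add e2 (by simpa using hg)
        exact ⟨Dvd.dvd.mul_left (by simpa using h8) _, fun _ => by simpa using h8⟩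
      · have hc : IsCoprime (l : ℤ) (2 * m) := by
          refine hlI.irreducible.coprime_iff_not_dvd.2 fun hd => ?_
          rcases hlI.dvd_or_dvd hd with hd | hd
          · exact hl2 ((Nat.prime_dvd_prime_iff_eq hl Nat.prime_two).1 (by exact_mod_cast hd))
          · exact hm hd
        obtain ⟨p, q, hpq⟩ := hc
        refine ⟨q * (g + m * w), mul_dvd_mul_left 4 ?_, fun h => absurd h hl2⟩
        have hd : (l : ℤ) ∣ g ^ 2 - m * J := (Dvd.intro_left 4 rfl).trans hg
        have : m ^ 2 * (2 * (q * (g + m * w)) - w) ^ 2 - m * J =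
            (g ^ 2 - m * J) + l * ((-p * (g + m * w)) *
              (m * (2 * (q * (g + m * w)) - w) + g)) := by
          linear_combination (g + m * w) * (m * (2 * (q * (g + m * w)) - w) + g) * hpq
        rw [this]
        exact dvd_add hd (Dvd.intro _ rfl)
    refine ⟨z, ?_⟩
    obtain ⟨u, hu1, hu2⟩ := hu z
    have hlu : (l : ℤ) ∣ u := by
      by_cases hl2 : l = 2
      · have := hz.2 hl2
        rw [hu1] at this
        exact Int.dvd_of_mul_dvd_mul_left (by norm_num) this
      · have h4 : IsCoprime (l : ℤ) 4 := by
          refine hlI.irreducible.coprime_iff_not_dvd.2 fun hd => hl2 ?_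
          have := hlI.dvd_of_dvd_pow (show (l : ℤ) ∣ 2 ^ 2 from hd)
          exact (Nat.prime_dvd_prime_iff_eq hl Nat.prime_two).1 (by exact_mod_cast this)
        have := hz.1
        rw [hu1] at this
        exact h4.dvd_of_dvd_mul_left (Int.dvd_of_mul_dvd_mul_left (by norm_num) this)
    have hum := (intCast_mem_iff hl hv u).2 hlu
    rw [hu2] at hum
    have h5 := (Submodule.add_mem_iff_left _ (Ideal.mul_mem_left _ (m : 𝓞 E) hσv)).1 hum
    refine intCast_mem_of_mul_mem hl hv (n := m ^ 2) (fun hd => hm (hlI.dvd_of_dvd_pow hd)) ?_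
    push_cast
    exact h5

-- For odd l the substitution z ↦ 2z − w is invertible modulo l and turns roots of z² − w z + b into
-- square roots of the discriminant β ≡ u.
include hG hl hv hres in
lemma IsHalf.split_iff_isSquare (hθ : IsHalf θ β) (hl2 : l ≠ 2) {u : ℤ} (hu : ¬ (l : ℤ) ∣ u)
    (hβu : β - u ∈ v.asIdeal) :
    (v.asIdeal.primesOver (𝓞 L)).ncard = 2 ↔ IsSquare (u : ZMod l) := by
  have hlI := Nat.prime_iff_prime_int.1 hl
  have := Fact.mk hl
  obtain ⟨w, b, φ, -, h1, h2, h3⟩ := hθ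
  have hβ : β ∉ v.asIdeal := by
    intro hβ
    apply hu
    rw [← intCast_mem_iff hl hv]
    exact (Submodule.sub_mem_iff_right _ hβ).1 hβu
  have h2' : (2 : ZMod l) ≠ 0 := by
    intro h0
    have := (ZMod.natCast_eq_zero_iff 2 l).1 (by exact_mod_cast h0)
    exact hl2 ((Nat.prime_dvd_prime_iff_eq hl Nat.prime_two).1 this)
  have hl4 : ¬ (l : ℤ) ∣ 4 := by
    intro hd
    have := hlI.dvd_of_dvd_pow (show (l : ℤ) ∣ 2 ^ 2 from hd)
    exact hl2 ((Nat.prime_dvd_prime_iff_eq hl Nat.prime_two).1 (by exact_mod_cast this))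
  have key : ∀ z : ℤ, (z : 𝓞 E) ^ 2 - w * z + b ∈ v.asIdeal ↔
      (((2 * z - w : ℤ) : ZMod l)) ^ 2 = u := by
    intro z
    have e1 : (((2 * z - w : ℤ) : ZMod l)) ^ 2 = u ↔ (l : ℤ) ∣ (2 * z - w) ^ 2 - u := by
      rw [← ZMod.intCast_zmod_eq_zero_iff_dvd, ← sub_eq_zero]
      push_cast
      rfl
    rw [e1, ← intCast_mem_iff hl hv]
    have e2 : (((2 * z - w) ^ 2 - u : ℤ) : 𝓞 E) =
        ((4 : ℤ) : 𝓞 E) * ((z : 𝓞 E) ^ 2 - w * z + b) + (β - u) := by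
      push_cast
      linear_combination h2
    rw [e2, Submodule.add_mem_iff_left _ hβu]
    exact ⟨fun h => Ideal.mul_mem_left _ _ h, fun h => intCast_mem_of_mul_mem hl hv hl4 h⟩
  rw [IsHalf.split_iff_exists_int hG hres hβ h1 h2 h3]
  constructor
  · rintro ⟨z, hz⟩
    exact ⟨_, by rw [← (key z).1 hz, sq]⟩
  · rintro ⟨g, hg⟩
    obtain ⟨z, hz⟩ := ZMod.intCast_surjective ((g + (w : ZMod l)) / 2)
    refine ⟨z, (key z).2 ?_⟩
    push_cast
    rw [hz, hg]
    field_simp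
    ring

end

namespace ReflexDatum

variable {D Dt : ℕ} {x y c : ℤ} {ω : 𝓞 E} {ξ ζ η : 𝓞 L} (h : ReflexDatum D Dt x y c ω ξ ζ η)
include h

/-- The entries of the matrix `m T`. -/
lemma exists_entries {m k : ℤ} (hk : (D : ℤ) ∣ 2 * k - m * x) :
    ∃ A B C d : ℤ, D * C = 2 * k - m * x ∧ 2 * B = -(m * y + D * C) ∧ (D : ℤ) = 1 + 4 * d ∧
      A = -k - D * B - D * d * C := by
  obtain ⟨C, hC⟩ := hk
  have hpar : (x - y) % 2 = 0 := by
    have h1 := h.norm_eq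
    have h2 := h.mod_four
    obtain ⟨d, hd⟩ : ∃ d : ℤ, (D : ℤ) = 1 + 4 * d := ⟨(D : ℤ) / 4, by omega⟩
    have h3 : (x - y) * (x + y) = 2 * (2 * Dt + 2 * d * y ^ 2) := by
      rw [hd] at h1
      linear_combination h1
    rcases Int.even_or_odd (x - y) with h4 | h4
    · exact Int.even_iff.1 h4
    · have h5 : Odd (x + y) := by
        have : x + y = (x - y) + 2 * y := by ring
        rw [this]
        exact h4.add_even (even_two_mul y)
      have := h4.mul h5
      rw [h3] at this
      exact absurd this (by simp)
  obtain ⟨b, hb⟩ : ∃ b, x - y = 2 * b := ⟨(x - y) / 2, by omega⟩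
  obtain ⟨d, hd⟩ : ∃ d : ℤ, (D : ℤ) = 1 + 4 * d := ⟨(D : ℤ) / 4, by have := h.mod_four; omega⟩
  -- Since D C = 2k − m x, the equation 2B = −(m y + D C) reads B = m(x − y)/2 − k, integral because
  -- x and y have the same parity.
  refine ⟨_, m * b - k, C, d, hC.symm, ?_, hd, rfl⟩
  linear_combination -hC - m * hb

/-- Inserting m x = 2k − D C and m y = −2B − D C into x² − D y² = 4 D̃ and comparing with 4 D Q = m²
D̃ − k² gives the determinant. -/
lemma det_entries {m k A B C d Q : ℤ} (hC : D * C = 2 * k - m * x)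
    (hB : 2 * B = -(m * y + D * C)) (hd : (D : ℤ) = 1 + 4 * d) (hA : A = -k - D * B - D * d * C)
    (hQ : 4 * (D : ℤ) * Q = m ^ 2 * Dt - k ^ 2) : A * C - B ^ 2 = 4 * Q := by
  have hD0 : (4 * D : ℤ) ≠ 0 := by
    have := h.prime.ne_zero
    positivity
  apply mul_left_cancel₀ hD0
  have h1 := h.norm_eq
  have hB' : m * y = -2 * B - D * C := by linarith
  have hx : m * x = 2 * k - D * C := by linarith
  have h2 : m ^ 2 * (4 * Dt) = (2 * k - D * C) ^ 2 - D * (-2 * B - D * C) ^ 2 := by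
    rw [← h1, ← hB', ← hx]
    ring
  subst hA
  have h3 : 4 * ((D : ℤ) * d) = D * (D - 1) := by rw [hd]; ring
  linear_combination (-4) * hQ - h2 - D * C ^ 2 * h3

/-- Otherwise l divides B as well, hence k. This yields D² ∣ D̃ for l = D, an even D̃ for l = 2, and
a common odd factor of x and y in the remaining case. So one diagonal entry is always available for
computing the symbol. -/
lemma not_dvd_entries {l : ℕ} (hl : l.Prime) {m k A B C d Q : ℤ} (hC : D * C = 2 * k - m * x)
    (hB : 2 * B = -(m * y + D * C)) (hd : (D : ℤ) = 1 + 4 * d) (hA : A = -k - D * B - D * d * C)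
    (hQ : 4 * (D : ℤ) * Q = m ^ 2 * Dt - k ^ 2) (hlm : ¬ (l : ℤ) ∣ m) (hlQ : (l : ℤ) ∣ Q) :
    ¬ (l : ℤ) ∣ A ∨ (l ≠ D ∧ ¬ (l : ℤ) ∣ C) := by
  have hlI := Nat.prime_iff_prime_int.1 hl
  by_contra! hcon
  obtain ⟨hlA, hlC⟩ := hcon
  have hlB : (l : ℤ) ∣ B := by
    refine hlI.dvd_of_dvd_pow (n := 2) ?_
    have : B ^ 2 = A * C - 4 * Q := by linear_combination -(h.det_entries hC hB hd hA hQ)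
    rw [this]
    exact dvd_sub (hlA.mul_right _) (hlQ.mul_left _)
  by_cases hlD : l = D
  · subst hlD
    have hk : (l : ℤ) ∣ k := by
      have : k = -A - l * (B + d * C) := by linear_combination hA
      rw [this]
      exact dvd_sub hlA.neg_right (Dvd.intro _ rfl)
    have h2 : (l : ℤ) ^ 2 ∣ m ^ 2 * Dt := by
      have : m ^ 2 * Dt = l * (4 * Q) + k ^ 2 := by linear_combination -hQ
      rw [this, sq]
      refine dvd_add (mul_dvd_mul_left _ (hlQ.mul_left _)) ?_
      rw [← sq]
      exact pow_dvd_pow_of_dvd hk 2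
    have h3 : IsCoprime ((l : ℤ) ^ 2) (m ^ 2) := (hlI.irreducible.coprime_iff_not_dvd.2 hlm).pow
    have h4 := h3.dvd_of_dvd_mul_left h2
    have h5 : l * l ∣ Dt := by
      rw [← sq]
      exact_mod_cast h4
    exact hl.one_lt.ne' (Nat.isUnit_iff.1 (h.squarefree l h5))
  · have hlC := hlC hlD
    have hk : (l : ℤ) ∣ k := by
      have : k = -A - D * B - D * d * C := by linear_combination hA
      rw [this]
      exact dvd_sub (dvd_sub hlA.neg_right (hlB.mul_left _)) (hlC.mul_left _)
    by_cases hl2 : l = 2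
    · subst hl2
      have h1 : (m ^ 2 * Dt) % 2 = 1 := by
        have h4 : (Dt : ℤ) % 2 = 1 := by have := h.disc; omega
        have h5 : m % 2 = 1 := by omega
        rw [Int.mul_emod, pow_two, Int.mul_emod m m, h5, h4]
        rfl
      have h2 : (2 : ℤ) ∣ k ^ 2 := dvd_pow hk two_ne_zero
      have h3 : m ^ 2 * Dt = 2 * (2 * D * Q) + k ^ 2 := by linear_combination -hQ
      omega
    · refine h.not_dvd_x_and_y hl hl2 ⟨?_, ?_⟩
      · refine (hlI.dvd_or_dvd ?_).resolve_left hlm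
        rw [show m * x = 2 * k - D * C by linear_combination hC]
        exact dvd_sub (hk.mul_left _) (hlC.mul_left _)
      · refine (hlI.dvd_or_dvd ?_).resolve_left hlm
        rw [show m * y = -2 * B - D * C by linear_combination hB]
        exact dvd_sub (hlB.mul_left _) (hlC.mul_left _)

section

variable {l : ℕ} (hl : l.Prime) {v : HeightOneSpectrum (𝓞 E)} (hv : (l : 𝓞 E) ∈ v.asIdeal)
    {m k e A B C d : ℤ} (he : 2 * e = m + k) (hlm : ¬ (l : ℤ) ∣ m)
    (hτ : (m : 𝓞 E) * ω - e ∈ v.asIdeal)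
    (hC : D * C = 2 * k - m * x)
    (hB : 2 * B = -(m * y + D * C)) (hd : (D : ℤ) = 1 + 4 * d) (hA : A = -k - D * B - D * d * C)
include hl hv he hlm hτ hC hB hd hA

/-- The generator η is used: mη² = −A − 4d(mω − e), with mω − e in v. -/
lemma split_iff_of_not_dvd_A (hlA : ¬ (l : ℤ) ∣ A) :
    (∃ g : ℤ, 4 ∣ g ^ 2 - m * (-A)) ∧ ((v.asIdeal.primesOver (𝓞 L)).ncard = 2 ↔
      ∃ g : ℤ, (4 * l : ℤ) ∣ g ^ 2 - m * (-A)) := by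
  have := h.isGalois
  obtain ⟨β, h1, -, h2⟩ := h.exists_isHalf_η
  have hdE : (D : 𝓞 E) = 1 + 4 * d := by exact_mod_cast congrArg (Int.cast : ℤ → 𝓞 E) hd
  have heE : 2 * (e : 𝓞 E) = m + k := by exact_mod_cast congrArg (Int.cast : ℤ → 𝓞 E) he
  have hCE : (D : 𝓞 E) * C = 2 * k - m * x := by
    exact_mod_cast congrArg (Int.cast : ℤ → 𝓞 E) hC
  have hBE : 2 * (B : 𝓞 E) = -(m * y + D * C) := by
    exact_mod_cast congrArg (Int.cast : ℤ → 𝓞 E) hB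
  have hAE : (A : 𝓞 E) = -k - D * B - D * d * C := by
    exact_mod_cast congrArg (Int.cast : ℤ → 𝓞 E) hA
  have hσ : (m : 𝓞 E) * β - ((-A : ℤ) : 𝓞 E) = 4 * (-(d * (m * ω - e))) := by
    have h4 : (4 : 𝓞 E) ≠ 0 := by norm_num
    apply mul_left_cancel₀ h4
    push_cast
    linear_combination (m : 𝓞 E) * h2 + 4 * hAE - 2 * D * hBE + (D + 1) * hCE +
      (D * C - 4 * (m * ω - e)) * hdE - 2 * (D - 1) * heE
  exact ⟨h1.exists_four_dvd h.basis hσ, h1.split_iff h.basis h.card_gal hl hv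
    (h.basis.exists_int_sub_mem hl hv hlm hτ) hlm (by rwa [Int.dvd_neg]) hσ
    (neg_mem (Ideal.mul_mem_left _ _ hτ))⟩

/-- The generator ζ is used: mζ² = −D²C − 4D(mω − e), with D²C prime to l. -/
lemma split_iff_of_not_dvd_C (hlD : l ≠ D) (hlC : ¬ (l : ℤ) ∣ C) :
    (∃ g : ℤ, 4 ∣ g ^ 2 - m * (-(D ^ 2 * C))) ∧ ((v.asIdeal.primesOver (𝓞 L)).ncard = 2 ↔
      ∃ g : ℤ, (4 * l : ℤ) ∣ g ^ 2 - m * (-(D ^ 2 * C))) := by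
  have := h.isGalois
  have hlI := Nat.prime_iff_prime_int.1 hl
  have heE : 2 * (e : 𝓞 E) = m + k := by exact_mod_cast congrArg (Int.cast : ℤ → 𝓞 E) he
  have hCE : (D : 𝓞 E) * C = 2 * k - m * x := by
    exact_mod_cast congrArg (Int.cast : ℤ → 𝓞 E) hC
  have hσ : (m : 𝓞 E) * (D * (x - 2 * (2 * ω - 1))) - ((-(D ^ 2 * C) : ℤ) : 𝓞 E) =
      4 * (-(D * (m * ω - e))) := by
    push_cast
    linear_combination (D : 𝓞 E) * hCE - 2 * D * heE
  refine ⟨h.isHalf_ζ.exists_four_dvd h.basis hσ, h.isHalf_ζ.split_iff h.basis h.card_gal hl hv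
    (h.basis.exists_int_sub_mem hl hv hlm hτ) hlm (fun hd => ?_) hσ
    (neg_mem (Ideal.mul_mem_left _ _ hτ))⟩
  rw [Int.dvd_neg] at hd
  rcases hlI.dvd_or_dvd hd with hd | hd
  · have := hlI.dvd_of_dvd_pow hd
    exact hlD ((Nat.prime_dvd_prime_iff_eq hl h.prime).1 (by exact_mod_cast this))
  · exact hlC hd

end

/-- The splitting behaviour at two conjugate primes. -/
lemma split_conj_iff {l : ℕ} (hl : l.Prime) (hl2 : l ≠ 2) (hlD : l ≠ D) (hlDt : ¬ (l : ℤ) ∣ Dt)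
    {v v' : HeightOneSpectrum (𝓞 E)} (hv : (l : 𝓞 E) ∈ v.asIdeal) (hv' : (l : 𝓞 E) ∈ v'.asIdeal)
    {m k e : ℤ} (he : 2 * e = m + k) (hlm : ¬ (l : ℤ) ∣ m)
    (hτ : (m : 𝓞 E) * ω - e ∈ v.asIdeal) (hτ' : (m : 𝓞 E) * ω - e ∉ v'.asIdeal)
    (hN : (l : ℤ) ∣ m ^ 2 * Dt - k ^ 2) :
    (v'.asIdeal.primesOver (𝓞 L)).ncard = 2 ↔
      ((v.asIdeal.primesOver (𝓞 L)).ncard = 2 ↔ IsSquare (D : ZMod l)) := by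
  have := h.isGalois
  have hlI := Nat.prime_iff_prime_int.1 hl
  have := Fact.mk hl
  have heE : 2 * (e : 𝓞 E) = m + k := by exact_mod_cast congrArg (Int.cast : ℤ → 𝓞 E) he
  have hres := h.basis.exists_int_sub_mem hl hv hlm hτ
  have h2v' : (2 : 𝓞 E) ∉ v'.asIdeal := by
    intro h2
    have := (intCast_mem_iff hl hv' 2).1 (by exact_mod_cast h2)
    exact hl2 ((Nat.prime_dvd_prime_iff_eq hl Nat.prime_two).1 (by exact_mod_cast this))
  have hl22 : ¬ (l : ℤ) ∣ 2 := fun hd =>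
    hl2 ((Nat.prime_dvd_prime_iff_eq hl Nat.prime_two).1 (by exact_mod_cast hd))
  have hτ2 : (m : 𝓞 E) * ω - ((m - e : ℤ) : 𝓞 E) ∈ v'.asIdeal := by
    have h1 : (2 * (m * ω - e)) * (2 * ((m : 𝓞 E) * ω - ((m - e : ℤ) : 𝓞 E))) ∈ v'.asIdeal := by
      have : (2 * (m * ω - e)) * (2 * ((m : 𝓞 E) * ω - ((m - e : ℤ) : 𝓞 E))) =
          ((m ^ 2 * Dt - k ^ 2 : ℤ) : 𝓞 E) := by
        push_cast
        linear_combination (m : 𝓞 E) ^ 2 * h.r_sq + (2 * m - 2 * e - k - m) * heE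
      rw [this]
      exact (intCast_mem_iff hl hv' _).2 hN
    rcases v'.isPrime.mem_or_mem h1 with h1 | h1
    · exact absurd ((v'.isPrime.mem_or_mem h1).resolve_left h2v') hτ'
    · exact (v'.isPrime.mem_or_mem h1).resolve_left h2v'
  have hres' := h.basis.exists_int_sub_mem hl hv' hlm hτ2
  -- The integer q represents r modulo v and −r modulo v', because m r ≡ k modulo v and m r ≡ −k
  -- modulo v'.
  obtain ⟨q, hq⟩ := hres (2 * ω - 1)
  have hq' : (2 * ω - 1) + (q : 𝓞 E) ∈ v'.asIdeal := by
    have h1 : (l : ℤ) ∣ m * q - k := by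
      rw [← intCast_mem_iff hl hv]
      have : ((m * q - k : ℤ) : 𝓞 E) = 2 * (m * ω - e) - m * (2 * ω - 1 - q) := by
        push_cast
        linear_combination heE
      rw [this]
      exact sub_mem (Ideal.mul_mem_left _ _ hτ) (Ideal.mul_mem_left _ _ hq)
    refine intCast_mem_of_mul_mem hl hv' hlm ?_
    have : (m : 𝓞 E) * ((2 * ω - 1) + q) =
        2 * ((m : 𝓞 E) * ω - ((m - e : ℤ) : 𝓞 E)) + ((m * q - k : ℤ) : 𝓞 E) := by
      push_cast
      linear_combination -heE
    rw [this]
    exact add_mem (Ideal.mul_mem_left _ _ hτ2) ((intCast_mem_iff hl hv' _).2 h1)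
  have hDl : ¬ (l : ℤ) ∣ D := fun hd =>
    hlD ((Nat.prime_dvd_prime_iff_eq hl h.prime).1 (by exact_mod_cast hd))
  have hχ : ∀ u : ℤ, ¬ (l : ℤ) ∣ u → (IsSquare ((D * u : ℤ) : ZMod l) ↔
      (IsSquare (u : ZMod l) ↔ IsSquare (D : ZMod l))) := by
    intro u hu
    have hu0 : (u : ZMod l) ≠ 0 := by rwa [Ne, ZMod.intCast_zmod_eq_zero_iff_dvd]
    have hD0 : ((D : ℤ) : ZMod l) ≠ 0 := by rwa [Ne, ZMod.intCast_zmod_eq_zero_iff_dvd]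
    have hDu0 : ((D * u : ℤ) : ZMod l) ≠ 0 := by push_cast; exact mul_ne_zero (by simpa using hD0) hu0
    have e1 := legendreSym.eq_one_iff l hDu0
    have e2 := legendreSym.eq_one_iff l hu0
    have e3 := legendreSym.eq_one_iff l hD0
    rw [Int.cast_natCast] at e3
    rw [← e1, ← e2, ← e3, legendreSym.mul]
    rcases legendreSym.eq_one_or_neg_one l hu0 with h1 | h1 <;>
    rcases legendreSym.eq_one_or_neg_one l hD0 with h2 | h2 <;> rw [h1, h2] <;> decide
  -- At one prime the discriminant is ζ² = D(x − 2r), at the other ξ² = x + 2r; their residues are D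
  -- u and u for the same integer u. One takes u = x − 2q or u = x + 2q, whichever is prime to l.
  by_cases hu : (l : ℤ) ∣ x + 2 * q
  · have hu' : ¬ (l : ℤ) ∣ x - 2 * q := by
      intro hu'
      have hq0 : (l : ℤ) ∣ q := by
        have h4 : (l : ℤ) ∣ 2 * (2 * q) := by
          rw [show 2 * (2 * q) = (x + 2 * q) - (x - 2 * q) by ring]
          exact dvd_sub hu hu'
        exact (hlI.dvd_or_dvd ((hlI.dvd_or_dvd h4).resolve_left hl22)).resolve_left hl22
      apply hlDt
      rw [← intCast_mem_iff hl hv]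
      have : ((Dt : ℤ) : 𝓞 E) = (2 * ω - 1) * (2 * ω - 1 - q) + (2 * ω - 1) * q := by
        push_cast
        linear_combination -h.r_sq
      rw [this]
      exact add_mem (Ideal.mul_mem_left _ _ hq)
        (Ideal.mul_mem_left _ _ ((intCast_mem_iff hl hv q).2 hq0))
    have a1 := h.isHalf_ζ.split_iff_isSquare h.card_gal hl hv hres hl2 (u := D * (x - 2 * q))
      (fun hd => (hlI.dvd_or_dvd hd).elim hDl hu') (by
        have : (D : 𝓞 E) * (x - 2 * (2 * ω - 1)) - ((D * (x - 2 * q) : ℤ) : 𝓞 E) =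
          (-2 * D) * (2 * ω - 1 - q) := by push_cast; ring
        rw [this]
        exact Ideal.mul_mem_left _ _ hq)
    have a2 := h.isHalf_ξ.split_iff_isSquare h.card_gal hl hv' hres' hl2 (u := x - 2 * q) hu' (by
        have : (x : 𝓞 E) + 2 * (2 * ω - 1) - ((x - 2 * q : ℤ) : 𝓞 E) =
          2 * (2 * ω - 1 + q) := by push_cast; ring
        rw [this]
        exact Ideal.mul_mem_left _ _ hq')
    rw [a1, a2, hχ _ hu']
    tauto
  · have a1 := h.isHalf_ζ.split_iff_isSquare h.card_gal hl hv' hres' hl2 (u := D * (x + 2 * q))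
      (fun hd => (hlI.dvd_or_dvd hd).elim hDl hu) (by
        have : (D : 𝓞 E) * (x - 2 * (2 * ω - 1)) - ((D * (x + 2 * q) : ℤ) : 𝓞 E) =
          (-2 * D) * (2 * ω - 1 + q) := by push_cast; ring
        rw [this]
        exact Ideal.mul_mem_left _ _ hq')
    have a2 := h.isHalf_ξ.split_iff_isSquare h.card_gal hl hv hres hl2 (u := x + 2 * q) hu (by
        have : (x : 𝓞 E) + 2 * (2 * ω - 1) - ((x + 2 * q : ℤ) : 𝓞 E) =
          2 * (2 * ω - 1 - q) := by push_cast; ring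
        rw [this]
        exact Ideal.mul_mem_left _ _ hq)
    rw [a1, a2, hχ _ hu]

end ReflexDatum

end Split

/-! ### Hilbert symbols (a, l)_l and squares modulo 4l -/

section Hilbert

variable {l : ℕ} [Fact l.Prime]

lemma hilbertSymbol_mul_sq {a b s : ℚ_[l]} (hs : s ≠ 0) :
    hilbertSymbol l (a * s ^ 2) b = hilbertSymbol l a b := by
  unfold hilbertSymbol
  congr 1
  apply propext
  constructor
  · rintro ⟨x, y, z, h0, h⟩
    refine ⟨s * x, y, z, h0.imp_left (mul_ne_zero hs), ?_⟩
    rw [h]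
    ring
  · rintro ⟨x, y, z, h0, h⟩
    refine ⟨x / s, y, z, h0.imp_left fun hx => div_ne_zero hx hs, ?_⟩
    rw [h]
    field_simp

lemma hilbertSymbol_eq_one_or (a b : ℚ_[l]) : hilbertSymbol l a b = 1 ∨ hilbertSymbol l a b = -1 := by
  unfold hilbertSymbol
  split_ifs <;> simp

/-- Hensel's lemma for X² − a at the unit s: the derivative 2s has norm |2|, and |s² − a| ≤ |4l| <
|2|². -/
lemma padicInt_exists_sq_eq_of_dvd {s a : ℤ_[l]} (hs : IsUnit s)
    (h : (4 * l : ℤ_[l]) ∣ s ^ 2 - a) : ∃ t : ℤ_[l], t ^ 2 = a := by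
  have hl := (Fact.out : l.Prime)
  obtain ⟨c, hc⟩ := h
  have h2 : (0 : ℝ) < ‖(2 : ℤ_[l])‖ := norm_pos_iff.2 (by norm_num)
  have hn := hensels_lemma (F := (Polynomial.X ^ 2 - Polynomial.C a : Polynomial ℤ_[l])) (a := s) (by
    simp only [Polynomial.aeval_sub, Polynomial.aeval_X_pow, Polynomial.aeval_C,
      Polynomial.derivative_sub, Polynomial.derivative_X_pow, Polynomial.derivative_C, sub_zero]
    simp only [Algebra.algebraMap_self, RingHom.id_apply, map_mul, Polynomial.aeval_X_pow]
    rw [hc]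
    have h4 : (4 : ℤ_[l]) = 2 * 2 := by norm_num
    have hlt : ‖(l : ℤ_[l])‖ * ‖c‖ < 1 := by
      have h1 : ‖(l : ℤ_[l])‖ < 1 := by
        rw [PadicInt.norm_p]
        exact inv_lt_one_of_one_lt₀ (by exact_mod_cast hl.one_lt)
      calc _ ≤ ‖(l : ℤ_[l])‖ * 1 := by gcongr; exact PadicInt.norm_le_one c
        _ < 1 := by rwa [mul_one]
    simp [PadicInt.isUnit_iff.1 hs, h4]
    rw [PadicInt.norm_p] at hlt
    nlinarith [mul_pos (mul_pos h2 h2) (sub_pos.2 hlt)])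
  obtain ⟨z, hz, -⟩ := hn
  refine ⟨z, ?_⟩
  simp at hz
  linear_combination hz

/-- A primitive solution over `ℤ_l`. -/
lemma exists_primitive {a b x y z : ℚ_[l]} (h0 : x ≠ 0 ∨ y ≠ 0 ∨ z ≠ 0)
    (h : z ^ 2 = a * x ^ 2 + b * y ^ 2) :
    ∃ x y z : ℤ_[l], (IsUnit x ∨ IsUnit y ∨ IsUnit z) ∧
      (z : ℚ_[l]) ^ 2 = a * (x : ℚ_[l]) ^ 2 + b * (y : ℚ_[l]) ^ 2 := by
  -- A coordinate of largest norm; dividing by it makes all coordinates integral and one of them 1.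
  obtain ⟨w, hw, hw0, hx, hy, hz⟩ : ∃ w : ℚ_[l], (w = x ∨ w = y ∨ w = z) ∧ w ≠ 0 ∧
      ‖x‖ ≤ ‖w‖ ∧ ‖y‖ ≤ ‖w‖ ∧ ‖z‖ ≤ ‖w‖ := by
    have hne : ∀ w : ℚ_[l], ‖x‖ ≤ ‖w‖ → ‖y‖ ≤ ‖w‖ → ‖z‖ ≤ ‖w‖ → w ≠ 0 := by
      rintro w hx hy hz rfl
      simp only [norm_zero, norm_le_zero_iff] at hx hy hz
      tauto
    rcases le_total ‖x‖ ‖y‖ with h1 | h1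
    · rcases le_total ‖y‖ ‖z‖ with h2 | h2
      · exact ⟨z, by simp, hne z (h1.trans h2) h2 le_rfl, h1.trans h2, h2, le_rfl⟩
      · exact ⟨y, by simp, hne y h1 le_rfl h2, h1, le_rfl, h2⟩
    · rcases le_total ‖x‖ ‖z‖ with h2 | h2
      · exact ⟨z, by simp, hne z h2 (h1.trans h2) le_rfl, h2, h1.trans h2, le_rfl⟩
      · exact ⟨x, by simp, hne x le_rfl h1 h2, le_rfl, h1, h2⟩
  have hle : ∀ u : ℚ_[l], ‖u‖ ≤ ‖w‖ → ‖u / w‖ ≤ 1 := fun u hu => by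
    rw [norm_div]
    exact div_le_one_of_le₀ hu (norm_nonneg _)
  refine ⟨⟨x / w, hle x hx⟩, ⟨y / w, hle y hy⟩, ⟨z / w, hle z hz⟩, ?_, ?_⟩
  · have hw1 : ‖w / w‖ = 1 := by rw [div_self hw0, norm_one]
    rcases hw with h | h | h
    · exact Or.inl (PadicInt.isUnit_iff.2 (by subst h; exact hw1))
    · exact Or.inr (Or.inl (PadicInt.isUnit_iff.2 (by subst h; exact hw1)))
    · exact Or.inr (Or.inr (PadicInt.isUnit_iff.2 (by subst h; exact hw1)))
  · change (z / w) ^ 2 = a * (x / w) ^ 2 + b * (y / w) ^ 2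
    field_simp
    exact h

lemma padicInt_isUnit_of_not_dvd {a : ℤ_[l]} (h : ¬ (l : ℤ_[l]) ∣ a) : IsUnit a := by
  by_contra hu
  rw [PadicInt.isUnit_iff] at hu
  exact h (PadicInt.norm_lt_one_iff_dvd a |>.1 (lt_of_le_of_ne (PadicInt.norm_le_one a) hu))

lemma padicInt_exists_int_dvd_sub (u : ℤ_[l]) (n : ℕ) : ∃ g : ℤ, (l : ℤ_[l]) ^ n ∣ u - g := by
  refine ⟨u.appr n, ?_⟩
  have := PadicInt.appr_spec n u
  rw [Ideal.mem_span_singleton] at this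
  simpa using this

lemma padicInt_natCast_dvd_intCast (a : ℤ) : (l : ℤ_[l]) ∣ a ↔ (l : ℤ) ∣ a := by
  have := PadicInt.pow_p_dvd_int_iff (p := l) 1 a
  simpa using this

/-- The symbol `(a, l)_l` for a unit `a`, congruent to a square modulo `4`. -/
lemma hilbertSymbol_eq_one_iff {a : ℤ} (ha : ¬ (l : ℤ) ∣ a) (h4 : ∃ g : ℤ, 4 ∣ g ^ 2 - a) :
    hilbertSymbol l (a : ℚ_[l]) (l : ℚ_[l]) = 1 ↔ ∃ g : ℤ, (4 * l : ℤ) ∣ g ^ 2 - a := by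
  have hl := (Fact.out : l.Prime)
  have hlI := Nat.prime_iff_prime_int.1 hl
  have hlp : Prime (l : ℤ_[l]) := PadicInt.prime_p
  have hsym : hilbertSymbol l (a : ℚ_[l]) (l : ℚ_[l]) = 1 ↔ ∃ x y z : ℚ_[l],
      (x ≠ 0 ∨ y ≠ 0 ∨ z ≠ 0) ∧ z ^ 2 = a * x ^ 2 + l * y ^ 2 := by
    unfold hilbertSymbol
    split_ifs with h <;> simp [h]
  rw [hsym]
  constructor
  · rintro ⟨x', y', z', h0, h⟩
    obtain ⟨x, y, z, hu, hxyz⟩ := exists_primitive h0 h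
    have hxyz : z ^ 2 = a * x ^ 2 + l * y ^ 2 := Subtype.ext (by push_cast; exact hxyz)
    -- If l divided x, it would divide z, then l² would divide l y², so l would divide y too,
    -- contradicting primitivity.
    have hx : IsUnit x := by
      by_contra hx
      have hlx : (l : ℤ_[l]) ∣ x := by
        by_contra hd
        exact hx (padicInt_isUnit_of_not_dvd hd)
      have hlz : (l : ℤ_[l]) ∣ z := by
        refine hlp.dvd_of_dvd_pow (n := 2) ?_
        rw [hxyz]
        exact dvd_add ((dvd_pow hlx two_ne_zero).mul_left _) (Dvd.intro _ rfl)
      have hly : (l : ℤ_[l]) ∣ y := by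
        obtain ⟨x1, rfl⟩ := hlx
        obtain ⟨z1, rfl⟩ := hlz
        refine hlp.dvd_of_dvd_pow (n := 2) ⟨z1 ^ 2 - a * x1 ^ 2, mul_left_cancel₀ hlp.ne_zero ?_⟩
        linear_combination -hxyz
      rcases hu with hu | hu | hu
      · exact hlp.not_isUnit (isUnit_of_dvd_unit hlx hu)
      · exact hlp.not_isUnit (isUnit_of_dvd_unit hly hu)
      · exact hlp.not_isUnit (isUnit_of_dvd_unit hlz hu)
    obtain ⟨x1, hx1⟩ := hx.exists_right_inv
    obtain ⟨U, V, hUV⟩ : ∃ U V : ℤ_[l], U ^ 2 = a + l * V ^ 2 := by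
      refine ⟨z * x1, y * x1, ?_⟩
      linear_combination x1 ^ 2 * hxyz + a * (x * x1 + 1) * hx1
    -- The precision l³ is needed only for l = 2, where it equals 4l = 8.
    obtain ⟨g, W, hg⟩ := padicInt_exists_int_dvd_sub U 3
    obtain ⟨g0, hg0⟩ := h4
    have hgl : (l : ℤ) ∣ g ^ 2 - a := by
      rw [← padicInt_natCast_dvd_intCast]
      refine ⟨V ^ 2 - l ^ 2 * W * (U + g), ?_⟩
      push_cast
      linear_combination hUV - (U + g) * hg
    by_cases hl2 : l = 2
    · subst hl2
      refine ⟨g, ?_⟩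
      have hgo : g % 2 = 1 := by
        by_contra hcon
        have he : (2 : ℤ) ∣ g ^ 2 := dvd_pow (by omega) two_ne_zero
        push_cast at hgl ha
        omega
      have hg0o : g0 % 2 = 1 := by
        by_contra hcon
        have he : (2 : ℤ) ∣ g0 ^ 2 := dvd_pow (by omega) two_ne_zero
        push_cast at ha
        omega
      have hg4 : (4 : ℤ) ∣ g ^ 2 - a := by
        have a1 := Int.eight_dvd_sq_sub_one_of_odd (Int.odd_iff.2 hgo)
        have a2 := Int.eight_dvd_sq_sub_one_of_odd (Int.odd_iff.2 hg0o)
        omega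
      have e1 : ((g ^ 2 - a : ℤ) : ℤ_[2]) = 2 * V ^ 2 - 8 * (W * (U + g)) := by
        push_cast at hUV hg ⊢
        linear_combination hUV - (U + g) * hg
      obtain ⟨q, hq⟩ := hg4
      -- Here the square root modulo 4 enters: g² ≡ a modulo 4 makes 2V² divisible by 4, so V is
      -- even and g² − a is divisible by 8.
      have hV : ((2 : ℕ) : ℤ_[2]) ∣ V := by
        refine hlp.dvd_of_dvd_pow (n := 2) ⟨q + 2 * (W * (U + g)), mul_left_cancel₀ hlp.ne_zero ?_⟩
        rw [hq] at e1
        push_cast at e1 ⊢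
        linear_combination -e1
      obtain ⟨V1, rfl⟩ := hV
      have := (PadicInt.pow_p_dvd_int_iff (p := 2) 3 (g ^ 2 - a)).1
        ⟨V1 ^ 2 - W * (U + g), by rw [e1]; push_cast; ring⟩
      simpa using this
    · have hc : IsCoprime (l : ℤ) (4 : ℤ) := by
        refine hlI.irreducible.coprime_iff_not_dvd.2 fun hd => hl2 ?_
        have := hlI.dvd_of_dvd_pow (show (l : ℤ) ∣ 2 ^ 2 from hd)
        exact (Nat.prime_dvd_prime_iff_eq hl Nat.prime_two).1 (by exact_mod_cast this)
      obtain ⟨p, q, hpq⟩ := id hc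
      -- Chinese remainder theorem: the witness is g0 modulo 4 and g modulo l.
      refine ⟨g0 * (p * l) + g * (q * 4), hc.symm.mul_dvd ?_ ?_⟩
      · have : (g0 * (p * l) + g * (q * 4)) ^ 2 - a = (g0 ^ 2 - a) +
            4 * (q * (g - g0) * (g0 * (p * l) + g * (q * 4) + g0)) := by
          linear_combination g0 * (g0 * (p * l) + g * (q * 4) + g0) * hpq
        rw [this]
        exact dvd_add hg0 (Dvd.intro _ rfl)
      · have : (g0 * (p * l) + g * (q * 4)) ^ 2 - a = (g ^ 2 - a) +
            l * (p * (g0 - g) * (g0 * (p * l) + g * (q * 4) + g)) := by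
          linear_combination g * (g0 * (p * l) + g * (q * 4) + g) * hpq
        rw [this]
        exact dvd_add hgl (Dvd.intro _ rfl)
  · rintro ⟨g, hg⟩
    have hgu : IsUnit (g : ℤ_[l]) := by
      apply padicInt_isUnit_of_not_dvd
      rw [padicInt_natCast_dvd_intCast]
      intro hd
      apply ha
      have h1 : (l : ℤ) ∣ g ^ 2 - a := (Dvd.intro_left 4 rfl).trans hg
      exact (Int.dvd_iff_dvd_of_dvd_sub h1).1 (dvd_pow hd two_ne_zero)
    obtain ⟨c, hc⟩ := hg
    obtain ⟨t, ht⟩ := padicInt_exists_sq_eq_of_dvd (a := (a : ℤ_[l])) hgu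
      ⟨c, by exact_mod_cast congrArg (Int.cast : ℤ → ℤ_[l]) hc⟩
    refine ⟨1, 0, t, Or.inl one_ne_zero, ?_⟩
    have : (t : ℚ_[l]) ^ 2 = a := by exact_mod_cast congrArg (fun u : ℤ_[l] => (u : ℚ_[l])) ht
    rw [this]
    ring

end Hilbert

/-! ### Diagonalization of T over ℤ_l -/

section Diag

set_option linter.unusedSectionVars false

variable {l : ℕ} [Fact l.Prime] {T : Matrix (Fin 2) (Fin 2) ℚ} {m A B C Q : ℤ}
  (hm : ¬ (l : ℤ) ∣ m) (hdet : A * C - B ^ 2 = 4 * Q)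
  (hA : (m : ℚ) * T 0 0 = A) (hB : (m : ℚ) * T 0 1 = B) (hB' : (m : ℚ) * T 1 0 = B)
  (hC : (m : ℚ) * T 1 1 = C)

lemma isUnit_intCast_of_not_dvd {a : ℤ} (h : ¬ (l : ℤ) ∣ a) : IsUnit (a : ℤ_[l]) :=
  padicInt_isUnit_of_not_dvd (by rwa [padicInt_natCast_dvd_intCast])

include hm hA hB hB' hC

/-- Completing the square with the unit A clears the off-diagonal entry and leaves α = A/m. -/
lemma exists_isEquivDiag_of_not_dvd_left (h : ¬ (l : ℤ) ∣ A) : ∃ α : ℤ_[l]ˣ, IsEquivDiag l T α := by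
  obtain ⟨a, ha⟩ := isUnit_intCast_of_not_dvd h
  obtain ⟨u, hu⟩ := isUnit_intCast_of_not_dvd hm
  let M : Matrix (Fin 2) (Fin 2) ℤ_[l] := !![1, 0; -(B : ℤ_[l]) * (a⁻¹ : ℤ_[l]ˣ), 1]
  have hMdet : IsUnit M.det := by simp [M, Matrix.det_fin_two]
  obtain ⟨g, hg⟩ := (Matrix.isUnit_iff_isUnit_det M).2 hMdet
  refine ⟨a * u⁻¹, g, ?_⟩
  rw [hg]
  have hm0 : (m : ℚ_[l]) ≠ 0 := by
    have : m ≠ 0 := by rintro rfl; simp at hm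
    exact_mod_cast this
  have hA0 : (A : ℚ_[l]) ≠ 0 := by
    have : A ≠ 0 := by rintro rfl; simp at h
    exact_mod_cast this
  have ea : ((a : ℤ_[l]) : ℚ_[l]) = A := by rw [ha]; simp
  have eu : ((u : ℤ_[l]) : ℚ_[l]) = m := by rw [hu]; simp
  have eai : (((a⁻¹ : ℤ_[l]ˣ) : ℤ_[l]) : ℚ_[l]) = (A : ℚ_[l])⁻¹ := by
    refine eq_inv_of_mul_eq_one_left ?_
    rw [← ea]
    exact_mod_cast congrArg (fun z : ℤ_[l] => (z : ℚ_[l])) a.inv_mul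
  have eui : (((u⁻¹ : ℤ_[l]ˣ) : ℤ_[l]) : ℚ_[l]) = (m : ℚ_[l])⁻¹ := by
    refine eq_inv_of_mul_eq_one_left ?_
    rw [← eu]
    exact_mod_cast congrArg (fun z : ℤ_[l] => (z : ℚ_[l])) u.inv_mul
  have hA' : ((T 0 0 : ℚ) : ℚ_[l]) = A / m := by
    rw [eq_div_iff hm0]; rw [mul_comm]; exact_mod_cast congrArg (Rat.cast : ℚ → ℚ_[l]) hA
  have hBa : ((T 0 1 : ℚ) : ℚ_[l]) = B / m := by
    rw [eq_div_iff hm0]; rw [mul_comm]; exact_mod_cast congrArg (Rat.cast : ℚ → ℚ_[l]) hB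
  have hBb : ((T 1 0 : ℚ) : ℚ_[l]) = B / m := by
    rw [eq_div_iff hm0]; rw [mul_comm]; exact_mod_cast congrArg (Rat.cast : ℚ → ℚ_[l]) hB'
  have hC' : ((T 1 1 : ℚ) : ℚ_[l]) = C / m := by
    rw [eq_div_iff hm0]; rw [mul_comm]; exact_mod_cast congrArg (Rat.cast : ℚ → ℚ_[l]) hC
  ext i j
  fin_cases i <;> fin_cases j <;>
    simp [M, Matrix.mul_apply, Fin.sum_univ_two, Matrix.det_fin_two, hA', hBa, hBb, hC', ea, eai,
      eui] <;> field_simp <;> ring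

/-- The same after exchanging the two basis vectors; here α = C/m. -/
lemma exists_isEquivDiag_of_not_dvd_right (h : ¬ (l : ℤ) ∣ C) :
    ∃ α : ℤ_[l]ˣ, IsEquivDiag l T α := by
  obtain ⟨a, ha⟩ := isUnit_intCast_of_not_dvd h
  obtain ⟨u, hu⟩ := isUnit_intCast_of_not_dvd hm
  let M : Matrix (Fin 2) (Fin 2) ℤ_[l] := !![0, 1; 1, -(B : ℤ_[l]) * (a⁻¹ : ℤ_[l]ˣ)]
  have hMdet : IsUnit M.det := by simp [M, Matrix.det_fin_two]
  obtain ⟨g, hg⟩ := (Matrix.isUnit_iff_isUnit_det M).2 hMdet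
  refine ⟨a * u⁻¹, g, ?_⟩
  rw [hg]
  have hm0 : (m : ℚ_[l]) ≠ 0 := by
    have : m ≠ 0 := by rintro rfl; simp at hm
    exact_mod_cast this
  have hC0 : (C : ℚ_[l]) ≠ 0 := by
    have : C ≠ 0 := by rintro rfl; simp at h
    exact_mod_cast this
  have ea : ((a : ℤ_[l]) : ℚ_[l]) = C := by rw [ha]; simp
  have eu : ((u : ℤ_[l]) : ℚ_[l]) = m := by rw [hu]; simp
  have eai : (((a⁻¹ : ℤ_[l]ˣ) : ℤ_[l]) : ℚ_[l]) = (C : ℚ_[l])⁻¹ := by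
    refine eq_inv_of_mul_eq_one_left ?_
    rw [← ea]
    exact_mod_cast congrArg (fun z : ℤ_[l] => (z : ℚ_[l])) a.inv_mul
  have eui : (((u⁻¹ : ℤ_[l]ˣ) : ℤ_[l]) : ℚ_[l]) = (m : ℚ_[l])⁻¹ := by
    refine eq_inv_of_mul_eq_one_left ?_
    rw [← eu]
    exact_mod_cast congrArg (fun z : ℤ_[l] => (z : ℚ_[l])) u.inv_mul
  have hA' : ((T 0 0 : ℚ) : ℚ_[l]) = A / m := by
    rw [eq_div_iff hm0]; rw [mul_comm]; exact_mod_cast congrArg (Rat.cast : ℚ → ℚ_[l]) hA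
  have hBa : ((T 0 1 : ℚ) : ℚ_[l]) = B / m := by
    rw [eq_div_iff hm0]; rw [mul_comm]; exact_mod_cast congrArg (Rat.cast : ℚ → ℚ_[l]) hB
  have hBb : ((T 1 0 : ℚ) : ℚ_[l]) = B / m := by
    rw [eq_div_iff hm0]; rw [mul_comm]; exact_mod_cast congrArg (Rat.cast : ℚ → ℚ_[l]) hB'
  have hC' : ((T 1 1 : ℚ) : ℚ_[l]) = C / m := by
    rw [eq_div_iff hm0]; rw [mul_comm]; exact_mod_cast congrArg (Rat.cast : ℚ → ℚ_[l]) hC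
  ext i j
  fin_cases i <;> fin_cases j <;>
    simp [M, Matrix.mul_apply, Fin.sum_univ_two, Matrix.det_fin_two, hA', hBa, hBb, hC', ea, eai,
      eui] <;> field_simp <;> ring

/-- The first entry `α` of the diagonal form, in terms of the first row of the base change. -/
lemma IsEquivDiag.exists_row {α : ℤ_[l]ˣ} (hα : IsEquivDiag l T α) :
    ∃ u v : ℤ_[l], (m : ℤ_[l]) * α = A * u ^ 2 + 2 * B * u * v + C * v ^ 2 := by
  obtain ⟨g, hg⟩ := hα
  refine ⟨(g : Matrix (Fin 2) (Fin 2) ℤ_[l]) 0 0, (g : Matrix (Fin 2) (Fin 2) ℤ_[l]) 0 1, ?_⟩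
  have h00 := congrFun (congrFun hg 0) 0
  simp [Matrix.mul_apply, Fin.sum_univ_two] at h00
  have hA' : (m : ℚ_[l]) * ((T 0 0 : ℚ) : ℚ_[l]) = A := by
    exact_mod_cast congrArg (Rat.cast : ℚ → ℚ_[l]) hA
  have hBa : (m : ℚ_[l]) * ((T 0 1 : ℚ) : ℚ_[l]) = B := by
    exact_mod_cast congrArg (Rat.cast : ℚ → ℚ_[l]) hB
  have hBb : (m : ℚ_[l]) * ((T 1 0 : ℚ) : ℚ_[l]) = B := by
    exact_mod_cast congrArg (Rat.cast : ℚ → ℚ_[l]) hB'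
  have hC' : (m : ℚ_[l]) * ((T 1 1 : ℚ) : ℚ_[l]) = C := by
    exact_mod_cast congrArg (Rat.cast : ℚ → ℚ_[l]) hC
  apply Subtype.ext
  push_cast
  have h2 : ((2 : ℤ_[l]) : ℚ_[l]) = 2 := rfl
  rw [← h00, ← hA', ← hC', h2]
  linear_combination (-((g : Matrix (Fin 2) (Fin 2) ℤ_[l]) 0 0 : ℚ_[l]) *
    ((g : Matrix (Fin 2) (Fin 2) ℤ_[l]) 0 1 : ℚ_[l])) * (-hBa - hBb)

-- One has A·mα = (Au + Bv)² + (AC − B²)v² with AC − B² divisible by 4l. So the unit mAα is a square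
-- in ℤ_l, and −α differs from −mA by a square factor.
omit hA hB hB' hC in
include hdet in
lemma hilbertSymbol_neg_eq {α : ℤ_[l]ˣ} (hQ : (l : ℤ) ∣ Q) (h : ¬ (l : ℤ) ∣ A) {u v : ℤ_[l]}
    (huv : (m : ℤ_[l]) * α = A * u ^ 2 + 2 * B * u * v + C * v ^ 2) :
    hilbertSymbol l (-((α : ℤ_[l]) : ℚ_[l])) l = hilbertSymbol l ((m * (-A) : ℤ) : ℚ_[l]) l := by
  have hdet' : (A : ℤ_[l]) * C - B ^ 2 = 4 * Q := by
    exact_mod_cast congrArg (Int.cast : ℤ → ℤ_[l]) hdet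
  obtain ⟨q, rfl⟩ := hQ
  have key : (A * u + B * v) ^ 2 - m * A * α = (4 * l) * (-q * v ^ 2) := by
    push_cast at hdet'
    linear_combination (-(A : ℤ_[l])) * huv - v ^ 2 * hdet'
  have hlp : Prime (l : ℤ_[l]) := PadicInt.prime_p
  have hunit : IsUnit ((m : ℤ_[l]) * A * α) :=
    ((isUnit_intCast_of_not_dvd hm).mul (isUnit_intCast_of_not_dvd h)).mul α.isUnit
  have hs : IsUnit ((A : ℤ_[l]) * u + B * v) := by
    apply padicInt_isUnit_of_not_dvd
    intro hd
    have h1 : (l : ℤ_[l]) ∣ m * A * α := by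
      have : (m : ℤ_[l]) * A * α = (A * u + B * v) ^ 2 - (4 * l) * (-q * v ^ 2) := by
        linear_combination -key
      rw [this]
      exact dvd_sub (dvd_pow hd two_ne_zero) (Dvd.dvd.mul_right (Dvd.intro_left 4 rfl) _)
    exact hlp.not_isUnit (isUnit_of_dvd_unit h1 hunit)
  obtain ⟨t, ht⟩ := padicInt_exists_sq_eq_of_dvd hs (Dvd.intro _ key.symm)
  have ht' : (t : ℚ_[l]) ^ 2 = m * A * ((α : ℤ_[l]) : ℚ_[l]) := by
    exact_mod_cast congrArg (fun z : ℤ_[l] => (z : ℚ_[l])) ht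
  have hm0 : (m : ℚ_[l]) ≠ 0 := by
    have : m ≠ 0 := by rintro rfl; simp at hm
    exact_mod_cast this
  have hA0 : (A : ℚ_[l]) ≠ 0 := by
    have : A ≠ 0 := by rintro rfl; simp at h
    exact_mod_cast this
  have hα0 : ((α : ℤ_[l]) : ℚ_[l]) ≠ 0 := by simp
  have ht0 : (t : ℚ_[l]) ≠ 0 := by
    intro h0
    rw [h0] at ht'
    exact mul_ne_zero (mul_ne_zero hm0 hA0) hα0 (by rw [← ht']; simp)
  have : -((α : ℤ_[l]) : ℚ_[l]) = ((m * (-A) : ℤ) : ℚ_[l]) * ((t : ℚ_[l]) / (m * A)) ^ 2 := by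
    rw [div_pow, ht']
    push_cast
    field_simp
  rw [this, hilbertSymbol_mul_sq (div_ne_zero ht0 (mul_ne_zero hm0 hA0))]

end Diag

/-! ### Integral entries and existence of T_m(μn) -/

section Entries

variable {F : Type*} [Field F] [CharZero F] {D Dt : ℕ} {s Δ : F} {x y : ℤ}

lemma eq_zero_of_eq_mul_sqrt (hD : D.Prime) (hs : s ^ 2 = D) {a b : ℚ} (hab : (a : F) = b * s) :
    a = 0 ∧ b = 0 := by
  by_cases hb : b = 0
  · subst hb
    simpa using hab
  · exfalso
    have h1 : a ^ 2 = b ^ 2 * (D : ℚ) := by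
      have : ((a ^ 2 : ℚ) : F) = ((b ^ 2 * (D : ℚ) : ℚ) : F) := by
        push_cast
        rw [hab, mul_pow, hs]
      exact_mod_cast this
    have h2 : IsSquare ((D : ℕ) : ℚ) := ⟨a / b, by field_simp; linarith⟩
    rw [Rat.isSquare_natCast_iff] at h2
    exact hD.prime.not_isSquare h2

/-- Comparing the coefficients of 1 and √D in Δ = (x + y√D)/2 determines C and then B; the remaining
linear condition gives A. -/
lemma IsTm.exists_entries {m n : ℕ} {μ : ℤˣ} {T : Matrix (Fin 2) (Fin 2) ℚ}
    (hT : IsTm D Dt s Δ m n μ T) (hD : D.Prime) (hs : s ^ 2 = D) (hΔ : 2 * Δ = x + y * s)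
    (hm : m ≠ 0) {d : ℤ} (hd : (D : ℤ) = 1 + 4 * d) :
    ∃ A B C : ℤ, (m : ℚ) * T 0 0 = A ∧ (m : ℚ) * T 0 1 = B ∧ (m : ℚ) * T 1 0 = B ∧
      (m : ℚ) * T 1 1 = C ∧ D * C = 2 * (μ * n) - m * x ∧ 2 * B = -(m * y + D * C) ∧
      A = -(μ * n) - D * B - D * d * C := by
  obtain ⟨A, hA⟩ := hT.integral 0 0
  obtain ⟨B, hB⟩ := hT.integral 0 1
  obtain ⟨C, hC⟩ := hT.integral 1 1
  have hm0 : (m : ℚ) ≠ 0 := by exact_mod_cast hm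
  have h1 := hT.delta_eq
  obtain ⟨h2, h3⟩ := eq_zero_of_eq_mul_sqrt hD hs
    (a := x - (2 * ((μ : ℤ) : ℚ) * (n / m) - D * T 1 1)) (b := -(2 * T 0 1 + D * T 1 1) - y) (by
      push_cast at h1 ⊢
      linear_combination -hΔ + 2 * h1)
  have h4 := hT.trace_eq
  have hdQ : (D : ℚ) = 1 + 4 * d := by exact_mod_cast congrArg (Int.cast : ℤ → ℚ) hd
  have hn : (m : ℚ) * (n / m) = n := by field_simp
  have e1 : (D : ℚ) * C = 2 * ((μ : ℤ) * n) - m * x := by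
    linear_combination (-(D : ℚ)) * hC + (m : ℚ) * h2 + 2 * ((μ : ℤ) : ℚ) * hn
  refine ⟨A, B, C, hA, hB, ?_, hC, ?_, ?_, ?_⟩
  · rw [← hB, ← hT.symm.apply 0 1]
  · exact_mod_cast e1
  · have : (2 : ℚ) * B = -(m * y + D * C) := by
      linear_combination (-2 : ℚ) * hB - D * hC - m * h3
    exact_mod_cast this
  · have : (A : ℚ) = -((μ : ℤ) * n) - D * B - D * d * C := by
      linear_combination (-1 : ℚ) * hA - D * hB - D * d * hC - m * h4 - ((μ : ℤ) : ℚ) * hn -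
        m * T 1 1 * D / 4 * hdQ
    exact_mod_cast this

lemma posDef_of_pos {a b c : ℝ} (hc : 0 < c) (hdet : 0 < a * c - b ^ 2) :
    (!![a, b; b, c] : Matrix (Fin 2) (Fin 2) ℝ).PosDef := by
  refine Matrix.PosDef.of_dotProduct_mulVec_pos ?_ ?_
  · ext i j
    fin_cases i <;> fin_cases j <;> simp
  · intro v hv
    simp [Matrix.mulVec, dotProduct, Fin.sum_univ_two]
    have h1 : c * (v 0 * (a * v 0 + b * v 1) + v 1 * (b * v 0 + c * v 1)) =
        (b * v 0 + c * v 1) ^ 2 + (a * c - b ^ 2) * v 0 ^ 2 := by ring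
    refine (mul_pos_iff_of_pos_left hc).1 ?_
    rw [h1]
    by_cases h0 : v 0 = 0
    · have hv1 : v 1 ≠ 0 := by
        intro h1
        apply hv
        ext i
        fin_cases i <;> simp [h0, h1]
      rw [h0]
      have h2 : 0 < (c * v 1) ^ 2 := by positivity
      simpa using h2
    · positivity

lemma exists_isTm (hD : D.Prime) (hΔ : 2 * Δ = x + y * s) (hx : x < 0)
    (hnorm : x ^ 2 - D * y ^ 2 = 4 * Dt)
    {m n : ℕ} (hm : m ≠ 0) (hn : n ^ 2 < m ^ 2 * Dt) {μ : ℤˣ} {A B C d Q : ℤ}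
    (hC : D * C = 2 * (μ * n) - m * x) (hB : 2 * B = -(m * y + D * C))
    (hd : (D : ℤ) = 1 + 4 * d) (hA : A = -(μ * n) - D * B - D * d * C)
    (hQ : 4 * (D : ℤ) * Q = m ^ 2 * Dt - (μ * n) ^ 2) (hdet : A * C - B ^ 2 = 4 * Q) :
    ∃ T, IsTm D Dt s Δ m n μ T := by
  have hm0 : (m : ℚ) ≠ 0 := by exact_mod_cast hm
  have hD0 : (D : ℚ) ≠ 0 := by exact_mod_cast hD.ne_zero
  have hDpos : (0 : ℤ) < D := by exact_mod_cast hD.pos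
  have hmpos : (0 : ℤ) < m := by exact_mod_cast Nat.pos_of_ne_zero hm
  have hμ : ((μ : ℤ) * n) ^ 2 = (n : ℤ) ^ 2 := by
    rw [mul_pow, ← Units.val_pow_eq_pow_val, Int.units_sq]
    simp
  have hn' : (n : ℤ) ^ 2 < m ^ 2 * Dt := by exact_mod_cast hn
  have hQpos : 0 < Q := by
    have : 0 < 4 * (D : ℤ) * Q := by rw [hQ, hμ]; linarith
    exact (mul_pos_iff_of_pos_left (by positivity)).1 this
  -- Since x² = 4 D̃ + D y² ≥ 4 D̃, the bound on n gives (2n)² < (m x)²; with x < 0 this makes D C =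
  -- 2μn − m x positive. Positivity of C and of the determinant yields definiteness.
  have hCpos : 0 < C := by
    have h1 : (2 * ((μ : ℤ) * n)) ^ 2 < (m * (-x)) ^ 2 := by
      rw [mul_pow, hμ, mul_pow, neg_sq]
      nlinarith [mul_nonneg (sq_nonneg (m : ℤ)) (mul_nonneg hDpos.le (sq_nonneg y))]
    have h2 := (abs_lt.1 (abs_lt_of_sq_lt_sq h1 (mul_nonneg hmpos.le (by linarith)))).1
    have : 0 < (D : ℤ) * C := by rw [hC]; linarith
    exact (mul_pos_iff_of_pos_left hDpos).1 this
  have hCQ : (D : ℚ) * C = 2 * ((μ : ℤ) * n) - m * x := by exact_mod_cast hC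
  have hBQ : (2 : ℚ) * B = -(m * y + D * C) := by exact_mod_cast hB
  have hAQ : (A : ℚ) = -((μ : ℤ) * n) - D * B - D * d * C := by exact_mod_cast hA
  have hdQ : (D : ℚ) = 1 + 4 * d := by exact_mod_cast hd
  have hdetQ : (A : ℚ) * C - B ^ 2 = 4 * Q := by exact_mod_cast hdet
  have hQQ : 4 * (D : ℚ) * Q = m ^ 2 * Dt - n ^ 2 := by
    rw [hμ] at hQ
    exact_mod_cast hQ
  refine ⟨!![(A : ℚ) / m, (B : ℚ) / m; (B : ℚ) / m, (C : ℚ) / m], ?_, ?_, ?_, ?_, ?_, ?_⟩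
  · ext i j
    fin_cases i <;> fin_cases j <;> simp
  · have : (!![(A : ℚ) / m, (B : ℚ) / m; (B : ℚ) / m, (C : ℚ) / m]).map (fun x : ℚ => (x : ℝ)) =
        !![(A : ℝ) / m, (B : ℝ) / m; (B : ℝ) / m, (C : ℝ) / m] := by
      ext i j
      fin_cases i <;> fin_cases j <;> simp
    rw [this]
    have hmR : (0 : ℝ) < m := by exact_mod_cast hmpos
    have hdetR : (A : ℝ) * C - B ^ 2 = 4 * Q := by exact_mod_cast hdet
    apply posDef_of_pos
    · have : (0 : ℝ) < C := by exact_mod_cast hCpos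
      positivity
    · have h2 : (A : ℝ) / m * (C / m) - (B / m) ^ 2 = 4 * Q / m ^ 2 := by
        rw [← hdetR]
        field_simp
      rw [h2]
      have : (0 : ℝ) < Q := by exact_mod_cast hQpos
      positivity
  · intro i j
    fin_cases i <;> fin_cases j
    · exact ⟨A, by simp; field_simp⟩
    · exact ⟨B, by simp; field_simp⟩
    · exact ⟨B, by simp; field_simp⟩
    · exact ⟨C, by simp; field_simp⟩
  · rw [Matrix.det_fin_two_of, ← hQQ]
    field_simp
    linear_combination hdetQ
  · have e1 : (2 * ((μ : ℤ) : ℚ) * (n / m) - D * (C / m) : ℚ) = x := by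
      field_simp
      linear_combination -hCQ
    have e2 : (2 * (B / m) + D * (C / m) : ℚ) = -y := by
      field_simp
      linear_combination hBQ
    simp only [Matrix.of_apply, Matrix.cons_val', Matrix.cons_val_zero, Matrix.cons_val_one,
      Matrix.cons_val_fin_one]
    rw [e1, e2]
    push_cast
    linear_combination hΔ / 2
  · simp only [Matrix.of_apply, Matrix.cons_val', Matrix.cons_val_zero, Matrix.cons_val_one,
      Matrix.cons_val_fin_one]
    have e3 : ((D : ℚ) ^ 2 - D) / 4 = D * d := by rw [hdQ]; ring
    rw [e3]
    field_simp
    linear_combination -hAQ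

lemma isTm_Tm {m n : ℕ} {μ : ℤˣ} (h : ∃ T, IsTm D Dt s Δ m n μ T) :
    IsTm D Dt s Δ m n μ (Tm D Dt s Δ m n μ) := by
  rw [Tm, dif_pos h]
  exact h.choose_spec

end Entries

/-! ### Comparison of the symbol (−α_l, l)_l with the splitting above l -/

section Local

open IsDedekindDomain

set_option linter.unusedSectionVars false

variable {E L : Type*} [Field E] [NumberField E] [Field L] [NumberField L] [Algebra E L]
  {F : Type*} [Field F] [CharZero F] {s Δ : F}
  {D Dt : ℕ} {x y c : ℤ} {ω : 𝓞 E} {ξ ζ η : 𝓞 L}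

/-- The local form of `T_m(μ n)` at `l` and the splitting of the prime above `l`. Here
`m₁ / k₁ = m / (μ n)` and `l ∤ m₁`. -/
lemma ReflexDatum.isEquivDiag_and_split_iff (h : ReflexDatum D Dt x y c ω ξ ζ η)
    (hs : s ^ 2 = D) (hΔ : 2 * Δ = x + y * s) {l : ℕ} [Fact l.Prime]
    {m n : ℕ} {μ : ℤˣ} {T : Matrix (Fin 2) (Fin 2) ℚ} (hT : IsTm D Dt s Δ m n μ T) (hm : m ≠ 0)
    {f m₁ k₁ Q₁ : ℤ} (hf : (m : ℤ) = f * m₁) (hfk : (μ : ℤ) * n = f * k₁) (hlm : ¬ (l : ℤ) ∣ m₁)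
    (hk₁ : (D : ℤ) ∣ 2 * k₁ - m₁ * x) (hQ : 4 * (D : ℤ) * Q₁ = m₁ ^ 2 * Dt - k₁ ^ 2)
    (hlQ : (l : ℤ) ∣ Q₁) :
    (∃ α : ℤ_[l]ˣ, IsEquivDiag l T α) ∧ ∀ α : ℤ_[l]ˣ, IsEquivDiag l T α →
      ∀ (e : ℤ) (v : HeightOneSpectrum (𝓞 E)), 2 * e = m₁ + k₁ → (l : 𝓞 E) ∈ v.asIdeal →
        (m₁ : 𝓞 E) * ω - e ∈ v.asIdeal →
        ((v.asIdeal.primesOver (𝓞 L)).ncard = 2 ↔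
          hilbertSymbol l (-((α : ℤ_[l]) : ℚ_[l])) l = 1) := by
  have hl := (Fact.out : l.Prime)
  have hlI := Nat.prime_iff_prime_int.1 hl
  obtain ⟨A₁, B₁, C₁, d, hC₁, hB₁, hd, hA₁⟩ := h.exists_entries hk₁
  obtain ⟨A, B, C, hA, hB, hB', hC, eC, eB, eA⟩ := hT.exists_entries h.prime hs hΔ hm hd
  have hf0 : f ≠ 0 := by
    rintro rfl
    exact hm (by simpa using hf)
  have hD0 : (D : ℤ) ≠ 0 := by exact_mod_cast h.prime.ne_zero
  -- The entries of mT are f times those belonging to m₁ and k₁, so T = m₁⁻¹(A₁, B₁; B₁, C₁) with m₁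
  -- prime to l.
  have fC : C = f * C₁ := by
    apply mul_left_cancel₀ hD0
    rw [eC, hf, hfk]
    linear_combination (-f) * hC₁
  have fB : B = f * B₁ := by
    apply mul_left_cancel₀ (two_ne_zero )
    rw [eB, hf, fC]
    linear_combination (-f) * hB₁
  have fA : A = f * A₁ := by
    rw [eA, hfk, fC, fB]
    linear_combination (-f) * hA₁
  have hfQ : (f : ℚ) ≠ 0 := by exact_mod_cast hf0
  have hmQ : (m : ℚ) = f * m₁ := by exact_mod_cast congrArg (Int.cast : ℤ → ℚ) hf
  have red : ∀ {t : ℚ} {z z₁ : ℤ}, (m : ℚ) * t = z → z = f * z₁ → (m₁ : ℚ) * t = z₁ := by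
    intro t z z₁ h1 h2
    apply mul_left_cancel₀ hfQ
    rw [← mul_assoc, ← hmQ, h1, h2]
    push_cast
    rfl
  have gA := red hA fA
  have gB := red hB fB
  have gB' := red hB' fB
  have gC := red hC fC
  have hdet := h.det_entries hC₁ hB₁ hd hA₁ hQ
  have hnd := h.not_dvd_entries hl hC₁ hB₁ hd hA₁ hQ hlm hlQ
  refine ⟨?_, fun α hα e v he hv hτ => ?_⟩
  · rcases hnd with h1 | ⟨-, h1⟩
    · exact exists_isEquivDiag_of_not_dvd_left hlm gA gB gB' gC h1
    · exact exists_isEquivDiag_of_not_dvd_right hlm gA gB gB' gC h1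
  · obtain ⟨u, t, hut⟩ := hα.exists_row hlm gA gB gB' gC
    rcases hnd with h1 | ⟨h2, h1⟩
    · obtain ⟨h3, h4⟩ := h.split_iff_of_not_dvd_A hl hv he hlm hτ hC₁ hB₁ hd hA₁ h1
      rw [h4, hilbertSymbol_neg_eq hlm hdet hlQ h1 hut, hilbertSymbol_eq_one_iff ?_ h3]
      intro h5
      rcases hlI.dvd_or_dvd h5 with h5 | h5
      · exact hlm h5
      · exact h1 ((Int.dvd_neg).1 h5)
    · obtain ⟨h3, h4⟩ := h.split_iff_of_not_dvd_C hl hv he hlm hτ hC₁ hB₁ hd hA₁ h2 h1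
      -- The symbol is computed with the roles of A₁ and C₁, and of the two coordinates, exchanged;
      -- the extra factor D² is a square.
      have hdet' : C₁ * A₁ - B₁ ^ 2 = 4 * Q₁ := by rw [← hdet]; ring
      have hDl : (D : ℚ_[l]) ≠ 0 := by exact_mod_cast h.prime.ne_zero
      have hsq : ((m₁ * (-(D ^ 2 * C₁)) : ℤ) : ℚ_[l]) = ((m₁ * (-C₁) : ℤ) : ℚ_[l]) * D ^ 2 := by
        push_cast
        ring
      rw [h4, hilbertSymbol_neg_eq hlm hdet' hlQ h1 (u := t) (v := u) (by rw [hut]; ring),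
        ← hilbertSymbol_mul_sq hDl, ← hsq, hilbertSymbol_eq_one_iff ?_ h3]
      intro h5
      rcases hlI.dvd_or_dvd h5 with h5 | h5
      · exact hlm h5
      · rcases hlI.dvd_or_dvd ((Int.dvd_neg).1 h5) with h5 | h5
        · have := hlI.dvd_of_dvd_pow h5
          exact h2 ((Nat.prime_dvd_prime_iff_eq hl h.prime).1 (by exact_mod_cast this))
        · exact h1 h5

end Local

open IsDedekindDomain

/-! ### Complete splitting in the Galois closure -/

section Closure

open scoped Pointwise

set_option linter.unusedSectionVars false

variable {E L M : Type*} [Field E] [NumberField E] [Field L] [NumberField L] [Algebra E L]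
  [Field M] [NumberField M] [Algebra E M] [Algebra L M] [IsScalarTower E L M]

lemma ncard_primesOver_eq_finrank_iff [IsGalois ℚ M] {l : ℕ} (hl : l.Prime)
    (P : Ideal (𝓞 M)) [P.IsPrime] [P.LiesOver (Ideal.span {(l : ℤ)})] :
    SplitsCompletely M l ↔ P.ramificationIdx ℤ = 1 ∧ P.inertiaDeg ℤ = 1 := by
  have := isMaximal_span_natCast hl
  have h1 := Ideal.ncard_primesOver_mul_ramificationIdxIn_mul_inertiaDegIn
    (Ideal.span {(l : ℤ)}) (𝓞 M) Gal(M/ℚ)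
  rw [Ideal.ramificationIdxIn_eq_ramificationIdx _ P Gal(M/ℚ),
    Ideal.inertiaDegIn_eq_inertiaDeg _ P Gal(M/ℚ), IsGalois.card_aut_eq_finrank] at h1
  have h0 : 0 < Module.finrank ℚ M := Module.finrank_pos
  rw [SplitsCompletely]
  constructor
  · intro h
    rw [h] at h1
    have := Nat.eq_one_of_mul_eq_one_right (Nat.eq_of_mul_eq_mul_left h0 (h1.trans (mul_one _).symm))
    have := Nat.eq_one_of_mul_eq_one_left (Nat.eq_of_mul_eq_mul_left h0 (h1.trans (mul_one _).symm))
    exact ⟨‹_›, ‹_›⟩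
  · rintro ⟨h2, h3⟩
    simpa [h2, h3] using h1

/-- An element of the decomposition group that negates a residually rational unit. -/
lemma smul_ne_neg {P : Ideal (𝓞 M)} {g : Gal(M/ℚ)} (hg : g • P = P) {θ : 𝓞 M} {n : ℤ}
    (hn : θ - n ∈ P) (hθ : 2 * θ ∉ P) : g • θ ≠ -θ := by
  intro h
  apply hθ
  have h1 : g • (θ - (n : 𝓞 M)) ∈ P := by
    rw [← hg]
    exact Ideal.smul_mem_pointwise_smul g _ P hn
  have h2 : g • (n : 𝓞 M) = n := map_intCast (MulSemiringAction.toRingHom Gal(M/ℚ) (𝓞 M) g) n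
  rw [smul_sub, h, h2] at h1
  have : 2 * θ = (θ - n) - (-θ - n) := by ring
  rw [this]
  exact sub_mem hn h1

lemma exists_int_sub_mem_of_inertiaDeg_eq_one {l : ℕ} (hl : l.Prime) (Q : Ideal (𝓞 L)) [Q.IsPrime]
    [Q.LiesOver (Ideal.span {(l : ℤ)})] (h : Q.inertiaDeg ℤ = 1) (θ : 𝓞 L) :
    ∃ n : ℤ, θ - n ∈ Q := by
  have := isMaximal_span_natCast hl
  have hQ0 : Q ≠ ⊥ := Ideal.ne_bot_of_liesOver_of_ne_bot (span_natCast_ne_bot hl) Q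
  have : Q.IsMaximal := Ring.DimensionLEOne.maximalOfPrime hQ0 ‹_›
  obtain ⟨n, hn⟩ := exists_sub_mem_of_inertiaDeg_eq_one (Ideal.span {(l : ℤ)}) Q h θ
  exact ⟨n, by simpa using hn⟩

namespace ReflexDatum

variable {D Dt : ℕ} {x y c : ℤ} {ω : 𝓞 E} {ξ ζ η : 𝓞 L} (h : ReflexDatum D Dt x y c ω ξ ζ η)
include h

/-- The decomposition groups above `l` fix `ξ`, if `l` splits in `E` and then in `L`. -/
lemma smul_ξ_eq {l : ℕ} (hl : l.Prime) (hl2 : l ≠ 2) (hlD : l ≠ D) (hlDt : ¬ (l : ℤ) ∣ Dt)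
    (hE : ((Ideal.span {(l : ℤ)}).primesOver (𝓞 E)).ncard = 2)
    (hL : ∀ v : HeightOneSpectrum (𝓞 E), (l : 𝓞 E) ∈ v.asIdeal →
      (v.asIdeal.primesOver (𝓞 L)).ncard = 2)
    (P : Ideal (𝓞 M)) [P.IsPrime] [P.LiesOver (Ideal.span {(l : ℤ)})]
    {g : Gal(M/ℚ)} (hg : g • P = P) :
    g • algebraMap (𝓞 L) (𝓞 M) ξ = algebraMap (𝓞 L) (𝓞 M) ξ := by
  have := isMaximal_span_natCast hl
  have hGE := h.basis.isGalois
  have hGL := h.isGalois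
  have hlI := Nat.prime_iff_prime_int.1 hl
  have hQP : P.LiesOver (P.under (𝓞 L)) := inferInstance
  set Q := P.under (𝓞 L) with hQ
  have hQl : Q.LiesOver (Ideal.span {(l : ℤ)}) := by rw [hQ]; infer_instance
  set v := Q.under (𝓞 E) with hv
  have hvQ : Q.LiesOver v := by rw [hv]; infer_instance
  have hvl : v.LiesOver (Ideal.span {(l : ℤ)}) := by rw [hv]; infer_instance
  have hv0 : v ≠ ⊥ := Ideal.ne_bot_of_liesOver_of_ne_bot (span_natCast_ne_bot hl) v
  have hvs := hL ⟨v, inferInstance, hv0⟩ (natCast_mem_of_liesOver l v)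
  have hfQ : Q.inertiaDeg ℤ = 1 := by
    rw [Ideal.inertiaDeg_tower v Q, inertiaDeg_eq_one_of_split Gal(E/ℚ) h.basis.card_gal _ hE v,
      inertiaDeg_eq_one_of_split Gal(L/E) h.card_gal v hvs Q]
  have hmemP : ∀ {z : 𝓞 L}, algebraMap (𝓞 L) (𝓞 M) z ∈ P ↔ z ∈ Q := fun {z} => Iff.rfl
  have hint : ∀ n : ℤ, (n : 𝓞 M) ∈ P ↔ (l : ℤ) ∣ n := fun n => by
    have h1 := Ideal.mem_of_liesOver P (Ideal.span {(l : ℤ)}) n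
    rw [Ideal.mem_span_singleton] at h1
    simpa using h1.symm
  have h2P : (2 : 𝓞 M) ∉ P := fun h2 => hl2 <| (Nat.prime_dvd_prime_iff_eq hl Nat.prime_two).1 <| by
    exact_mod_cast (hint 2).1 (by exact_mod_cast h2)
  have hDP : (D : 𝓞 M) ∉ P := fun h2 => hlD <| (Nat.prime_dvd_prime_iff_eq hl h.prime).1 <| by
    exact_mod_cast (hint D).1 (by exact_mod_cast h2)
  have hDtP : (Dt : 𝓞 M) ∉ P := fun h2 => hlDt <| (hint Dt).1 (by exact_mod_cast h2)
  -- The residue field of Q is prime, so the decomposition group acts trivially on residues from L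
  -- and cannot negate an element outside P.
  have hne : ∀ θ : 𝓞 L, algebraMap (𝓞 L) (𝓞 M) θ ∉ P →
      g • algebraMap (𝓞 L) (𝓞 M) θ ≠ -algebraMap (𝓞 L) (𝓞 M) θ := by
    intro θ hθ
    obtain ⟨n, hn⟩ := exists_int_sub_mem_of_inertiaDeg_eq_one hl Q hfQ θ
    refine smul_ne_neg hg (n := n) ?_ fun hc => ?_
    · have := hmemP.2 hn
      simpa using this
    · exact (‹P.IsPrime›.mem_or_mem hc).elim h2P hθ
  have hsq : ∀ {θ : 𝓞 L} {β : 𝓞 M}, algebraMap (𝓞 L) (𝓞 M) θ ^ 2 = β → g • β = β →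
      algebraMap (𝓞 L) (𝓞 M) θ ∉ P →
      g • algebraMap (𝓞 L) (𝓞 M) θ = algebraMap (𝓞 L) (𝓞 M) θ := by
    intro θ β hθ hβ hP
    have h1 : (g • algebraMap (𝓞 L) (𝓞 M) θ) ^ 2 = algebraMap (𝓞 L) (𝓞 M) θ ^ 2 := by
      rw [← smul_pow', hθ, hβ]
    exact (sq_eq_sq_iff_eq_or_eq_neg.1 h1).resolve_right (hne θ hP)
  have hnat : ∀ n : ℕ, g • (n : 𝓞 M) = n := fun n =>
    map_natCast (MulSemiringAction.toRingHom Gal(M/ℚ) (𝓞 M) g) n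
  have hintg : ∀ n : ℤ, g • (n : 𝓞 M) = n := fun n =>
    map_intCast (MulSemiringAction.toRingHom Gal(M/ℚ) (𝓞 M) g) n
  set r : 𝓞 M := algebraMap (𝓞 L) (𝓞 M) (algebraMap (𝓞 E) (𝓞 L) (2 * ω - 1)) with hr
  have hr2 : r ^ 2 = Dt := by
    rw [hr, ← map_pow, ← map_pow, h.r_sq]
    simp
  have hrP : r ∉ P := fun hc => hDtP (by rw [← hr2, sq]; exact P.mul_mem_left _ hc)
  have hgr : g • r = r := hsq hr2 (hnat Dt) hrP
  have hgx : ∀ a b : ℤ, g • ((a : 𝓞 M) + b * r) = a + b * r := fun a b => by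
    rw [smul_add, smul_mul', hintg, hintg, hgr]
  have hξ2 : algebraMap (𝓞 L) (𝓞 M) ξ ^ 2 = x + (2 : ℤ) * r := by
    rw [← map_pow, h.sq_ξ, hr]
    simp only [map_add, map_mul, map_intCast, map_ofNat]
    push_cast
    rfl
  have hζ2 : algebraMap (𝓞 L) (𝓞 M) ζ ^ 2 = D * (x + (-2 : ℤ) * r) := by
    rw [← map_pow, h.sq_ζ, hr]
    simp only [map_mul, map_intCast, map_ofNat, map_sub, map_natCast]
    push_cast
    ring
  -- If ξ ∈ P then ζ ∉ P, since otherwise (x + 2r) − (x − 2r) = 4r would lie in P. Then ζ is fixed,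
  -- and so is ξ because ξζ = D y.
  by_cases hξP : algebraMap (𝓞 L) (𝓞 M) ξ ∈ P
  · have hζP : algebraMap (𝓞 L) (𝓞 M) ζ ∉ P := by
      intro hζP
      have e1 : (x : 𝓞 M) + (2 : ℤ) * r ∈ P := by rw [← hξ2, sq]; exact P.mul_mem_left _ hξP
      have e2 : (D : 𝓞 M) * (x + (-2 : ℤ) * r) ∈ P := by
        rw [← hζ2, sq]; exact P.mul_mem_left _ hζP
      have e3 := (‹P.IsPrime›.mem_or_mem e2).resolve_left hDP
      have e4 : 2 * (2 * r) ∈ P := by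
        have : 2 * (2 * r) = ((x : 𝓞 M) + (2 : ℤ) * r) - (x + (-2 : ℤ) * r) := by
          push_cast; ring
        rw [this]
        exact sub_mem e1 e3
      exact hrP ((‹P.IsPrime›.mem_or_mem
        ((‹P.IsPrime›.mem_or_mem e4).resolve_left h2P)).resolve_left h2P)
    have hζg := hsq hζ2 (by rw [smul_mul', hnat, hgx]) hζP
    have hprod : algebraMap (𝓞 L) (𝓞 M) ξ * algebraMap (𝓞 L) (𝓞 M) ζ = (D * y : ℤ) := by
      rw [← map_mul, h.ξ_mul_ζ]
      simp
    have h3 := congrArg (g • ·) hprod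
    simp only [smul_mul', hζg, hintg] at h3
    rw [← hprod] at h3
    exact mul_right_cancel₀ (fun h0 => hζP (by rw [h0]; exact zero_mem _)) h3
  · exact hsq hξ2 (hgx x 2) hξP

/-- One direction is multiplicativity of e and f in the tower. Conversely the decomposition groups
of all conjugates of P fix ξ, so that of P fixes all conjugates of ξ; by `hgen` it is trivial, and l
has [M : ℚ] primes above it. -/
lemma splitsCompletely_iff [IsGalois ℚ M] {l : ℕ} (hl : l.Prime) (hl2 : l ≠ 2) (hlD : l ≠ D)
    (hlDt : ¬ (l : ℤ) ∣ Dt)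
    (hgen : ∀ g : Gal(M/ℚ), (∀ σ : Gal(M/ℚ), g (σ (algebraMap L M (algebraMap (𝓞 L) L ξ))) =
      σ (algebraMap L M (algebraMap (𝓞 L) L ξ))) → g = 1) :
    SplitsCompletely M l ↔ ((Ideal.span {(l : ℤ)}).primesOver (𝓞 E)).ncard = 2 ∧
      ∀ v : HeightOneSpectrum (𝓞 E), (l : 𝓞 E) ∈ v.asIdeal →
        (v.asIdeal.primesOver (𝓞 L)).ncard = 2 := by
  have := isMaximal_span_natCast hl
  have hGE := h.basis.isGalois
  have hGL := h.isGalois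
  constructor
  · intro hM
    have key : ∀ v : Ideal (𝓞 E), v.IsPrime → v.LiesOver (Ideal.span {(l : ℤ)}) →
        (v.ramificationIdx ℤ = 1 ∧ v.inertiaDeg ℤ = 1) ∧ (v.primesOver (𝓞 L)).ncard = 2 := by
      intro v _ _
      obtain ⟨Q⟩ := (inferInstance : Nonempty (Ideal.primesOver v (𝓞 L)))
      have := Q.2.1
      have := Q.2.2
      obtain ⟨P⟩ := (inferInstance : Nonempty (Ideal.primesOver Q.1 (𝓞 M)))
      have := P.2.1
      have := P.2.2
      have hQl : Q.1.LiesOver (Ideal.span {(l : ℤ)}) := Ideal.LiesOver.trans Q.1 v _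
      have hPl : P.1.LiesOver (Ideal.span {(l : ℤ)}) := Ideal.LiesOver.trans P.1 Q.1 _
      obtain ⟨h1, h2⟩ := (ncard_primesOver_eq_finrank_iff hl P.1).1 hM
      rw [Ideal.ramificationIdx_tower Q.1 P.1, Ideal.ramificationIdx_tower v Q.1] at h1
      rw [Ideal.inertiaDeg_tower Q.1 P.1, Ideal.inertiaDeg_tower v Q.1] at h2
      have a1 := Nat.eq_one_of_mul_eq_one_right h1
      have a2 := Nat.eq_one_of_mul_eq_one_right h2
      have h3 := ncard_mul_ramification_mul_inertia Gal(L/E) h.card_gal v Q.1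
      rw [Nat.eq_one_of_mul_eq_one_left a1, Nat.eq_one_of_mul_eq_one_left a2] at h3
      exact ⟨⟨Nat.eq_one_of_mul_eq_one_right a1, Nat.eq_one_of_mul_eq_one_right a2⟩,
        by simpa using h3⟩
    refine ⟨?_, fun v hv => (key v.asIdeal v.isPrime
      (liesOver_of_natCast_mem hl v.isPrime.ne_top hv)).2⟩
    obtain ⟨v⟩ := (inferInstance : Nonempty (Ideal.primesOver (Ideal.span {(l : ℤ)}) (𝓞 E)))
    have := v.2.1
    have := v.2.2
    have h3 := ncard_mul_ramification_mul_inertia Gal(E/ℚ) h.basis.card_gal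
      (Ideal.span {(l : ℤ)}) v.1
    rw [(key v.1 v.2.1 v.2.2).1.1, (key v.1 v.2.1 v.2.2).1.2] at h3
    simpa using h3
  · rintro ⟨hE, hL⟩
    obtain ⟨P⟩ := (inferInstance : Nonempty (Ideal.primesOver (Ideal.span {(l : ℤ)}) (𝓞 M)))
    have := P.2.1
    have := P.2.2
    have htriv : ∀ g : Gal(M/ℚ), g • P.1 = P.1 → g = 1 := by
      intro g hg
      refine hgen g fun σ => ?_
      have hP' : (σ⁻¹ • P.1).IsPrime := inferInstance
      have hPl' : (σ⁻¹ • P.1).LiesOver (Ideal.span {(l : ℤ)}) := inferInstance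
      have hst : (σ⁻¹ * g * σ) • (σ⁻¹ • P.1) = σ⁻¹ • P.1 := by
        rw [smul_smul, mul_assoc, mul_inv_cancel, mul_one, ← smul_smul, hg]
      have h1 := h.smul_ξ_eq hl hl2 hlD hlDt hE hL (σ⁻¹ • P.1) hst
      have h2 := congrArg (fun z => σ (algebraMap (𝓞 M) M z)) h1
      have h3 : ∀ z : 𝓞 M, algebraMap (𝓞 M) M ((σ⁻¹ * g * σ) • z) =
          σ⁻¹ (g (σ (algebraMap (𝓞 M) M z))) := fun z => rfl
      simp only [h3] at h2
      have h4 : ∀ z : M, σ (σ⁻¹ z) = z := fun z => AlgEquiv.apply_symm_apply σ z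
      rw [h4] at h2
      exact h2
    have hle : Nat.card Gal(M/ℚ) ≤ ((Ideal.span {(l : ℤ)}).primesOver (𝓞 M)).ncard := by
      rw [← Nat.card_coe_set_eq]
      have : Finite ((Ideal.span {(l : ℤ)}).primesOver (𝓞 M)) :=
        (IsDedekindDomain.primesOver_finite _ _)
      refine Nat.card_le_card_of_injective (fun g => ⟨g • P.1, inferInstance, inferInstance⟩) ?_
      intro g g' hgg
      have h1 : g • P.1 = g' • P.1 := congrArg Subtype.val hgg
      have h2 := htriv (g⁻¹ * g') (by rw [mul_smul, ← h1, inv_smul_smul])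
      exact (inv_mul_eq_one.1 h2)
    have h1 := Ideal.ncard_primesOver_mul_ramificationIdxIn_mul_inertiaDegIn
      (Ideal.span {(l : ℤ)}) (𝓞 M) Gal(M/ℚ)
    rw [SplitsCompletely, ← IsGalois.card_aut_eq_finrank]
    refine le_antisymm (Nat.le_of_dvd Nat.card_pos (Dvd.intro _ h1)) hle

end ReflexDatum

end Closure

open NumberField

/-! ### Rational coordinates of the CM field K -/

section CMField

set_option linter.unusedSectionVars false

variable {K : Type*} [Field K] [NumberField K] [NumberField.IsCMField K]

lemma finrank_maximalRealSubfield (hdeg : Module.finrank ℚ K = 4) :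
    Module.finrank ℚ (maximalRealSubfield K) = 2 := by
  have h1 := Module.finrank_mul_finrank ℚ (maximalRealSubfield K) K
  rw [Algebra.IsQuadraticExtension.finrank_eq_two (maximalRealSubfield K) K, hdeg] at h1
  omega

section

variable {Δ : maximalRealSubfield K} {sqrtΔ : K} {w : 𝓞 (maximalRealSubfield K)}
  (hOK : ∀ z : K, IsIntegral ℤ z ↔
      ∃ u v : 𝓞 (NumberField.maximalRealSubfield K),
        z = ((u : NumberField.maximalRealSubfield K) : K) +
          ((v : NumberField.maximalRealSubfield K) : K) *
            ((((w : NumberField.maximalRealSubfield K) : K) + sqrtΔ) / 2))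
include hOK

lemma exists_eq_add_mul_sqrt (z : K) : ∃ u v : maximalRealSubfield K, z = u + v * sqrtΔ := by
  have halg : IsAlgebraic ℤ z :=
    (IsFractionRing.isAlgebraic_iff ℤ ℚ K).2 (Algebra.IsAlgebraic.isAlgebraic z)
  obtain ⟨n, hn0, hn⟩ := halg.exists_integral_multiple
  obtain ⟨u, v, huv⟩ := (hOK _).1 hn
  have hnK : (n : K) ≠ 0 := by exact_mod_cast hn0
  refine ⟨(u + v * w / 2) / n, v / 2 / n, ?_⟩
  have h1 : z = (n • z) / n := by
    rw [zsmul_eq_mul]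
    field_simp
  have h2 : ((2 : maximalRealSubfield K) : K) = 2 := rfl
  rw [h1, huv]
  push_cast
  rw [h2]
  field_simp
  ring

lemma sqrt_not_mem : sqrtΔ ∉ maximalRealSubfield K := by
  intro hmem
  have h2 := Algebra.IsQuadraticExtension.finrank_eq_two (maximalRealSubfield K) K
  have hbot : (⊥ : Subalgebra (maximalRealSubfield K) K) = ⊤ := by
    rw [eq_top_iff]
    rintro z -
    obtain ⟨u, v, rfl⟩ := exists_eq_add_mul_sqrt hOK z
    exact Algebra.mem_bot.2 ⟨u + v * ⟨sqrtΔ, hmem⟩, rfl⟩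
  have := (Subalgebra.bot_eq_top_iff_finrank_eq_one).1 hbot
  omega

/-- Conjugation fixes the square, because Δ is real in every embedding. If it fixed the root as
well, √Δ would lie in the maximal real subfield. -/
lemma star_apply_sqrt (hsqrtΔ : sqrtΔ ^ 2 = (Δ : K)) (φ : K →+* ℂ) :
    star (φ sqrtΔ) = -φ sqrtΔ := by
  have h1 : (star (φ sqrtΔ)) ^ 2 = (φ sqrtΔ) ^ 2 := by
    rw [← star_pow, ← map_pow, hsqrtΔ]
    exact Δ.2 φ
  refine (sq_eq_sq_iff_eq_or_eq_neg.1 h1).resolve_left fun h2 => ?_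
  have h3 : φ (IsCMField.complexConj K sqrtΔ) = φ sqrtΔ := by
    rw [IsCMField.complexEmbedding_complexConj]
    exact h2
  exact sqrt_not_mem hOK ((IsCMField.complexConj_eq_self_iff K sqrtΔ).1 (φ.injective h3))

lemma sqrt_ne_zero : sqrtΔ ≠ 0 := by
  rintro h
  exact sqrt_not_mem hOK (h ▸ zero_mem _)

lemma isIntegral_sqrt : IsIntegral ℤ sqrtΔ := by
  have h1 : IsIntegral ℤ (((w : maximalRealSubfield K) : K) + sqrtΔ) :=
    (hOK _).2 ⟨0, 2, by
      have : (((2 : 𝓞 (maximalRealSubfield K)) : maximalRealSubfield K) : K) = 2 := by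
        norm_cast
      rw [this]; simp; field_simp⟩
  have h2 : IsIntegral ℤ ((w : maximalRealSubfield K) : K) :=
    w.isIntegral_coe.map ((algebraMap (maximalRealSubfield K) K).toIntAlgHom)
  simpa using h1.sub h2

lemma isIntegral_delta (hsqrtΔ : sqrtΔ ^ 2 = (Δ : K)) : IsIntegral ℤ Δ := by
  refine (isIntegral_algebraMap_iff (algebraMap (maximalRealSubfield K) K).injective).1 ?_
  change IsIntegral ℤ (Δ : K)
  rw [← hsqrtΔ]
  exact (isIntegral_sqrt hOK).pow 2

end

/-- The rational data attached to `K`. -/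
structure CMData (D Dt : ℕ) (s Δ : maximalRealSubfield K) (δ : K) (x y a b : ℤ) : Prop where
  finrank : Module.finrank ℚ (maximalRealSubfield K) = 2
  prime : D.Prime
  mod_four : D % 4 = 1
  sq_s : s ^ 2 = (D : _)
  sq_δ : δ ^ 2 = (Δ : K)
  two_Δ : 2 * Δ = x + y * s
  norm_eq : x ^ 2 - D * y ^ 2 = 4 * Dt
  squarefree : Squarefree Dt
  Dt_mod_four : Dt % 4 = 1
  not_biquadratic : ¬ IsBiquadratic K
  span : ∀ z : K, ∃ p q u v : ℚ, z = p + q * s + (u + v * s) * δ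
  star_δ : ∀ φ : K →+* ℂ, star (φ δ) = -φ δ
  δ_ne_zero : δ ≠ 0
  int_half : ∀ p q : ℤ, IsIntegral ℤ ((p + q * ((1 + (s : K)) / 2)) *
    ((a + b * ((1 + (s : K)) / 2) + δ) / 2))

/-- Writing the integral element Δ as e + f(1 + √D)/2 gives x = 2e + f and y = f; a and b are the
coordinates of w. -/
lemma exists_cmData (hdeg : Module.finrank ℚ K = 4) (hbiq : ¬ IsBiquadratic K)
    {D : ℕ} (hD : D.Prime) (hD4 : D % 4 = 1)
    {sqrtD : maximalRealSubfield K} (hsqrtD : sqrtD ^ 2 = (D : _))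
    {Δ : maximalRealSubfield K} {sqrtΔ : K} (hsqrtΔ : sqrtΔ ^ 2 = (Δ : K))
    {w : 𝓞 (maximalRealSubfield K)}
    (hOK : ∀ z : K, IsIntegral ℤ z ↔
      ∃ u v : 𝓞 (NumberField.maximalRealSubfield K),
        z = ((u : NumberField.maximalRealSubfield K) : K) +
          ((v : NumberField.maximalRealSubfield K) : K) *
            ((((w : NumberField.maximalRealSubfield K) : K) + sqrtΔ) / 2))
    {Dt : ℕ} (hDt : Algebra.norm ℚ Δ = (Dt : ℚ)) (hDt4 : Dt % 4 = 1) (hDtsq : Squarefree Dt) :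
    ∃ x y a b : ℤ, CMData D Dt sqrtD Δ sqrtΔ x y a b := by
  have hF := finrank_maximalRealSubfield hdeg
  have hDsq : Squarefree D := hD.prime.squarefree
  obtain ⟨c, ω, hb, hc, hω⟩ := exists_quadraticBasis hF hDsq hD.one_lt.ne' hD4 hsqrtD
  obtain ⟨Δ', hΔ'⟩ : ∃ z : 𝓞 (maximalRealSubfield K), algebraMap _ (maximalRealSubfield K) z = Δ :=
    ⟨⟨Δ, isIntegral_delta hOK hsqrtΔ⟩, rfl⟩
  obtain ⟨e, f, hef⟩ := hb.span Δ'
  obtain ⟨a, b, hab⟩ := hb.span w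
  have hω' : algebraMap _ (maximalRealSubfield K) ω = (1 + sqrtD) / 2 := by
    rw [← hω]; ring
  have hΔef : Δ = e + f * ((1 + sqrtD) / 2) := by
    rw [← hΔ', hef, ← hω']
    simp
  have hwab : (w : maximalRealSubfield K) = a + b * ((1 + sqrtD) / 2) := by
    rw [hab, ← hω']
    simp
  refine ⟨2 * e + f, f, a, b, hF, hD, hD4, hsqrtD, hsqrtΔ, ?_, ?_, hDtsq, hDt4, hbiq, ?_,
    star_apply_sqrt hOK hsqrtΔ, sqrt_ne_zero hOK, ?_⟩
  · rw [hΔef]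
    push_cast
    ring
  · have h1 := Algebra.coe_norm_int (K := maximalRealSubfield K) Δ'
    rw [NumberField.RingOfIntegers.coe_eq_algebraMap, hΔ', hDt, hef, hb.norm_eq] at h1
    have h2 : e ^ 2 + e * f + c * f ^ 2 = (Dt : ℤ) := by exact_mod_cast h1
    rw [hc]
    linear_combination 4 * h2
  · intro z
    obtain ⟨u, v, rfl⟩ := exists_eq_add_mul_sqrt hOK z
    have hr := not_mem_range_of_sq_eq hDsq hD.one_lt.ne' hsqrtD
    obtain ⟨p, q, hu⟩ := exists_add_mul_of_finrank_two hF hr u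
    obtain ⟨p', q', hv⟩ := exists_add_mul_of_finrank_two hF hr v
    refine ⟨p, q, p', q', ?_⟩
    rw [hu, hv]
    simp
  · intro p q
    refine (hOK _).2 ⟨0, p + q * ω, ?_⟩
    have e1 : ((((p : 𝓞 (maximalRealSubfield K)) + q * ω : 𝓞 (maximalRealSubfield K)) :
        maximalRealSubfield K) : K) = p + q * ((1 + (sqrtD : K)) / 2) := by
      have : (((p : 𝓞 (maximalRealSubfield K)) + q * ω : 𝓞 (maximalRealSubfield K)) :
        maximalRealSubfield K) = p + q * ((1 + sqrtD) / 2) := by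
        rw [← hω']
        simp
      rw [this]
      push_cast
      rfl
    have h2 : ((2 : maximalRealSubfield K) : K) = 2 := rfl
    rw [e1, hwab]
    push_cast
    simp [h2]

namespace CMData

variable {D Dt : ℕ} {s Δ : maximalRealSubfield K} {δ : K} {x y a b : ℤ}
  (h : CMData D Dt s Δ δ x y a b)
include h

lemma sq_s' : (s : K) ^ 2 = D := by
  have := congrArg (fun z : maximalRealSubfield K => (z : K)) h.sq_s
  push_cast at this
  exact this

lemma two_sq_δ : 2 * δ ^ 2 = x + y * (s : K) := by
  have := congrArg (fun z : maximalRealSubfield K => (z : K)) h.two_Δ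
  push_cast at this
  rw [h.sq_δ]
  exact this

lemma adjoin_eq_top {t u : K} (hs : (s : K) ∈ IntermediateField.adjoin ℚ {t, u})
    (hδ : δ ∈ IntermediateField.adjoin ℚ {t, u}) : IntermediateField.adjoin ℚ {t, u} = ⊤ := by
  rw [eq_top_iff]
  rintro z -
  obtain ⟨p, q, v, w, rfl⟩ := h.span z
  have hq : ∀ q : ℚ, (q : K) ∈ IntermediateField.adjoin ℚ {t, u} := fun q => by
    have := (IntermediateField.adjoin ℚ {t, u}).algebraMap_mem q
    rwa [eq_ratCast] at this
  exact add_mem (add_mem (hq p) (mul_mem (hq q) hs))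
    (mul_mem (add_mem (hq v) (mul_mem (hq w) hs)) hδ)

/-- If y = 0, then δ² is rational and K = ℚ(√D, δ) is biquadratic. -/
lemma y_ne_zero : y ≠ 0 := by
  intro hy
  refine h.not_biquadratic ⟨D, x / 2, s, δ, ?_, ?_, h.adjoin_eq_top ?_ ?_⟩
  · rw [h.sq_s']; simp
  · have := h.two_sq_δ
    rw [hy] at this
    push_cast
    linear_combination this / 2
  · exact IntermediateField.subset_adjoin _ _ (by simp)
  · exact IntermediateField.subset_adjoin _ _ (by simp)

/-- If ΔΔ' = 1, then (δ + 1/δ)² = Δ + Δ' + 2 = x + 2 is rational, and √D together with δ + 1/δ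
generates K. Hence F̃ is a genuine quadratic field. -/
lemma Dt_ne_one : Dt ≠ 1 := by
  intro hDt
  have hs0 := h.two_sq_δ
  have hδ := h.δ_ne_zero
  have hn : (x : K) ^ 2 - D * y ^ 2 = 4 := by
    have := congrArg (Int.cast : ℤ → K) h.norm_eq
    rw [hDt] at this
    push_cast at this
    linear_combination this
  have hsq := h.sq_s'
  have h1 : (δ + 1 / δ) ^ 2 = ((x + 2 : ℚ) : K) := by
    field_simp
    push_cast
    linear_combination ((2 * δ ^ 2 + x + y * s) / 4 - (x : K) / 2) * hs0 + y ^ 2 / 4 * hsq - hn / 4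
  have h2 : δ ^ 2 + 1 ≠ 0 := by
    intro h0
    have h3 : ((x + 2 : ℤ) : K) = ((-y : ℤ) : K) * s := by
      push_cast
      linear_combination 2 * h0 - hs0
    have h4 : ((x + 2 : ℤ) : ℚ) = 0 ∧ ((-y : ℤ) : ℚ) = 0 :=
      eq_zero_of_eq_mul_sqrt h.prime h.sq_s' (by exact_mod_cast h3)
    exact h.y_ne_zero (by have := h4.2; push_cast at this; exact_mod_cast neg_eq_zero.1 this)
  refine h.not_biquadratic ⟨D, x + 2, s, δ + 1 / δ, by rw [h.sq_s']; simp, h1,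
    h.adjoin_eq_top ?_ ?_⟩
  · exact IntermediateField.subset_adjoin _ _ (by simp)
  · have m1 : (s : K) ∈ IntermediateField.adjoin ℚ {(s : K), δ + 1 / δ} :=
      IntermediateField.subset_adjoin _ _ (by simp)
    have m2 : δ + 1 / δ ∈ IntermediateField.adjoin ℚ {(s : K), δ + 1 / δ} :=
      IntermediateField.subset_adjoin _ _ (by simp)
    -- This is δ = (δ + 1/δ)·Δ/(Δ + 1).
    have e : δ = (δ + 1 / δ) * ((x + y * s) / 2) / ((x + y * s) / 2 + 1) := by
      rw [← hs0]
      have : 2 * δ ^ 2 / 2 + 1 ≠ 0 := by rwa [mul_div_cancel_left₀ _ two_ne_zero]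
      field_simp
    have m3 : ((x : K) + y * s) / 2 ∈ IntermediateField.adjoin ℚ {(s : K), δ + 1 / δ} :=
      div_mem (add_mem (intCast_mem _ _) (mul_mem (intCast_mem _ _) m1)) (ofNat_mem _ 2)
    have m4 := div_mem (mul_mem m2 m3) (add_mem m3 (one_mem _))
    rwa [← e] at m4

end CMData

end CMField

open NumberField

/-! ### Complex embeddings and the CM type -/

section Embeddings

set_option linter.unusedSectionVars false

variable {K : Type*} [Field K] [NumberField K] [NumberField.IsCMField K]

namespace CMData

variable {D Dt : ℕ} {s Δ : maximalRealSubfield K} {δ : K} {x y a b : ℤ}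
  (h : CMData D Dt s Δ δ x y a b)
include h

lemma embedding_s (φ : K →+* ℂ) : φ s = (Real.sqrt D : ℂ) ∨ φ s = -(Real.sqrt D : ℂ) := by
  apply sq_eq_sq_iff_eq_or_eq_neg.1
  rw [← map_pow, h.sq_s', map_natCast, ← Complex.ofReal_pow, Real.sq_sqrt (Nat.cast_nonneg D)]
  simp

lemma sqrt_D_ne_zero : (Real.sqrt D : ℂ) ≠ 0 := by
  rw [Ne, Complex.ofReal_eq_zero, Real.sqrt_eq_zero (Nat.cast_nonneg D)]
  exact_mod_cast h.prime.ne_zero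

lemma sq_sqrt_D : (Real.sqrt D : ℂ) ^ 2 = D := by
  rw [← Complex.ofReal_pow, Real.sq_sqrt (Nat.cast_nonneg D)]
  simp

lemma exists_embedding_neg (φ : K →+* ℂ) : ∃ ψ : K →+* ℂ, ψ s = -φ s := by
  have hr := not_mem_range_of_sq_eq h.prime.prime.squarefree h.prime.one_lt.ne' h.sq_s
  obtain ⟨τ, hτ⟩ := exists_algEquiv_neg h.finrank hr (d := (D : ℚ)) (by simpa using h.sq_s)
  refine ⟨ComplexEmbedding.lift K ((φ.comp (algebraMap (maximalRealSubfield K) K)).comp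
    (τ : maximalRealSubfield K →+* maximalRealSubfield K)), ?_⟩
  have h1 := ComplexEmbedding.lift_algebraMap_apply K
    ((φ.comp (algebraMap (maximalRealSubfield K) K)).comp
    (τ : maximalRealSubfield K →+* maximalRealSubfield K)) s
  refine h1.trans ?_
  simp only [RingHom.comp_apply]
  have : (τ : maximalRealSubfield K →+* maximalRealSubfield K) s = -s := hτ
  rw [this, map_neg, map_neg]
  rfl

lemma exists_embedding : (∃ φ : K →+* ℂ, φ s = (Real.sqrt D : ℂ)) ∧
    ∃ φ : K →+* ℂ, φ s = -(Real.sqrt D : ℂ) := by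
  have φ : K →+* ℂ := Classical.choice inferInstance
  obtain ⟨ψ, hψ⟩ := h.exists_embedding_neg φ
  rcases h.embedding_s φ with h1 | h1
  · exact ⟨⟨φ, h1⟩, ψ, by rw [hψ, h1]⟩
  · exact ⟨⟨ψ, by rw [hψ, h1, neg_neg]⟩, φ, h1⟩

lemma embedding_ext {φ ψ : K →+* ℂ} (h1 : φ s = ψ s) (h2 : φ δ = ψ δ) : φ = ψ := by
  ext z
  obtain ⟨p, q, u, v, rfl⟩ := h.span z
  simp only [map_add, map_mul, map_ratCast, h1, h2]

lemma two_sq_embedding (φ : K →+* ℂ) : 2 * (φ δ) ^ 2 = x + y * φ s := by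
  have := congrArg φ h.two_sq_δ
  have e : φ 2 = 2 := map_ofNat φ 2
  simpa [e] using this

lemma eq_or_eq_conjugate {φ ψ : K →+* ℂ} (h1 : φ s = ψ s) :
    φ = ψ ∨ φ = ComplexEmbedding.conjugate ψ := by
  have h2 : (φ δ) ^ 2 = (ψ δ) ^ 2 := by
    have e1 := h.two_sq_embedding φ
    have e2 := h.two_sq_embedding ψ
    rw [h1] at e1
    linear_combination (e1 - e2) / 2
  rcases sq_eq_sq_iff_eq_or_eq_neg.1 h2 with h3 | h3
  · exact Or.inl (h.embedding_ext h1 h3)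
  · refine Or.inr (h.embedding_ext ?_ ?_)
    · rw [h1]
      exact (s.2 ψ).symm
    · rw [h3]
      exact (h.star_δ ψ).symm

/-- Complex conjugation does not change the restriction to F, so a CM type contains exactly one
embedding over each of the two embeddings of F. -/
lemma exists_cmType {Φ : Finset (K →+* ℂ)} (hΦ : IsCMType Φ) :
    ∃ σ₁ σ₂ : K →+* ℂ, σ₁ s = (Real.sqrt D : ℂ) ∧ σ₂ s = -(Real.sqrt D : ℂ) ∧
      ∀ f : (K →+* ℂ) → ℂ, ∑ φ ∈ Φ, f φ = f σ₁ + f σ₂ := by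
  classical
  have key : ∀ φ : K →+* ℂ, ∃ ψ ∈ Φ, ψ s = φ s := by
    intro φ
    by_cases hφ : φ ∈ Φ
    · exact ⟨φ, hφ, rfl⟩
    · refine ⟨ComplexEmbedding.conjugate φ, ?_, s.2 φ⟩
      by_contra hc
      exact hφ ((hΦ φ).2 hc)
  obtain ⟨⟨φ₁, h1⟩, φ₂, h2⟩ := h.exists_embedding
  obtain ⟨σ₁, hm1, e1⟩ := key φ₁
  obtain ⟨σ₂, hm2, e2⟩ := key φ₂
  rw [h1] at e1
  rw [h2] at e2
  have hne : σ₁ ≠ σ₂ := by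
    rintro rfl
    rw [e1] at e2
    exact h.sqrt_D_ne_zero (self_eq_neg.1 e2)
  have huniq : ∀ φ ∈ Φ, ∀ ψ ∈ Φ, φ s = ψ s → φ = ψ := by
    intro φ hφ ψ hψ he
    refine (h.eq_or_eq_conjugate he).resolve_right ?_
    rintro rfl
    exact (hΦ ψ).1 hψ hφ
  have hΦ2 : Φ = {σ₁, σ₂} := by
    ext φ
    simp only [Finset.mem_insert, Finset.mem_singleton]
    constructor
    · intro hφ
      rcases h.embedding_s φ with h3 | h3
      · exact Or.inl (huniq φ hφ σ₁ hm1 (by rw [h3, e1]))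
      · exact Or.inr (huniq φ hφ σ₂ hm2 (by rw [h3, e2]))
    · rintro (rfl | rfl) <;> assumption
  refine ⟨σ₁, σ₂, e1, e2, fun f => ?_⟩
  rw [hΦ2, Finset.sum_pair hne]

lemma re_sq_neg (φ : K →+* ℂ) : ((φ δ) ^ 2).re < 0 := by
  have h1 := h.star_δ φ
  have h2 : (φ δ).re = 0 := by
    have := congrArg Complex.re h1
    simp at this
    linarith
  have h3 : (φ δ).im ≠ 0 := by
    intro h3
    have : φ δ = 0 := Complex.ext h2 h3
    exact h.δ_ne_zero (by simpa using this)
  rw [sq, Complex.mul_re, h2]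
  nlinarith [mul_self_pos.2 h3]

/-- It is the sum of (φ δ)² over two embeddings with opposite images of √D, each the square of a
non-zero purely imaginary number. -/
lemma x_neg : x < 0 := by
  obtain ⟨⟨φ₁, h1⟩, φ₂, h2⟩ := h.exists_embedding
  have e1 := h.two_sq_embedding φ₁
  have e2 := h.two_sq_embedding φ₂
  have e3 : (x : ℂ) = (φ₁ δ) ^ 2 + (φ₂ δ) ^ 2 := by
    rw [h1] at e1
    rw [h2] at e2
    linear_combination -(e1 + e2) / 2
  have e4 := congrArg Complex.re e3
  rw [Complex.add_re, Complex.intCast_re] at e4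
  have : (x : ℝ) < 0 := by
    rw [e4]
    linarith [h.re_sq_neg φ₁, h.re_sq_neg φ₂]
  exact_mod_cast this

section

variable {σ₁ σ₂ : K →+* ℂ} (h1 : σ₁ s = (Real.sqrt D : ℂ)) (h2 : σ₂ s = -(Real.sqrt D : ℂ))
include h1 h2

lemma sq_r : (σ₁ δ * σ₂ δ) ^ 2 = Dt := by
  have e1 := h.two_sq_embedding σ₁
  have e2 := h.two_sq_embedding σ₂
  have hn : (x : ℂ) ^ 2 - D * y ^ 2 = 4 * Dt := by
    have := congrArg (Int.cast : ℤ → ℂ) h.norm_eq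
    push_cast at this
    exact this
  rw [h1] at e1
  rw [h2] at e2
  linear_combination hn / 4 + (σ₂ δ) ^ 2 / 2 * e1 + (x + y * (Real.sqrt D : ℂ)) / 4 * e2 -
    (y : ℂ) ^ 2 / 4 * h.sq_sqrt_D

lemma r_eq : σ₁ δ * σ₂ δ = (Real.sqrt Dt : ℂ) ∨ σ₁ δ * σ₂ δ = -(Real.sqrt Dt : ℂ) := by
  apply sq_eq_sq_iff_eq_or_eq_neg.1
  rw [h.sq_r h1 h2, ← Complex.ofReal_pow, Real.sq_sqrt (Nat.cast_nonneg Dt)]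
  simp

lemma sq_ξ : (σ₁ δ + σ₂ δ) ^ 2 = x + 2 * (σ₁ δ * σ₂ δ) := by
  have e1 := h.two_sq_embedding σ₁
  have e2 := h.two_sq_embedding σ₂
  rw [h1] at e1
  rw [h2] at e2
  linear_combination (e1 + e2) / 2

lemma sq_ζ : ((Real.sqrt D : ℂ) * (σ₁ δ - σ₂ δ)) ^ 2 = D * (x - 2 * (σ₁ δ * σ₂ δ)) := by
  have e1 := h.two_sq_embedding σ₁
  have e2 := h.two_sq_embedding σ₂
  rw [h1] at e1
  rw [h2] at e2
  linear_combination (σ₁ δ - σ₂ δ) ^ 2 * h.sq_sqrt_D + D * (e1 + e2) / 2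

lemma ξ_mul_ζ : (σ₁ δ + σ₂ δ) * ((Real.sqrt D : ℂ) * (σ₁ δ - σ₂ δ)) = D * y := by
  have e1 := h.two_sq_embedding σ₁
  have e2 := h.two_sq_embedding σ₂
  rw [h1] at e1
  rw [h2] at e2
  linear_combination (Real.sqrt D : ℂ) * (e1 - e2) / 2 + y * h.sq_sqrt_D

end

end CMData

lemma finrank_adjoin_simple_eq_two {k L : Type*} [Field k] [Field L] [Algebra k L] {θ : L} {a : k}
    (hθ : θ ^ 2 = algebraMap k L a) (hθk : θ ∉ (algebraMap k L).range) :
    Module.finrank k (IntermediateField.adjoin k {θ}) = 2 := by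
  have hm : (Polynomial.X ^ 2 - Polynomial.C a : Polynomial k).Monic := by monicity!
  have hroot : Polynomial.aeval θ (Polynomial.X ^ 2 - Polynomial.C a) = 0 := by simp [hθ]
  have hint : IsIntegral k θ := ⟨_, hm, hroot⟩
  rw [IntermediateField.adjoin.finrank hint]
  have hdeg : (Polynomial.X ^ 2 - Polynomial.C a : Polynomial k).natDegree = 2 := by compute_degree!
  have h1 : (minpoly k θ).natDegree ≤ 2 := by
    rw [← hdeg]
    exact Polynomial.natDegree_le_of_dvd (minpoly.dvd k θ hroot) hm.ne_zero
  have h2 : (minpoly k θ).natDegree ≠ 1 := fun h => hθk (minpoly.natDegree_eq_one_iff.1 h)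
  have h3 := minpoly.natDegree_pos hint
  omega

end Embeddings

open NumberField

/-! ### The reflex field realizes the quadratic datum -/

section ReflexData

set_option linter.unusedSectionVars false

variable {K : Type*} [Field K] [NumberField K] [NumberField.IsCMField K]

namespace CMData

variable {D Dt : ℕ} {s Δ : maximalRealSubfield K} {δ : K} {x y a b : ℤ}
  (h : CMData D Dt s Δ δ x y a b) {Φ : Finset (K →+* ℂ)} {σ₁ σ₂ : K →+* ℂ}
  (h1 : σ₁ s = (Real.sqrt D : ℂ)) (h2 : σ₂ s = -(Real.sqrt D : ℂ))
  (hsum : ∀ f : (K →+* ℂ) → ℂ, ∑ φ ∈ Φ, f φ = f σ₁ + f σ₂)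
include h h1 h2 hsum

omit h h1 h2 in
lemma exists_trace (z : K) : ∃ t : reflexField Φ, (t : ℂ) = σ₁ z + σ₂ z :=
  ⟨⟨σ₁ z + σ₂ z, IntermediateField.subset_adjoin _ _ ⟨z, hsum fun φ => φ z⟩⟩, rfl⟩

omit h h1 h2 in
lemma exists_integer_trace {z : K} (hz : IsIntegral ℤ z) :
    ∃ t : 𝓞 (reflexField Φ), ((algebraMap (𝓞 (reflexField Φ)) (reflexField Φ) t : _) : ℂ) =
      σ₁ z + σ₂ z := by
  obtain ⟨t, ht⟩ := exists_trace hsum z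
  refine ⟨⟨t, ?_⟩, ht⟩
  refine (isIntegral_algebraMap_iff (algebraMap (reflexField Φ) ℂ).injective).1 ?_
  change IsIntegral ℤ (t : ℂ)
  rw [ht]
  exact (hz.map σ₁.toIntAlgHom).add (hz.map σ₂.toIntAlgHom)

/-- The type trace ξ of δ gives r = (ξ² − x)/2. Either sign of r = ±√D̃ generates the same field F̃.
-/
lemma exists_sqrt : ∃ ρ r : reflexField Φ, (ρ : ℂ) = (Real.sqrt Dt : ℂ) ∧ (r : ℂ) = σ₁ δ * σ₂ δ ∧
    (r = ρ ∨ r = -ρ) ∧ tildeF Φ Dt = IntermediateField.adjoin ℚ {ρ} := by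
  obtain ⟨ξ, hξ⟩ := exists_trace hsum δ
  obtain ⟨r, hr⟩ : ∃ r : reflexField Φ, (r : ℂ) = σ₁ δ * σ₂ δ := by
    refine ⟨(ξ ^ 2 - x) / 2, ?_⟩
    have c2 : ((2 : reflexField Φ) : ℂ) = 2 := rfl
    push_cast
    rw [hξ, h.sq_ξ h1 h2, c2]
    ring
  have key : ∀ ρ : reflexField Φ, (ρ : ℂ) = (Real.sqrt Dt : ℂ) →
      tildeF Φ Dt = IntermediateField.adjoin ℚ {ρ} := by
    intro ρ hρ
    unfold tildeF
    congr 1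
    ext z
    rw [Set.mem_ofPred_eq, Set.mem_singleton_iff, ← hρ]
    exact Subtype.ext_iff.symm
  rcases h.r_eq h1 h2 with h3 | h3
  · exact ⟨r, r, by rw [hr, h3], hr, Or.inl rfl, key r (by rw [hr, h3])⟩
  · have : ((-r : reflexField Φ) : ℂ) = (Real.sqrt Dt : ℂ) := by
      push_cast
      rw [hr, h3, neg_neg]
    exact ⟨-r, r, this, hr, Or.inr (neg_neg r).symm, key _ this⟩

lemma exists_reflexDatum : ∃ (c : ℤ) (ω : 𝓞 (tildeF Φ Dt)) (ξ ζ η : 𝓞 (reflexField Φ)),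
    ReflexDatum D Dt x y c ω ξ ζ η ∧
    ((algebraMap (𝓞 (reflexField Φ)) (reflexField Φ) ξ : _) : ℂ) = σ₁ δ + σ₂ δ ∧
    (((2 * algebraMap (𝓞 (tildeF Φ Dt)) (tildeF Φ Dt) ω - 1 : tildeF Φ Dt) : reflexField Φ) : ℂ) =
      σ₁ δ * σ₂ δ := by
  obtain ⟨ρ, r, hρ, hr, hrρ, hE⟩ := h.exists_sqrt h1 h2 hsum
  have hr2 : r ^ 2 = (Dt : reflexField Φ) := by
    apply Subtype.ext
    push_cast
    rw [hr, h.sq_r h1 h2]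
  have hρ2 : ρ ^ 2 = (Dt : reflexField Φ) := by
    rw [← hr2]
    rcases hrρ with h3 | h3 <;> rw [h3]
    ring
  have hfinE : Module.finrank ℚ (tildeF Φ Dt) = 2 := by
    rw [hE]
    exact finrank_adjoin_simple_eq_two (a := (Dt : ℚ)) (by simpa using hρ2)
      (not_mem_range_of_sq_eq h.squarefree h.Dt_ne_one hρ2)
  have hρE : ρ ∈ tildeF Φ Dt := by
    rw [hE]
    exact IntermediateField.mem_adjoin_simple_self ℚ ρ
  have hrE : r ∈ tildeF Φ Dt := by
    rcases hrρ with h3 | h3 <;> rw [h3]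
    · exact hρE
    · exact neg_mem hρE
  obtain ⟨rE, hrE'⟩ : ∃ rE : tildeF Φ Dt, (rE : reflexField Φ) = r := ⟨⟨r, hrE⟩, rfl⟩
  have hrE2 : rE ^ 2 = (Dt : tildeF Φ Dt) := by
    apply Subtype.ext
    push_cast
    rw [hrE', hr2]
  obtain ⟨c, ω, hb, hc, hω⟩ := exists_quadraticBasis hfinE h.squarefree h.Dt_ne_one h.Dt_mod_four hrE2
  obtain ⟨d, hd⟩ : ∃ d : ℤ, (D : ℤ) = 1 + 4 * d := ⟨(D : ℤ) / 4, by have := h.mod_four; omega⟩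
  have hdC : (D : ℂ) = 1 + 4 * d := by exact_mod_cast congrArg (Int.cast : ℤ → ℂ) hd
  have c2 : ∀ φ : K →+* ℂ, φ 2 = 2 := fun φ => map_ofNat φ 2
  -- The multipliers p + q(1 + √D)/2 of (w + δ)/2 are 1, √D and (√D − 1)/2. Their type traces are
  -- halves of ξ, ζ, η plus the integers 2a + b, bD and −a + 2bd, the traces of the multiplier times
  -- w.
  obtain ⟨φ₁, hφ₁⟩ := exists_integer_trace hsum (h.int_half 1 0)
  obtain ⟨φ₂, hφ₂⟩ := exists_integer_trace hsum (h.int_half (-1) 2)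
  obtain ⟨φ₃, hφ₃⟩ := exists_integer_trace hsum (h.int_half (-1) 1)
  simp only [map_mul, map_add, map_div₀, map_intCast, map_one, h1, h2, c2] at hφ₁ hφ₂ hφ₃
  push_cast at hφ₁ hφ₂ hφ₃
  set ι : 𝓞 (reflexField Φ) →+* ℂ :=
    (algebraMap (reflexField Φ) ℂ).comp (algebraMap (𝓞 (reflexField Φ)) (reflexField Φ)) with hι
  have hinj : Function.Injective ι := (algebraMap (reflexField Φ) ℂ).injective.comp
    NumberField.RingOfIntegers.coe_injective
  have eφ₁ : ι φ₁ = _ := hφ₁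
  have eφ₂ : ι φ₂ = _ := hφ₂
  have eφ₃ : ι φ₃ = _ := hφ₃
  have i2 : ι 2 = 2 := map_ofNat ι 2
  have hsq := h.sq_sqrt_D
  obtain ⟨ξ, hξd⟩ : ∃ ξ, ξ = 2 * φ₁ - ((2 * a + b : ℤ) : 𝓞 (reflexField Φ)) := ⟨_, rfl⟩
  obtain ⟨ζ, hζd⟩ : ∃ ζ, ζ = 2 * φ₂ - ((b * D : ℤ) : 𝓞 (reflexField Φ)) := ⟨_, rfl⟩
  obtain ⟨η, hηd⟩ : ∃ η, η = 2 * φ₃ - ((-a + 2 * b * d : ℤ) : 𝓞 (reflexField Φ)) := ⟨_, rfl⟩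
  have eξ : ι ξ = σ₁ δ + σ₂ δ := by
    rw [hξd, map_sub, map_mul, i2, map_intCast, eφ₁]
    push_cast
    ring
  have eζ : ι ζ = (Real.sqrt D : ℂ) * (σ₁ δ - σ₂ δ) := by
    rw [hζd, map_sub, map_mul, i2, map_intCast, eφ₂]
    push_cast
    linear_combination (b : ℂ) * hsq
  have eη : 2 * ι η = (Real.sqrt D : ℂ) * (σ₁ δ - σ₂ δ) - (σ₁ δ + σ₂ δ) := by
    rw [hηd, map_sub, map_mul, i2, map_intCast, eφ₃]
    push_cast
    linear_combination (b : ℂ) * hsq + b * hdC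
  have eω : ∀ z : 𝓞 (tildeF Φ Dt), ι (algebraMap (𝓞 (tildeF Φ Dt)) (𝓞 (reflexField Φ)) z) =
      ((algebraMap (𝓞 (tildeF Φ Dt)) (tildeF Φ Dt) z : reflexField Φ) : ℂ) := fun z => rfl
  have eωr : ι (algebraMap (𝓞 (tildeF Φ Dt)) (𝓞 (reflexField Φ)) (2 * ω - 1)) = σ₁ δ * σ₂ δ := by
    rw [eω, map_sub, map_mul, map_ofNat, map_one, hω, hrE', hr]
  have hDy : (D : ℂ) * y ≠ 0 := by
    have := h.y_ne_zero
    have := h.prime.ne_zero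
    exact mul_ne_zero (by exact_mod_cast this) (by exact_mod_cast h.y_ne_zero)
  have hξ0 : σ₁ δ + σ₂ δ ≠ 0 := by
    intro h0
    apply hDy
    rw [← h.ξ_mul_ζ h1 h2, h0, zero_mul]
  -- Elements of F̃ are real, whereas ξ is purely imaginary and non-zero.
  have hξE : algebraMap (𝓞 (reflexField Φ)) (reflexField Φ) ξ ∉
      (algebraMap (tildeF Φ Dt) (reflexField Φ)).range := by
    rintro ⟨z, hz⟩
    obtain ⟨p, q, hpq⟩ := exists_add_mul_of_finrank_two hfinE
      (not_mem_range_of_sq_eq h.squarefree h.Dt_ne_one hrE2) z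
    have hz' : ι ξ = p + q * (σ₁ δ * σ₂ δ) := by
      have e1 : ι ξ = (((algebraMap (𝓞 (reflexField Φ)) (reflexField Φ) ξ : reflexField Φ)) : ℂ) :=
        rfl
      have e2 : algebraMap (tildeF Φ Dt) (reflexField Φ) z = (z : reflexField Φ) := rfl
      rw [e1, ← hz, e2, hpq, ← hr, ← hrE']
      simp
    have hst := congrArg star hz'
    rw [eξ] at hz'
    rw [eξ] at hst
    have e3 : ∀ q : ℚ, star (q : ℂ) = q := fun q => map_ratCast (starRingEnd ℂ) q
    rw [star_add, h.star_δ, h.star_δ, star_add, star_mul, star_mul, h.star_δ, h.star_δ, e3, e3] at hst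
    apply hξ0
    linear_combination (hz' - hst) / 2
  have hfin : Module.finrank (tildeF Φ Dt) (reflexField Φ) = 2 := by
    have hξ2 : (algebraMap (𝓞 (reflexField Φ)) (reflexField Φ) ξ) ^ 2 =
        algebraMap (tildeF Φ Dt) (reflexField Φ) (x + 2 * rE) := by
      apply Subtype.ext
      have e1 : (((algebraMap (𝓞 (reflexField Φ)) (reflexField Φ) ξ : reflexField Φ)) : ℂ) =
        σ₁ δ + σ₂ δ := eξ
      have e2 : algebraMap (tildeF Φ Dt) (reflexField Φ) (x + 2 * rE) = x + 2 * r := by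
        rw [map_add, map_mul, map_intCast, map_ofNat, ← hrE']
        rfl
      rw [e2]
      push_cast
      rw [e1, h.sq_ξ h1 h2, hr]
      rfl
    have htop : IntermediateField.adjoin (tildeF Φ Dt)
        {algebraMap (𝓞 (reflexField Φ)) (reflexField Φ) ξ} = ⊤ := by
      set N := IntermediateField.adjoin (tildeF Φ Dt)
        {algebraMap (𝓞 (reflexField Φ)) (reflexField Φ) ξ} with hN
      have hle : reflexField Φ ≤ (N.restrictScalars ℚ).map (reflexField Φ).val := by
        refine IntermediateField.adjoin_le_iff.2 ?_
        rintro _ ⟨z, rfl⟩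
        obtain ⟨p, q, u, v, rfl⟩ := h.span z
        have hξN : algebraMap (𝓞 (reflexField Φ)) (reflexField Φ) ξ ∈ N :=
          IntermediateField.mem_adjoin_simple_self _ _
        have hQ : ∀ q : ℚ, (q : reflexField Φ) ∈ N := fun q => by
          have := N.algebraMap_mem (q : tildeF Φ Dt)
          rwa [map_ratCast] at this
        have hζN : (D : reflexField Φ) * y / algebraMap (𝓞 (reflexField Φ)) (reflexField Φ) ξ ∈ N :=
          div_mem (mul_mem (natCast_mem _ _) (intCast_mem _ _)) hξN
        -- The type trace of p + q√D + (u + v√D)δ is 2p + uξ + vζ, and ζ = D y/ξ.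
        refine ⟨_, add_mem (add_mem (hQ (2 * p)) (mul_mem (hQ u) hξN)) (mul_mem (hQ v) hζN), ?_⟩
        have e1 : (((algebraMap (𝓞 (reflexField Φ)) (reflexField Φ) ξ : reflexField Φ)) : ℂ) =
          σ₁ δ + σ₂ δ := eξ
        simp only [hsum, map_add, map_mul, map_ratCast, h1, h2]
        simp only [AlgHom.coe_toRingHom, IntermediateField.coe_val, IntermediateField.coe_div,
          IntermediateField.coe_mul]
        push_cast
        rw [e1, ← h.ξ_mul_ζ h1 h2, mul_div_cancel_left₀ _ hξ0]
        ring
      rw [eq_top_iff]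
      rintro z -
      obtain ⟨w, hw, hwz⟩ := hle z.2
      have : w = z := Subtype.ext hwz
      exact this ▸ hw
    have h3 := finrank_adjoin_simple_eq_two hξ2 hξE
    rwa [htop, IntermediateField.finrank_top'] at h3
  refine ⟨c, ω, ξ, ζ, η, ⟨hb, hfin, h.prime, h.mod_four, hc, h.squarefree, h.norm_eq, h.y_ne_zero,
    ?_, ?_, ?_, ?_, ?_, ⟨2 * a + b, φ₁, by rw [hξd]; ring⟩, ⟨b * D, φ₂, by rw [hζd]; ring⟩,
    ⟨-a + 2 * b * d, φ₃, by rw [hηd]; ring⟩⟩, eξ, ?_⟩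
  · apply hinj
    rw [map_pow, eξ, map_add, map_add, map_mul, map_mul, eωr, map_intCast, map_intCast, map_ofNat,
      i2, h.sq_ξ h1 h2]
  · apply hinj
    rw [map_pow, eζ, map_mul, map_mul, map_sub, map_sub, map_mul (algebraMap _ _) 2, map_mul ι (algebraMap _ _ 2), eωr, map_intCast, map_intCast,
      map_ofNat, i2, h.sq_ζ h1 h2, map_natCast, map_natCast]
  · apply hinj
    rw [map_mul, map_mul, eξ, eζ, h.ξ_mul_ζ h1 h2, map_natCast, map_intCast]
  · apply hinj
    rw [map_mul, map_sub, eξ, eζ, i2, eη]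
  · rintro ⟨z, hz⟩
    exact hξE ⟨algebraMap _ _ z, by rw [← hz]; rfl⟩
  · rw [hω, hrE', hr]

end CMData

end ReflexData

open NumberField

/-! ### Generators of the Galois closure -/

section Closure

set_option linter.unusedSectionVars false

instance galoisClosure_numberField (K : Type*) [Field K] [NumberField K] :
    NumberField (galoisClosure K) where
  to_charZero := inferInstance
  to_finiteDimensional := inferInstance

instance galoisClosure_isGalois (K : Type*) [Field K] [NumberField K] :
    IsGalois ℚ (galoisClosure K) := by
  have : Normal ℚ (galoisClosure K) :=
    (Algebra.IsAlgebraic.isNormalClosure_normalClosure (F := ℚ) (K := K) (L := ℂ)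
      fun x => IsAlgClosed.splits _).normal
  constructor

variable {K : Type*} [Field K] [NumberField K] [NumberField.IsCMField K]

namespace CMData

variable {D Dt : ℕ} {s Δ : maximalRealSubfield K} {δ : K} {x y a b : ℤ}
  (h : CMData D Dt s Δ δ x y a b) {σ₁ σ₂ : K →+* ℂ}
  (h1 : σ₁ s = (Real.sqrt D : ℂ)) (h2 : σ₂ s = -(Real.sqrt D : ℂ))
include h h1 h2

lemma adjoin_galoisClosure {S d₁ d₂ : galoisClosure K} (hS : (S : ℂ) = (Real.sqrt D : ℂ))
    (hd₁ : (d₁ : ℂ) = σ₁ δ) (hd₂ : (d₂ : ℂ) = σ₂ δ) (z : galoisClosure K) :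
    z ∈ IntermediateField.adjoin ℚ {S, d₁, d₂} := by
  set N := IntermediateField.adjoin ℚ {S, d₁, d₂} with hN
  have hSN : S ∈ N := IntermediateField.subset_adjoin _ _ (by simp)
  have hd₁N : d₁ ∈ N := IntermediateField.subset_adjoin _ _ (by simp)
  have hd₂N : d₂ ∈ N := IntermediateField.subset_adjoin _ _ (by simp)
  have hle : galoisClosure K ≤ N.map (galoisClosure K).val := by
    refine iSup_le fun f => ?_
    rintro _ ⟨z, rfl⟩
    have hmS : (Real.sqrt D : ℂ) ∈ N.map (galoisClosure K).val := ⟨S, hSN, hS⟩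
    have hm₁ : σ₁ δ ∈ N.map (galoisClosure K).val := ⟨d₁, hd₁N, hd₁⟩
    have hm₂ : σ₂ δ ∈ N.map (galoisClosure K).val := ⟨d₂, hd₂N, hd₂⟩
    have hfs : f s ∈ N.map (galoisClosure K).val := by
      rcases h.embedding_s (f : K →+* ℂ) with h3 | h3
      · exact (show f s = _ from h3) ▸ hmS
      · exact (show f s = _ from h3) ▸ neg_mem hmS
    have hfδ : f δ ∈ N.map (galoisClosure K).val := by
      have key : ∀ σ : K →+* ℂ, (f : K →+* ℂ) s = σ s → σ δ ∈ N.map (galoisClosure K).val →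
          f δ ∈ N.map (galoisClosure K).val := by
        intro σ hσ hm
        rcases h.eq_or_eq_conjugate hσ with h4 | h4
        · exact (show f δ = σ δ from RingHom.congr_fun h4 δ) ▸ hm
        · have h5 : f δ = -σ δ := (RingHom.congr_fun h4 δ).trans (h.star_δ σ)
          exact h5 ▸ neg_mem hm
      rcases h.embedding_s (f : K →+* ℂ) with h3 | h3
      · exact key σ₁ (h3.trans h1.symm) hm₁
      · exact key σ₂ (h3.trans h2.symm) hm₂
    obtain ⟨p, q, u, v, rfl⟩ := h.span z
    have hq : ∀ q : ℚ, (q : ℂ) ∈ N.map (galoisClosure K).val := fun q => by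
      have := (N.map (galoisClosure K).val).algebraMap_mem q
      rwa [eq_ratCast] at this
    change f _ ∈ _
    simp only [map_add, map_mul, map_ratCast]
    exact add_mem (add_mem (hq p) (mul_mem (hq q) hfs))
      (mul_mem (add_mem (hq u) (mul_mem (hq v) hfs)) hfδ)
  obtain ⟨w, hw, hwz⟩ := hle z.2
  have : w = z := Subtype.ext hwz
  exact this ▸ hw

/-- The conjugates of `ξ` generate the Galois closure. -/
lemma eq_one_of_fixes_conjugates {ξ : galoisClosure K} (hξ : (ξ : ℂ) = σ₁ δ + σ₂ δ)
    (g : Gal((galoisClosure K)/ℚ)) (hg : ∀ σ : Gal((galoisClosure K)/ℚ), g (σ ξ) = σ ξ) : g = 1 := by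
  have hmem : ∀ (σ : K →+* ℂ) (z : K), ∃ t : galoisClosure K, (t : ℂ) = σ z := fun σ z =>
    ⟨⟨σ z, (AlgHom.fieldRange_le_normalClosure σ.toRatAlgHom) ⟨z, rfl⟩⟩, rfl⟩
  obtain ⟨S, hS⟩ := hmem σ₁ s
  obtain ⟨d₁, hd₁⟩ := hmem σ₁ δ
  obtain ⟨d₂, hd₂⟩ := hmem σ₂ δ
  have c2 : ((2 : galoisClosure K) : ℂ) = 2 := rfl
  have e1 : 2 * d₁ ^ 2 = x + y * S := by
    apply Subtype.ext
    push_cast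
    rw [c2, hd₁, hS, h.two_sq_embedding]
  have hr2 : (d₁ * d₂) ^ 2 = (Dt : galoisClosure K) := by
    apply Subtype.ext
    push_cast
    rw [hd₁, hd₂, h.sq_r h1 h2]
  have hξd : ξ = d₁ + d₂ := by
    apply Subtype.ext
    push_cast
    rw [hξ, hd₁, hd₂]
  have hξ2 : ξ ^ 2 = x + 2 * (d₁ * d₂) := by
    apply Subtype.ext
    push_cast
    rw [hξ, c2, hd₁, hd₂, h.sq_ξ h1 h2]
  -- As r = d₁d₂ is irrational, some σ negates it and sends ξ to ±(d₁ − d₂). So g fixes d₁ and d₂,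
  -- and also √D, since y√D = 2d₁² − x with y ≠ 0.
  have hr : ¬ ∀ σ : Gal((galoisClosure K)/ℚ), σ (d₁ * d₂) = d₁ * d₂ := by
    intro hfix
    apply not_mem_range_of_sq_eq h.squarefree h.Dt_ne_one hr2
    have := (IsGalois.mem_bot_iff_fixed (F := ℚ) (d₁ * d₂)).2 hfix
    exact IntermediateField.mem_bot.1 this
  push Not at hr
  obtain ⟨σ, hσ⟩ := hr
  have hσr : σ (d₁ * d₂) = -(d₁ * d₂) := by
    refine (sq_eq_sq_iff_eq_or_eq_neg.1 ?_).resolve_left hσ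
    rw [← map_pow, hr2, map_natCast]
  have hσξ : (σ ξ) ^ 2 = (d₁ - d₂) ^ 2 := by
    rw [← map_pow, hξ2, map_add, map_mul, hσr, map_intCast, map_ofNat]
    linear_combination (-hξ2) + (ξ + d₁ + d₂) * hξd
  have hg1 : g (d₁ - d₂) = d₁ - d₂ := by
    rcases sq_eq_sq_iff_eq_or_eq_neg.1 hσξ with h3 | h3
    · rw [← h3]; exact hg σ
    · have := hg σ
      rw [h3, map_neg] at this
      exact neg_inj.1 this
  have hg2 : g (d₁ + d₂) = d₁ + d₂ := by
    rw [← hξd]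
    exact hg 1
  rw [map_sub] at hg1
  rw [map_add] at hg2
  have hgd₁ : g d₁ = d₁ := by linear_combination (hg1 + hg2) / 2
  have hgd₂ : g d₂ = d₂ := by linear_combination (hg2 - hg1) / 2
  have hgS : g S = S := by
    have hy : (y : galoisClosure K) ≠ 0 := by exact_mod_cast h.y_ne_zero
    have e2 := congrArg g e1
    rw [map_mul, map_pow, hgd₁, map_add, map_mul, map_intCast, map_intCast, map_ofNat] at e2
    apply mul_left_cancel₀ hy
    linear_combination e1 - e2
  ext z
  have hz := h.adjoin_galoisClosure h1 h2 (hS.trans h1) hd₁ hd₂ z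
  congr 1
  change g z = z
  induction hz using IntermediateField.adjoin_induction with
  | mem w hw =>
    rcases hw with rfl | rfl | rfl <;> assumption
  | algebraMap q => exact g.commutes q
  | add u v _ _ hu hv => rw [map_add, hu, hv]
  | inv u _ hu => rw [map_inv₀, hu]
  | mul u v _ _ hu hv => rw [map_mul, hu, hv]

end CMData

end Closure

open IsDedekindDomain

/-! ### Prime factors of an ideal above a given rational prime -/

section Factors

set_option linter.unusedSectionVars false

variable {E : Type*} [Field E] [NumberField E]

/-- The prime divisors of `I` above `l`. -/
def factorsOver (I : Ideal (𝓞 E)) (l : ℕ) : Set (HeightOneSpectrum (𝓞 E)) :=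
  {v | (l : 𝓞 E) ∈ v.asIdeal ∧ v.asIdeal ∣ I}

lemma HeightOneSpectrum.eq_of_dvd {v w : HeightOneSpectrum (𝓞 E)} (h : v.asIdeal ∣ w.asIdeal) :
    v = w := by
  by_contra hvw
  exact not_dvd_of_ne hvw h

lemma natCast_mem_iff_dvd {v : HeightOneSpectrum (𝓞 E)} {l : ℕ} :
    (l : 𝓞 E) ∈ v.asIdeal ↔ v.asIdeal ∣ Ideal.span {(l : 𝓞 E)} := by
  rw [Ideal.dvd_span_singleton]

lemma span_natCast_ne_bot' {l : ℕ} (hl : l.Prime) : Ideal.span {(l : 𝓞 E)} ≠ ⊥ := by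
  simpa using hl.ne_zero

lemma dvd_absNorm_of_mem {v : HeightOneSpectrum (𝓞 E)} {l : ℕ} (hl : l.Prime)
    (hv : (l : 𝓞 E) ∈ v.asIdeal) : l ∣ Ideal.absNorm v.asIdeal := by
  have h4 : Ideal.absNorm v.asIdeal ≠ 1 := by
    rw [Ne, Ideal.absNorm_eq_one_iff]
    exact v.isPrime.ne_top
  obtain ⟨q, hq, hqd⟩ := Nat.exists_prime_and_dvd h4
  obtain ⟨w, hw, hwv⟩ := exists_dvd_of_dvd_absNorm hq v.ne_bot hqd
  rw [HeightOneSpectrum.eq_of_dvd hwv] at hw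
  rwa [eq_of_natCast_mem hl hq hv hw]

namespace QuadraticBasis

variable {c : ℤ} {ω : 𝓞 E} (h : QuadraticBasis c ω) {l : ℕ} (hl : l.Prime)
  (hd : ¬ (l : ℤ) ∣ 1 - 4 * c)
include h hl

lemma exists_pair (h2 : ((Ideal.span {(l : ℤ)}).primesOver (𝓞 E)).ncard = 2) :
    ∃ v w : HeightOneSpectrum (𝓞 E), v ≠ w ∧ (l : 𝓞 E) ∈ v.asIdeal ∧ (l : 𝓞 E) ∈ w.asIdeal := by
  have := h.isGalois
  have := isMaximal_span_natCast hl
  obtain ⟨P, Q, hP, hQ, hPl, hQl, hPQ, -, -⟩ := map_eq_mul_of_split (B := 𝓞 E) Gal(E/ℚ) h.card_gal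
    (Ideal.span {(l : ℤ)}) (span_natCast_ne_bot hl) h2
  have hP0 : P ≠ ⊥ := Ideal.ne_bot_of_liesOver_of_ne_bot (span_natCast_ne_bot hl) P
  have hQ0 : Q ≠ ⊥ := Ideal.ne_bot_of_liesOver_of_ne_bot (span_natCast_ne_bot hl) Q
  exact ⟨⟨P, hP, hP0⟩, ⟨Q, hQ, hQ0⟩, fun h0 => hPQ (congrArg HeightOneSpectrum.asIdeal h0),
    natCast_mem_of_liesOver l P, natCast_mem_of_liesOver l Q⟩

include hd

lemma exists_inert (h2 : ((Ideal.span {(l : ℤ)}).primesOver (𝓞 E)).ncard ≠ 2) :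
    ∃ v : HeightOneSpectrum (𝓞 E), v.asIdeal = Ideal.span {(l : 𝓞 E)} := by
  have := h.isGalois
  have := isMaximal_span_natCast hl
  obtain ⟨P, hP, hPl, hPe⟩ := map_eq_of_inert (B := 𝓞 E) Gal(E/ℚ) h.card_gal
    (Ideal.span {(l : ℤ)}) (span_natCast_ne_bot hl) h.eq_zero' h.not_mem_range
    (by rw [Ideal.mem_span_singleton]; simpa using hd) h2
  rw [map_span_natCast] at hPe
  exact ⟨⟨P, hP, hPe ▸ span_natCast_ne_bot' hl⟩, hPe.symm⟩

lemma isInertPrime_iff :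
    IsInertPrime E l ↔ ((Ideal.span {(l : ℤ)}).primesOver (𝓞 E)).ncard ≠ 2 := by
  constructor
  · intro hi h2
    obtain ⟨v, w, hvw, hv, hw⟩ := h.exists_pair hl h2
    have hu : ∃ u : HeightOneSpectrum (𝓞 E), u.asIdeal = Ideal.span {(l : 𝓞 E)} :=
      ⟨⟨_, hi, span_natCast_ne_bot' hl⟩, rfl⟩
    obtain ⟨u, hu⟩ := hu
    rw [natCast_mem_iff_dvd, ← hu] at hv hw
    exact hvw ((HeightOneSpectrum.eq_of_dvd hv).trans (HeightOneSpectrum.eq_of_dvd hw).symm)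
  · intro h2
    obtain ⟨v, hv⟩ := h.exists_inert hl hd h2
    rw [IsInertPrime, ← hv]
    exact v.isPrime

lemma ncard_eq_two_iff_isSquare (hl2 : l ≠ 2) :
    ((Ideal.span {(l : ℤ)}).primesOver (𝓞 E)).ncard = 2 ↔ IsSquare ((1 - 4 * c : ℤ) : ZMod l) := by
  have := Fact.mk hl
  have h20 : (2 : ZMod l) ≠ 0 := by
    intro h0
    have h3 : ((2 : ℕ) : ZMod l) = 0 := by exact_mod_cast h0
    rw [ZMod.natCast_eq_zero_iff] at h3
    exact hl2 ((Nat.prime_dvd_prime_iff_eq hl Nat.prime_two).1 h3)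
  rw [h.ncard_eq_two_iff hl hd]
  constructor
  · rintro ⟨z, hz⟩
    refine ⟨2 * z - 1, ?_⟩
    rw [← ZMod.intCast_zmod_eq_zero_iff_dvd] at hz
    push_cast at hz ⊢
    linear_combination (-4) * hz
  · rintro ⟨g, hg⟩
    obtain ⟨z, hz⟩ := ZMod.intCast_surjective ((g + 1) / 2)
    have hz2 : 2 * (z : ZMod l) = g + 1 := by rw [hz]; field_simp
    refine ⟨z, ?_⟩
    rw [← ZMod.intCast_zmod_eq_zero_iff_dvd]
    push_cast at hg ⊢
    have h4 : (2 : ZMod l) * 2 * (z ^ 2 - z + c) = 0 := by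
      linear_combination (2 * z + g + 1 - 2) * hz2 - hg
    simpa [h20] using h4

omit hd in
/-- The primes over `l` dividing `I`, if `l ∤ I`. -/
lemma exists_factorsOver_eq {I : Ideal (𝓞 E)} (hI : I ≠ ⊥)
    (hlI : ¬ Ideal.span {(l : 𝓞 E)} ∣ I) (hdvd : l ∣ Ideal.absNorm I) :
    ∃ v : HeightOneSpectrum (𝓞 E), factorsOver I l = {v} ∧ (l : 𝓞 E) ∈ v.asIdeal ∧
      v.asIdeal ∣ I ∧ Ideal.absNorm v.asIdeal = l ∧
      ordI v I = padicValNat l (Ideal.absNorm I) := by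
  obtain ⟨v, hv, hvI, hN, ho, hu⟩ := h.exists_unique_prime hl hI hlI hdvd
  refine ⟨v, ?_, hv, hvI, hN, ho⟩
  ext w
  simp only [factorsOver, Set.mem_ofPred_eq, Set.mem_singleton_iff]
  exact ⟨fun hw => hu w hw.1 hw.2, fun hw => hw ▸ ⟨hv, hvI⟩⟩

lemma factorsOver_mul_of_inert {I : Ideal (𝓞 E)} (hI : I ≠ ⊥) (hlI : ¬ l ∣ Ideal.absNorm I)
    (h2 : ((Ideal.span {(l : ℤ)}).primesOver (𝓞 E)).ncard ≠ 2) :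
    ∃ v : HeightOneSpectrum (𝓞 E), v.asIdeal = Ideal.span {(l : 𝓞 E)} ∧
      factorsOver (Ideal.span {(l : 𝓞 E)} * I) l = {v} ∧
      ordI v (Ideal.span {(l : 𝓞 E)} * I) = 1 := by
  obtain ⟨v, hv⟩ := h.exists_inert hl hd h2
  refine ⟨v, hv, ?_, ?_⟩
  · ext w
    simp only [factorsOver, Set.mem_ofPred_eq, Set.mem_singleton_iff]
    rw [natCast_mem_iff_dvd, ← hv]
    exact ⟨fun hw => HeightOneSpectrum.eq_of_dvd hw.1, fun hw => hw ▸ ⟨dvd_rfl, dvd_mul_right _ _⟩⟩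
  · rw [← hv, ordI_mul v v.ne_bot hI, ordI_self, ordI_eq_zero, add_zero]
    intro hvI
    refine hlI ?_
    have h3 := Ideal.absNorm_dvd_absNorm_of_le (Ideal.le_of_dvd hvI)
    exact (dvd_absNorm_of_mem hl (natCast_mem_iff_dvd.2 (by rw [hv]))).trans h3

omit hd in
lemma factorsOver_mul_of_split {I : Ideal (𝓞 E)}
    {v w : HeightOneSpectrum (𝓞 E)} (hv : (l : 𝓞 E) ∈ v.asIdeal) (hw : (l : 𝓞 E) ∈ w.asIdeal)
    (hvw : v ≠ w) : factorsOver (Ideal.span {(l : 𝓞 E)} * I) l = {v, w} := by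
  ext u
  simp only [factorsOver, Set.mem_ofPred_eq, Set.mem_insert_iff, Set.mem_singleton_iff]
  refine ⟨fun hu => (h.mul_eq_span_of_ne hl hv hw hvw).2.1 u hu.1, ?_⟩
  rintro (rfl | rfl)
  · exact ⟨hv, (natCast_mem_iff_dvd.1 hv).mul_right _⟩
  · exact ⟨hw, (natCast_mem_iff_dvd.1 hw).mul_right _⟩

omit hd in
lemma ordI_mul_of_split {I : Ideal (𝓞 E)} (hI : I ≠ ⊥)
    {v w : HeightOneSpectrum (𝓞 E)} (hv : (l : 𝓞 E) ∈ v.asIdeal) (hw : (l : 𝓞 E) ∈ w.asIdeal)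
    (hvw : v ≠ w) : ordI v (Ideal.span {(l : 𝓞 E)} * I) = 1 + ordI v I := by
  rw [ordI_mul v (span_natCast_ne_bot' hl) hI, ← (h.mul_eq_span_of_ne hl hv hw hvw).1,
    ordI_mul v v.ne_bot w.ne_bot, ordI_self, ordI_of_ne hvw]

/-- If `l` is the norm of `v` and unramified, there is a second prime above `l`. -/
lemma exists_ne {v : HeightOneSpectrum (𝓞 E)} (hv : (l : 𝓞 E) ∈ v.asIdeal)
    (hN : Ideal.absNorm v.asIdeal = l) :
    ∃ w : HeightOneSpectrum (𝓞 E), (l : 𝓞 E) ∈ w.asIdeal ∧ v ≠ w := by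
  have h2 : ((Ideal.span {(l : ℤ)}).primesOver (𝓞 E)).ncard = 2 := by
    by_contra h2
    obtain ⟨u, hu⟩ := h.exists_inert hl hd h2
    have hvu : v = u := HeightOneSpectrum.eq_of_dvd (by rw [hu]; exact natCast_mem_iff_dvd.1 hv)
    subst hvu
    have h3 := h.absNorm_span l 0
    simp only [Int.cast_natCast, Int.cast_zero, zero_mul, add_zero] at h3
    rw [← hu, hN] at h3
    have h4 : l = l ^ 2 := by
      conv_lhs => rw [h3]
      simp [Int.natAbs_pow]
    nlinarith [hl.one_lt]
  obtain ⟨w₁, w₂, hne, hw₁, hw₂⟩ := h.exists_pair hl h2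
  by_cases hv1 : v = w₁
  · exact ⟨w₂, hw₂, hv1 ▸ hne⟩
  · exact ⟨w₁, hw₁, hv1⟩

end QuadraticBasis

end Factors

open IsDedekindDomain

/-! ### The counting function ρ as a product over rational primes -/

section Count

set_option linter.unusedSectionVars false

variable {E L : Type*} [Field E] [NumberField E] [Field L] [NumberField L] [Algebra E L]

lemma finite_setOf_asIdeal_dvd {I : Ideal (𝓞 E)} (hI : I ≠ ⊥) :
    {v : HeightOneSpectrum (𝓞 E) | v.asIdeal ∣ I}.Finite := Ideal.finite_factors hI

lemma finite_primes_dvd {N : ℕ} (hN : N ≠ 0) : {l : Nat.Primes | (l : ℕ) ∣ N}.Finite :=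
  Set.Finite.of_finite_image (f := fun l : Nat.Primes => (l : ℕ))
    ((Nat.divisors N).finite_toSet.subset (by
      rintro _ ⟨l, hl, rfl⟩
      simpa [hN] using hl)) Subtype.val_injective.injOn

lemma finprod_factors {I : Ideal (𝓞 E)} (hI : I ≠ ⊥) (f : HeightOneSpectrum (𝓞 E) → ℕ) :
    ∏ v ∈ (finite_setOf_asIdeal_dvd hI).toFinset, f v =
      ∏ᶠ (l : Nat.Primes) (_ : (l : ℕ) ∣ Ideal.absNorm I), ∏ᶠ v ∈ factorsOver I l, f v := by
  classical
  have hN : Ideal.absNorm I ≠ 0 := by rwa [Ne, Ideal.absNorm_eq_zero_iff]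
  choose q hq hqv using fun v : HeightOneSpectrum (𝓞 E) => exists_prime_natCast_mem v
  rw [show (∏ᶠ (l : Nat.Primes) (_ : (l : ℕ) ∣ Ideal.absNorm I), ∏ᶠ v ∈ factorsOver I l, f v) =
    ∏ᶠ l ∈ {l : Nat.Primes | (l : ℕ) ∣ Ideal.absNorm I}, ∏ᶠ v ∈ factorsOver I l, f v from rfl,
    finprod_mem_eq_finite_toFinset_prod _ (finite_primes_dvd hN),
    ← Finset.prod_fiberwise_of_maps_to (g := fun v => (⟨q v, hq v⟩ : Nat.Primes))
      (t := (finite_primes_dvd hN).toFinset)]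
  · refine Finset.prod_congr rfl fun l _ => ?_
    rw [← finprod_mem_coe_finset]
    refine finprod_mem_congr ?_ fun _ _ => rfl
    ext v
    simp only [Finset.coe_filter, Set.Finite.mem_toFinset, factorsOver, Set.mem_ofPred_eq]
    refine ⟨fun hv => ⟨hv.2 ▸ hqv v, hv.1⟩, fun hv => ⟨hv.2, Subtype.ext ?_⟩⟩
    exact eq_of_natCast_mem (hq v) l.2 (hqv v) hv.1
  · intro v hv
    rw [Set.Finite.mem_toFinset] at hv
    exact (Set.Finite.mem_toFinset (finite_primes_dvd hN)).2 <| (dvd_absNorm_of_mem (hq v) (hqv v)).trans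
      (Ideal.absNorm_dvd_absNorm_of_le (Ideal.le_of_dvd hv))

namespace ReflexDatum

variable {D Dt : ℕ} {x y c : ℤ} {ω : 𝓞 E} {ξ ζ η : 𝓞 L} (h : ReflexDatum D Dt x y c ω ξ ζ η)
include h

/-- The exponents of J = I v₀⁻¹ are those of I, lowered by one at v₀. All primes involved are
unramified because 𝔡 does not divide I. -/
lemma normCount_eq_finprod {I J : Ideal (𝓞 E)} (hI : I ≠ ⊥) (hd : ¬ dIdeal ω D x ∣ I)
    {v₀ : HeightOneSpectrum (𝓞 E)} (hJ : I = v₀.asIdeal * J) [DecidableEq (HeightOneSpectrum (𝓞 E))] :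
    normCount (𝓞 L) J = ∏ᶠ (l : Nat.Primes) (_ : (l : ℕ) ∣ Ideal.absNorm I),
      ∏ᶠ v ∈ factorsOver I l,
        localCount (𝓞 L) v.asIdeal (if v = v₀ then ordI v I - 1 else ordI v I) := by
  have := h.isGalois
  have hJ0 : J ≠ ⊥ := by
    rintro rfl
    exact hI (by rw [hJ, Ideal.mul_bot])
  rw [← finprod_factors hI (fun v =>
    localCount (𝓞 L) v.asIdeal (if v = v₀ then ordI v I - 1 else ordI v I))]
  have hJS := eq_prod_pow_ordI hJ0 (finite_setOf_asIdeal_dvd hI).toFinset fun v hv => by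
    simpa using hv.trans (hJ ▸ dvd_mul_left _ _)
  rw [hJS, normCount_prod Gal(L/E) h.card_gal]
  · refine Finset.prod_congr rfl fun v hv => ?_
    congr 1
    have h1 := ordI_mul v v₀.ne_bot hJ0
    rw [← hJ] at h1
    split_ifs with hv0
    · subst hv0
      rw [h1, ordI_self]
      omega
    · rw [h1, ordI_of_ne hv0, zero_add]
  · intro v hv
    refine h.isGood fun h0 => hd ?_
    rw [← h0]
    simpa using hv

variable (L) in
lemma rho_eq_zero_and_eq {t : E} {I : Ideal (𝓞 E)}
    (ht : FractionalIdeal.spanSingleton (𝓞 E)⁰ t * (relDiscr E L : FractionalIdeal (𝓞 E)⁰ E) = I)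
    (v : HeightOneSpectrum (𝓞 E)) :
    (¬ v.asIdeal ∣ I → rho E L (FractionalIdeal.spanSingleton (𝓞 E)⁰ t *
        (relDiscr E L : FractionalIdeal (𝓞 E)⁰ E) *
        (v.asIdeal : FractionalIdeal (𝓞 E)⁰ E)⁻¹) = 0) ∧
    ∀ J, I = v.asIdeal * J → rho E L (FractionalIdeal.spanSingleton (𝓞 E)⁰ t *
        (relDiscr E L : FractionalIdeal (𝓞 E)⁰ E) *
        (v.asIdeal : FractionalIdeal (𝓞 E)⁰ E)⁻¹) = normCount (𝓞 L) J := by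
  have hv0 : (v.asIdeal : FractionalIdeal (𝓞 E)⁰ E) ≠ 0 :=
    FractionalIdeal.coeIdeal_ne_zero.2 v.ne_bot
  rw [ht]
  constructor
  · intro hv
    rw [rho, Nat.card_eq_zero]
    left
    refine ⟨fun ⟨A, hA⟩ => hv ⟨Ideal.relNorm (𝓞 E) A, ?_⟩⟩
    rw [eq_mul_inv_iff_mul_eq₀ hv0, ← FractionalIdeal.coeIdeal_mul,
      FractionalIdeal.coeIdeal_inj] at hA
    rw [← hA, mul_comm]
  · rintro J rfl
    rw [FractionalIdeal.coeIdeal_mul, mul_comm (v.asIdeal : FractionalIdeal (𝓞 E)⁰ E),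
      mul_inv_cancel_right₀ hv0, rho, normCount]
    simp only [FractionalIdeal.coeIdeal_inj]

/-- The value of `B_t(𝔭)`. -/
lemma Bterm_eq {t : E} {I : Ideal (𝓞 E)} (hI : I ≠ ⊥) (hd : ¬ dIdeal ω D x ∣ I)
    (ht : FractionalIdeal.spanSingleton (𝓞 E)⁰ t * (relDiscr E L : FractionalIdeal (𝓞 E)⁰ E) = I)
    (v : HeightOneSpectrum (𝓞 E)) :
    (¬ v.asIdeal ∣ I → Bterm E L t v = 0) ∧
    ∀ J, I = v.asIdeal * J → ¬ (v.asIdeal.primesOver (𝓞 L)).ncard = 2 →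
      Bterm E L t v = ((ordI v I : ℝ) + 1) * normCount (𝓞 L) J *
        Real.log (Ideal.absNorm v.asIdeal) := by
  obtain ⟨h1, h2⟩ := h.rho_eq_zero_and_eq L ht v
  constructor
  · intro hv
    rw [Bterm, h1 hv]
    simp
  · intro J hJ hs
    have hvd : v.asIdeal ≠ dIdeal ω D x := fun h0 => hd (h0 ▸ hJ ▸ dvd_mul_right _ _)
    have hδ0 : relDiscr E L ≠ ⊥ := h.relDiscr_eq ▸ h.dIdeal_ne_bot
    have hI0 : (I : FractionalIdeal (𝓞 E)⁰ E) ≠ 0 := FractionalIdeal.coeIdeal_ne_zero.2 hI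
    have ht0 : FractionalIdeal.spanSingleton (𝓞 E)⁰ t ≠ 0 := fun h0 => hI0 (by
      rw [← ht, h0, zero_mul])
    -- Since v ≠ 𝔡, the valuation of t at v is that of I = t𝔡.
    have hcount : FractionalIdeal.count E v (FractionalIdeal.spanSingleton (𝓞 E)⁰ t) =
        (ordI v I : ℤ) := by
      have h3 := FractionalIdeal.count_mul E v ht0 (FractionalIdeal.coeIdeal_ne_zero.2 hδ0)
      rw [ht, count_coeIdeal E v hI, count_coeIdeal E v hδ0, h.relDiscr_eq] at h3
      have h4 : ordI v (dIdeal ω D x) = 0 := by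
        have h5 := not_dvd_of_ne (v := v) (w := ⟨dIdeal ω D x, h.dIdeal_isPrime, h.dIdeal_ne_bot⟩)
          fun h0 => hvd (congrArg HeightOneSpectrum.asIdeal h0)
        exact ordI_eq_zero h5
      rw [h4] at h3
      simpa using h3.symm
    rw [Bterm, if_neg (show ¬ IsSplit E L v.asIdeal from hs), h2 J hJ, hcount]
    simp

end ReflexDatum

end Count

open IsDedekindDomain

/-! ### Local counts at the primes dividing m -/

section LocalFactor

set_option linter.unusedSectionVars false

/-- The common factor f cancels in the defining quotient, and the remaining denominator m₁² is prime
to l. -/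
lemma tOrd_eq {D Dt m n l : ℕ} (hl : l.Prime) (hD : D ≠ 0) {f m₁ k₁ : ℤ} (hf : f ≠ 0)
    (hm : (m : ℤ) = f * m₁) (hk : (n : ℤ) ^ 2 = (f * k₁) ^ 2) (hlm : ¬ (l : ℤ) ∣ m₁) {Q₁ : ℕ}
    (hQ : 4 * (D : ℤ) * Q₁ = m₁ ^ 2 * Dt - k₁ ^ 2) (hQ0 : Q₁ ≠ 0) :
    tOrd D Dt m n l = padicValNat l Q₁ := by
  have := Fact.mk hl
  have hm₁ : m₁ ≠ 0 := by
    rintro rfl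
    exact hlm (dvd_zero _)
  have h1 : ((m : ℚ) ^ 2 * Dt - (n : ℚ) ^ 2) / (4 * D * (m : ℚ) ^ 2) = (Q₁ : ℚ) / ((m₁ ^ 2 : ℤ) : ℚ) := by
    have e1 : (m : ℚ) = f * m₁ := by exact_mod_cast hm
    have e2 : (n : ℚ) ^ 2 = (f * k₁) ^ 2 := by exact_mod_cast hk
    have e3 : 4 * (D : ℚ) * Q₁ = m₁ ^ 2 * Dt - k₁ ^ 2 := by exact_mod_cast hQ
    have e4 : (D : ℚ) ≠ 0 := by exact_mod_cast hD
    have e5 : (f : ℚ) ≠ 0 := by exact_mod_cast hf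
    have e6 : (m₁ : ℚ) ≠ 0 := by exact_mod_cast hm₁
    rw [e1, e2]
    push_cast
    rw [div_eq_div_iff (by positivity) (by positivity)]
    linear_combination (-(f : ℚ) ^ 2 * m₁ ^ 2) * e3
  rw [tOrd, h1, padicValRat.div (by exact_mod_cast hQ0) (by exact_mod_cast pow_ne_zero 2 hm₁),
    padicValRat.of_int, padicValRat.of_nat, padicValInt.eq_zero_of_not_dvd]
  · simp
  · exact fun h0 => hlm ((Nat.prime_iff_prime_int.1 hl).dvd_of_dvd_pow h0)

variable {E L : Type*} [Field E] [NumberField E] [Field L] [NumberField L] [Algebra E L]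

lemma localCount_one (p : Ideal (𝓞 E)) [Decidable ((p.primesOver (𝓞 L)).ncard = 2)] :
    localCount (𝓞 L) p 1 = if (p.primesOver (𝓞 L)).ncard = 2 then 2 else 0 := by
  rw [localCount]
  split_ifs <;> simp_all

namespace ReflexDatum

variable {D Dt : ℕ} {x y c : ℤ} {ω : 𝓞 E} {ξ ζ η : 𝓞 L} (h : ReflexDatum D Dt x y c ω ξ ζ η)
include h

/-- Division of `m`, `k` and the numerator by a common prime factor `l`. -/
lemma exists_numerator_div {l : ℕ} (hl : l.Prime) (hl2 : l ≠ 2) (hlD : l ≠ D)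
    {m k e : ℤ} (hm : Squarefree m) (hlm : (l : ℤ) ∣ m) (he : 2 * e = m + k)
    (hk : (D : ℤ) ∣ 2 * k - m * x) (hkm : k ^ 2 < m ^ 2 * Dt) {I : Ideal (𝓞 E)}
    (hI : Ideal.span {(m : 𝓞 E) * ω - e} = I * dIdeal' ω D x) (hlI : l ∣ Ideal.absNorm I) :
    ∃ (m₁ k₁ e₁ : ℤ) (I₁ : Ideal (𝓞 E)), m = l * m₁ ∧ k = l * k₁ ∧ 2 * e₁ = m₁ + k₁ ∧
      ¬ (l : ℤ) ∣ m₁ ∧ (D : ℤ) ∣ 2 * k₁ - m₁ * x ∧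
      Ideal.span {(m₁ : 𝓞 E) * ω - e₁} = I₁ * dIdeal' ω D x ∧
      I = Ideal.span {(l : 𝓞 E)} * I₁ ∧
      4 * (D : ℤ) * Ideal.absNorm I₁ = m₁ ^ 2 * Dt - k₁ ^ 2 ∧ I₁ ≠ ⊥ := by
  have hlp := Nat.prime_iff_prime_int.1 hl
  have hl0 : (l : ℤ) ≠ 0 := hlp.ne_zero
  have hN := h.absNorm_numerator he hkm hI
  obtain ⟨m₁, rfl⟩ := hlm
  have hlk : (l : ℤ) ∣ k := by
    refine hlp.dvd_of_dvd_pow (n := 2) ?_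
    obtain ⟨q, hq⟩ := hlI
    exact ⟨l * m₁ ^ 2 * Dt - 4 * D * q, by rw [hq] at hN; push_cast at hN; linear_combination hN⟩
  obtain ⟨k₁, rfl⟩ := hlk
  have hl2' : ¬ (l : ℤ) ∣ 2 := fun h0 =>
    hl2 ((Nat.prime_dvd_prime_iff_eq hl Nat.prime_two).1 (by exact_mod_cast h0))
  obtain ⟨e₁, rfl⟩ := (hlp.dvd_or_dvd (show (l : ℤ) ∣ 2 * e from
    ⟨m₁ + k₁, by rw [he]; ring⟩)).resolve_left hl2'
  have he₁ : 2 * e₁ = m₁ + k₁ := mul_left_cancel₀ hl0 (by linear_combination he)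
  have hlm₁ : ¬ (l : ℤ) ∣ m₁ := fun ⟨q, hq⟩ => hlp.not_isUnit (hm l ⟨q, by rw [hq]; ring⟩)
  have hk₁ : (D : ℤ) ∣ 2 * k₁ - m₁ * x := by
    have hc : IsCoprime (D : ℤ) (l : ℤ) :=
      Nat.isCoprime_iff_coprime.2 ((Nat.coprime_primes h.prime hl).2 (Ne.symm hlD))
    refine hc.dvd_of_dvd_mul_left (?_ : (D : ℤ) ∣ l * (2 * k₁ - m₁ * x))
    convert hk using 1
    ring
  obtain ⟨I₁, hI₁⟩ := h.exists_numerator he₁ hk₁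
  have hkm₁ : k₁ ^ 2 < m₁ ^ 2 * Dt := by
    have h1 : (l : ℤ) ^ 2 * k₁ ^ 2 < l ^ 2 * (m₁ ^ 2 * Dt) := by
      calc (l : ℤ) ^ 2 * k₁ ^ 2 = (l * k₁) ^ 2 := by ring
        _ < _ := hkm
        _ = _ := by ring
    exact lt_of_mul_lt_mul_left h1 (by positivity)
  refine ⟨m₁, k₁, e₁, I₁, rfl, rfl, he₁, hlm₁, hk₁, hI₁, ?_, h.absNorm_numerator he₁ hkm₁ hI₁, ?_⟩
  · simpa using h.numerator_smul hI hI₁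
  · rintro rfl
    have := h.absNorm_numerator he₁ hkm₁ hI₁
    simp at this
    linarith

section

variable {l : ℕ} (hl : l.Prime) (hl2 : l ≠ 2) (hlD : l ≠ D) (hlDt : ¬ (l : ℤ) ∣ Dt)
  {m₁ k₁ e₁ : ℤ} {I₁ : Ideal (𝓞 E)} (he₁ : 2 * e₁ = m₁ + k₁) (hlm₁ : ¬ (l : ℤ) ∣ m₁)
  (hI₁ : Ideal.span {(m₁ : 𝓞 E) * ω - e₁} = I₁ * dIdeal' ω D x) (hI₁0 : I₁ ≠ ⊥)

-- With I₁ prime to l, every prime above l occurs in l I₁ with exponent one, and such a prime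
-- contributes 2 or 0 according as it splits or not.
include hl hlDt hI₁0 in
open Classical in
lemma finprod_localCount_of_not_dvd (hlI₁ : ¬ l ∣ Ideal.absNorm I₁) :
    ∏ᶠ v ∈ factorsOver (Ideal.span {(l : 𝓞 E)} * I₁) l,
      localCount (𝓞 L) v.asIdeal (ordI v (Ideal.span {(l : 𝓞 E)} * I₁)) =
    if ((Ideal.span {(l : ℤ)}).primesOver (𝓞 E)).ncard = 2 ∧
      ∀ v : HeightOneSpectrum (𝓞 E), (l : 𝓞 E) ∈ v.asIdeal →
        (v.asIdeal.primesOver (𝓞 L)).ncard = 2 then 4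
    else if ((Ideal.span {(l : ℤ)}).primesOver (𝓞 E)).ncard ≠ 2 ∧
      ((Ideal.span {(l : 𝓞 E)}).primesOver (𝓞 L)).ncard = 2 then 2 else 0 := by
  have hd : ¬ (l : ℤ) ∣ 1 - 4 * c := h.disc ▸ hlDt
  have hnd : ∀ v : HeightOneSpectrum (𝓞 E), (l : 𝓞 E) ∈ v.asIdeal → ¬ v.asIdeal ∣ I₁ :=
    fun v hv h0 => hlI₁ ((dvd_absNorm_of_mem hl hv).trans
      (Ideal.absNorm_dvd_absNorm_of_le (Ideal.le_of_dvd h0)))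
  by_cases h2 : ((Ideal.span {(l : ℤ)}).primesOver (𝓞 E)).ncard = 2
  · obtain ⟨v, w, hvw, hv, hw⟩ := h.basis.exists_pair hl h2
    rw [h.basis.factorsOver_mul_of_split hl hv hw hvw, finprod_mem_pair hvw,
      h.basis.ordI_mul_of_split hl hI₁0 hv hw hvw, h.basis.ordI_mul_of_split hl hI₁0 hw hv hvw.symm,
      ordI_eq_zero (hnd v hv), ordI_eq_zero (hnd w hw), localCount_one, localCount_one]
    have hall : (∀ u : HeightOneSpectrum (𝓞 E), (l : 𝓞 E) ∈ u.asIdeal →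
        (u.asIdeal.primesOver (𝓞 L)).ncard = 2) ↔ (v.asIdeal.primesOver (𝓞 L)).ncard = 2 ∧
          (w.asIdeal.primesOver (𝓞 L)).ncard = 2 := by
      refine ⟨fun hu => ⟨hu v hv, hu w hw⟩, fun hu u hul => ?_⟩
      rcases (h.basis.mul_eq_span_of_ne hl hv hw hvw).2.1 u hul with rfl | rfl
      exacts [hu.1, hu.2]
    rw [hall]
    simp only [h2, true_and, ne_eq, not_true_eq_false, false_and, if_false]
    split_ifs <;> simp_all
  · obtain ⟨v, hv, hf, ho⟩ := h.basis.factorsOver_mul_of_inert hl hd hI₁0 hlI₁ h2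
    rw [hf, finprod_mem_singleton, ho, localCount_one, hv]
    simp [h2]

-- Only one prime v above l divides I₁, so v occurs in l I₁ with exponent t_l + 1 and its conjugate
-- with exponent 1. The conjugate contributes 2 or 0, decided by the behaviour of v and of D modulo
-- l.
include hl hl2 hlD hlDt he₁ hlm₁ hI₁ hI₁0 in
open Classical in
lemma finprod_localCount_of_dvd (hN : 4 * (D : ℤ) * Ideal.absNorm I₁ = m₁ ^ 2 * Dt - k₁ ^ 2)
    (hlI₁ : l ∣ Ideal.absNorm I₁) :
    ∃ v : HeightOneSpectrum (𝓞 E), (l : 𝓞 E) ∈ v.asIdeal ∧ (m₁ : 𝓞 E) * ω - e₁ ∈ v.asIdeal ∧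
    ∏ᶠ v ∈ factorsOver (Ideal.span {(l : 𝓞 E)} * I₁) l,
      localCount (𝓞 L) v.asIdeal (ordI v (Ideal.span {(l : 𝓞 E)} * I₁)) =
    if IsSquare (D : ZMod l) then
      if (v.asIdeal.primesOver (𝓞 L)).ncard = 2 then 2 * (padicValNat l (Ideal.absNorm I₁) + 2) else 0
    else if (v.asIdeal.primesOver (𝓞 L)).ncard = 2 then 0
    else if Even (padicValNat l (Ideal.absNorm I₁)) then 0 else 2 := by
  have hd : ¬ (l : ℤ) ∣ 1 - 4 * c := h.disc ▸ hlDt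
  obtain ⟨v, hv, hvI, hNv, hov, huniq⟩ := h.basis.exists_unique_prime hl hI₁0
    (h.numerator_not_dvd hlm₁ hI₁) hlI₁
  obtain ⟨w, hw, hvw⟩ := h.basis.exists_ne hl hd hv hNv
  have hwI : ¬ w.asIdeal ∣ I₁ := fun h0 => hvw (huniq w hw h0).symm
  have hτ : (m₁ : 𝓞 E) * ω - e₁ ∈ v.asIdeal := by
    rw [← Ideal.dvd_span_singleton, hI₁]
    exact hvI.mul_right _
  have hτ' : (m₁ : 𝓞 E) * ω - e₁ ∉ w.asIdeal := by
    rw [← Ideal.dvd_span_singleton, hI₁]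
    intro h0
    rcases (HeightOneSpectrum.prime' w).dvd_or_dvd h0 with h1 | h1
    · exact hwI h1
    · have h3 : (D : 𝓞 E) ∈ w.asIdeal := Ideal.le_of_dvd h1 (Ideal.subset_span (by simp))
      exact hlD (eq_of_natCast_mem hl h.prime hw h3)
  have hsc := h.split_conj_iff hl hl2 hlD hlDt hv hw he₁ hlm₁ hτ hτ'
    (hN ▸ Dvd.dvd.mul_left (by exact_mod_cast hlI₁) _)
  refine ⟨v, hv, hτ, ?_⟩
  rw [h.basis.factorsOver_mul_of_split hl hv hw hvw, finprod_mem_pair hvw,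
    h.basis.ordI_mul_of_split hl hI₁0 hv hw hvw, h.basis.ordI_mul_of_split hl hI₁0 hw hv hvw.symm,
    ordI_eq_zero hwI, localCount_one, hov, localCount, if_congr hsc rfl rfl]
  by_cases hvs : (v.asIdeal.primesOver (𝓞 L)).ncard = 2 <;> by_cases hsq : IsSquare (D : ZMod l) <;>
    simp only [hvs, hsq, if_true, if_false, true_iff, false_iff, iff_self, not_true_eq_false, mul_zero]
  · ring
  · by_cases hev : Even (padicValNat l (Ideal.absNorm I₁)) <;> simp [Nat.even_add, hev]

end

end ReflexDatum

end LocalFactor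

open IsDedekindDomain NumberField

/-! ### Splitting in F and in M -/

section Splitting

set_option linter.unusedSectionVars false

variable {K : Type*} [Field K] [NumberField K] [NumberField.IsCMField K]

namespace CMData

variable {D Dt : ℕ} {s Δ : maximalRealSubfield K} {δ : K} {x y a b : ℤ}
  (h : CMData D Dt s Δ δ x y a b)
include h

lemma splitting_maximalRealSubfield {l : ℕ} (hl : l.Prime) (hl2 : l ≠ 2) (hlD : l ≠ D) :
    (SplitsCompletely (maximalRealSubfield K) l ↔ IsSquare (D : ZMod l)) ∧
    (IsInertPrime (maximalRealSubfield K) l ↔ ¬ IsSquare (D : ZMod l)) := by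
  obtain ⟨c, ω, hb, hc, -⟩ := exists_quadraticBasis h.finrank h.prime.squarefree h.prime.ne_one
    h.mod_four h.sq_s
  have hd : ¬ (l : ℤ) ∣ 1 - 4 * c := by
    rw [← hc]
    exact fun h0 => hlD ((Nat.prime_dvd_prime_iff_eq hl h.prime).1 (by exact_mod_cast h0))
  have h1 := hb.ncard_eq_two_iff_isSquare hl hd hl2
  rw [← hc, Int.cast_natCast] at h1
  refine ⟨?_, ?_⟩
  · rw [SplitsCompletely, h.finrank, h1]
  · rw [hb.isInertPrime_iff hl hd, Ne, h1]

variable {Φ : Finset (K →+* ℂ)} {σ₁ σ₂ : K →+* ℂ}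
  (h1 : σ₁ s = (Real.sqrt D : ℂ)) (h2 : σ₂ s = -(Real.sqrt D : ℂ))
  {c : ℤ} {ω : 𝓞 (tildeF Φ Dt)} {ξ ζ η : 𝓞 (reflexField Φ)}
  (hR : ReflexDatum D Dt x y c ω ξ ζ η)
  (hξ : ((algebraMap (𝓞 (reflexField Φ)) (reflexField Φ) ξ : _) : ℂ) = σ₁ δ + σ₂ δ)
include h1 h2 hR hξ

lemma splitting_galoisClosure {l : ℕ} (hl : l.Prime) (hl2 : l ≠ 2) (hlD : l ≠ D)
    (hlDt : ¬ (l : ℤ) ∣ Dt) :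
    SplitsCompletely (galoisClosure K) l ↔
      ((Ideal.span {(l : ℤ)}).primesOver (𝓞 (tildeF Φ Dt))).ncard = 2 ∧
      ∀ v : HeightOneSpectrum (𝓞 (tildeF Φ Dt)), (l : 𝓞 (tildeF Φ Dt)) ∈ v.asIdeal →
        (v.asIdeal.primesOver (𝓞 (reflexField Φ))).ncard = 2 := by
  let _ : Algebra (reflexField Φ) (galoisClosure K) :=
    (IntermediateField.inclusion (reflexField_le Φ)).toAlgebra
  let _ : Algebra (tildeF Φ Dt) (galoisClosure K) :=
    ((algebraMap (reflexField Φ) (galoisClosure K)).comp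
      (algebraMap (tildeF Φ Dt) (reflexField Φ))).toAlgebra
  have htower : IsScalarTower (tildeF Φ Dt) (reflexField Φ) (galoisClosure K) :=
    IsScalarTower.of_algebraMap_eq fun _ => rfl
  exact @ReflexDatum.splitsCompletely_iff _ _ (galoisClosure K) _ _ _ _ _ _ _ _ _ htower _ _ _ _ _ _ _ _ _ hR _ _ hl hl2 hlD hlDt
    fun g hg => h.eq_one_of_fixes_conjugates h1 h2 hξ g hg

end CMData

end Splitting

/-! ### Identification of the local factors -/

section Factor

set_option linter.unusedSectionVars false

variable {K : Type*} [Field K] [NumberField K] [NumberField.IsCMField K]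
  {D Dt : ℕ} {s Δ : maximalRealSubfield K} {δ : K} {x y a b : ℤ}
  (h : CMData D Dt s Δ δ x y a b) {Φ : Finset (K →+* ℂ)} {σ₁ σ₂ : K →+* ℂ}
  (h1 : σ₁ s = (Real.sqrt D : ℂ)) (h2 : σ₂ s = -(Real.sqrt D : ℂ))
  {c : ℤ} {ω : 𝓞 (tildeF Φ Dt)} {ξ ζ η : 𝓞 (reflexField Φ)}
  (hR : ReflexDatum D Dt x y c ω ξ ζ η)
  (hξ : ((algebraMap (𝓞 (reflexField Φ)) (reflexField Φ) ξ : _) : ℂ) = σ₁ δ + σ₂ δ)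
  {m n p : ℕ} {μ : ℤˣ} {e : ℤ} {I : Ideal (𝓞 (tildeF Φ Dt))}
  (hm : m ≠ 0) (hmsq : Squarefree m) (hmcop : Nat.Coprime m (2 * D * Dt * p)) (hp : p.Prime)
  (he : 2 * e = m + μ * n) (hk : (D : ℤ) ∣ 2 * (μ * n) - m * x)
  (hkm : ((μ : ℤ) * n) ^ 2 < (m : ℤ) ^ 2 * Dt)
  (hI : Ideal.span {((m : ℤ) : 𝓞 (tildeF Φ Dt)) * ω - e} = I * dIdeal' ω D x) (hI0 : I ≠ ⊥)
  (hT : ∃ T, IsTm D Dt s Δ m n μ T)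

lemma units_mul_sq (μ : ℤˣ) (n : ℤ) : ((μ : ℤ) * n) ^ 2 = n ^ 2 := by
  rw [mul_pow, ← Units.val_pow_eq_pow_val, Int.units_sq, Units.val_one, one_mul]

lemma ne_of_dvd_of_coprime {l : ℕ} (hl : l.Prime) (hmcop : Nat.Coprime m (2 * D * Dt * p))
    (hlm : l ∣ m) : l ≠ 2 ∧ l ≠ D ∧ ¬ (l : ℤ) ∣ Dt ∧ l ≠ p := by
  have key : ∀ q, l ∣ q → q ∣ 2 * D * Dt * p → False := fun q h1 h2 =>
    hl.one_lt.ne' (Nat.eq_one_of_dvd_coprimes hmcop hlm (h1.trans h2))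
  refine ⟨?_, ?_, fun h0 => ?_, ?_⟩
  · rintro rfl
    exact key 2 dvd_rfl ⟨D * Dt * p, by ring⟩
  · rintro rfl
    exact key l dvd_rfl ⟨2 * Dt * p, by ring⟩
  · exact key Dt (by exact_mod_cast h0) ⟨2 * D * p, by ring⟩
  · rintro rfl
    exact key l dvd_rfl ⟨2 * D * Dt, by ring⟩

include h hR hm he hk hkm hI hT in
/-- The local form of `T_m(μ n)` at the primes not dividing `m`. -/
lemma local_form_of_not_dvd {l : ℕ} [Fact l.Prime] (hlm : ¬ l ∣ m) (hlQ : l ∣ Ideal.absNorm I) :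
    (∃ α : ℤ_[l]ˣ, IsEquivDiag l (Tm D Dt s Δ m n μ) α) ∧
    tOrd D Dt m n l = padicValNat l (Ideal.absNorm I) ∧
    ∃ v : HeightOneSpectrum (𝓞 (tildeF Φ Dt)), factorsOver I l = {v} ∧
      (l : 𝓞 (tildeF Φ Dt)) ∈ v.asIdeal ∧ v.asIdeal ∣ I ∧ Ideal.absNorm v.asIdeal = l ∧
      ordI v I = padicValNat l (Ideal.absNorm I) ∧
      ∀ α : ℤ_[l]ˣ, IsEquivDiag l (Tm D Dt s Δ m n μ) α →
        ((v.asIdeal.primesOver (𝓞 (reflexField Φ))).ncard = 2 ↔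
          hilbertSymbol l (-((α : ℤ_[l]) : ℚ_[l])) l = 1) := by
  have hl : l.Prime := Fact.out
  have hlm' : ¬ (l : ℤ) ∣ m := by exact_mod_cast hlm
  have hN := hR.absNorm_numerator he hkm hI
  have hN0 : Ideal.absNorm I ≠ 0 := by
    intro h0
    rw [h0] at hN
    simp only [CharP.cast_eq_zero, mul_zero] at hN
    linarith
  have hI0 : I ≠ ⊥ := by rwa [Ne, Ideal.absNorm_eq_zero_iff] at hN0
  obtain ⟨v, hv1, hv, hvI, hvN, hvo⟩ := hR.basis.exists_factorsOver_eq hl hI0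
    (hR.numerator_not_dvd hlm' hI) hlQ
  obtain ⟨ha, hs⟩ := hR.isEquivDiag_and_split_iff (by exact_mod_cast h.sq_s) h.two_Δ
    (isTm_Tm hT) hm (f := 1) (one_mul _).symm (one_mul _).symm hlm' hk hN
    (by exact_mod_cast hlQ)
  refine ⟨ha, ?_, v, hv1, hv, hvI, hvN, hvo, fun α hα => hs α hα e v he hv ?_⟩
  · exact tOrd_eq hl h.prime.ne_zero one_ne_zero (one_mul _).symm
      (by rw [one_mul, units_mul_sq]) hlm' hN hN0
  · rw [← Ideal.dvd_span_singleton, hI]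
    exact hvI.mul_right _

-- For l ∣ m the factor l is removed from m, k and I; it occurs only once in m because m is
-- squarefree. The diagonal form is asserted only if l still divides the norm of I₁, which is the
-- case t_l > 0.
include h hR hm he hk hkm hI hT hmsq hmcop in
lemma local_form_of_dvd {l : ℕ} [Fact l.Prime] (hlm : l ∣ m) (hlQ : l ∣ Ideal.absNorm I) :
    ∃ (m₁ k₁ e₁ : ℤ) (I₁ : Ideal (𝓞 (tildeF Φ Dt))), 2 * e₁ = m₁ + k₁ ∧ ¬ (l : ℤ) ∣ m₁ ∧
      Ideal.span {(m₁ : 𝓞 (tildeF Φ Dt)) * ω - e₁} = I₁ * dIdeal' ω D x ∧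
      I = Ideal.span {(l : 𝓞 (tildeF Φ Dt))} * I₁ ∧
      4 * (D : ℤ) * Ideal.absNorm I₁ = m₁ ^ 2 * Dt - k₁ ^ 2 ∧ I₁ ≠ ⊥ ∧
      tOrd D Dt m n l = padicValNat l (Ideal.absNorm I₁) ∧
      (l ∣ Ideal.absNorm I₁ → (∃ α : ℤ_[l]ˣ, IsEquivDiag l (Tm D Dt s Δ m n μ) α) ∧
        ∀ α : ℤ_[l]ˣ, IsEquivDiag l (Tm D Dt s Δ m n μ) α →
        ∀ v : HeightOneSpectrum (𝓞 (tildeF Φ Dt)), (l : 𝓞 (tildeF Φ Dt)) ∈ v.asIdeal →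
          (m₁ : 𝓞 (tildeF Φ Dt)) * ω - e₁ ∈ v.asIdeal →
          ((v.asIdeal.primesOver (𝓞 (reflexField Φ))).ncard = 2 ↔
            hilbertSymbol l (-((α : ℤ_[l]) : ℚ_[l])) l = 1)) := by
  have hl : l.Prime := Fact.out
  obtain ⟨hl2, hlD, hlDt, hlp⟩ := ne_of_dvd_of_coprime hl hmcop hlm
  obtain ⟨m₁, k₁, e₁, I₁, hm₁, hk₁, he₁, hlm₁, hDk, hI₁, hII, hN, hI₁0⟩ :=
    hR.exists_numerator_div hl hl2 hlD (Int.squarefree_natCast.2 hmsq) (by exact_mod_cast hlm)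
      he hk hkm hI hlQ
  refine ⟨m₁, k₁, e₁, I₁, he₁, hlm₁, hI₁, hII, hN, hI₁0, ?_, fun hd => ?_⟩
  · exact tOrd_eq hl h.prime.ne_zero (by exact_mod_cast hl.ne_zero) hm₁
      (by rw [← hk₁, units_mul_sq]) hlm₁ hN (by rwa [Ne, Ideal.absNorm_eq_zero_iff])
  · obtain ⟨ha, hs⟩ := hR.isEquivDiag_and_split_iff (by exact_mod_cast h.sq_s) h.two_Δ
      (isTm_Tm hT) hm hm₁ hk₁ hlm₁ hDk hN (by exact_mod_cast hd)
    exact ⟨ha, fun α hα v hv hτ => hs α hα e₁ v he₁ hv hτ⟩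

include h hR hm he hk hkm hI hT hmsq hmcop in
lemma exists_isEquivDiag {l : ℕ} [Fact l.Prime] (hlQ : l ∣ Ideal.absNorm I)
    (hlt : ¬ l ∣ m ∨ 0 < tOrd D Dt m n l) :
    ∃ α : ℤ_[l]ˣ, IsEquivDiag l (Tm D Dt s Δ m n μ) α := by
  by_cases hlm : l ∣ m
  · obtain ⟨m₁, k₁, e₁, I₁, -, -, -, -, -, -, ht, hα⟩ :=
      local_form_of_dvd h hR hm hmsq hmcop he hk hkm hI hT hlm hlQ
    refine (hα ?_).1
    have h3 := hlt.resolve_left (not_not.2 hlm)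
    rw [ht] at h3
    exact dvd_of_one_le_padicValNat (by exact_mod_cast h3)
  · exact (local_form_of_not_dvd h hR hm he hk hkm hI hT hlm hlQ).1

include h h1 h2 hR hξ hm he hk hkm hI hT hmsq hmcop in
open Classical in
/-- The local factor at a prime `l ≠ p`. -/
lemma localFactor_of_ne {l : ℕ} [Fact l.Prime] (hlQ : l ∣ Ideal.absNorm I) (hlp : l ≠ p)
    (α : ℤ_[l]ˣ) (hα : (¬ l ∣ m ∨ 0 < tOrd D Dt m n l) → IsEquivDiag l (Tm D Dt s Δ m n μ) α) :
    localFactor Φ D Dt m p n l (hilbertSymbol l (-((α : ℤ_[l]) : ℚ_[l])) l) =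
      ((∏ᶠ v ∈ factorsOver I l, localCount (𝓞 (reflexField Φ)) v.asIdeal (ordI v I) : ℕ) : ℚ) := by
  have hl : l.Prime := Fact.out
  by_cases hlm : l ∣ m
  · obtain ⟨hl2, hlD, hlDt, -⟩ := ne_of_dvd_of_coprime hl hmcop hlm
    obtain ⟨m₁, k₁, e₁, I₁, he₁, hlm₁, hI₁, rfl, hN, hI₁0, ht, hβ⟩ :=
      local_form_of_dvd h hR hm hmsq hmcop he hk hkm hI hT hlm hlQ
    have hN0 : Ideal.absNorm I₁ ≠ 0 := by rwa [Ne, Ideal.absNorm_eq_zero_iff]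
    by_cases hd : l ∣ Ideal.absNorm I₁
    · have hpos : 0 < padicValNat l (Ideal.absNorm I₁) := one_le_padicValNat_of_dvd hN0 hd
      obtain ⟨v, hv, hτ, hprod⟩ :=
        hR.finprod_localCount_of_dvd hl hl2 hlD hlDt he₁ hlm₁ hI₁ hI₁0 hN hd
      obtain ⟨hF1, hF2⟩ := h.splitting_maximalRealSubfield hl hl2 hlD
      rw [hprod, if_congr ((hβ hd).2 α (hα (Or.inr (by rw [ht]; exact_mod_cast hpos))) v hv hτ) rfl rfl,
        if_congr ((hβ hd).2 α (hα (Or.inr (by rw [ht]; exact_mod_cast hpos))) v hv hτ) rfl rfl,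
        localFactor, if_neg (not_not.2 hlm), ht, if_neg (by exact_mod_cast hpos.ne'),
        if_congr hF1 rfl rfl, if_congr hF2 rfl rfl, zpow_natCast]
      rcases hilbertSymbol_eq_one_or (l := l) (-((α : ℤ_[l]) : ℚ_[l])) l with h0 | h0 <;>
        by_cases hsq : IsSquare (D : ZMod l) <;>
        rcases Nat.even_or_odd (padicValNat l (Ideal.absNorm I₁)) with hev | hev <;>
        simp [h0, hsq, hev, hev.neg_one_pow, Nat.not_even_iff_odd.2]
      all_goals norm_num
    · have ht0 : padicValNat l (Ideal.absNorm I₁) = 0 := padicValNat.eq_zero_of_not_dvd hd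
      have hd4 : ¬ (l : ℤ) ∣ 1 - 4 * c := hR.disc ▸ hlDt
      have hsplit : IsInertPrime (tildeF Φ Dt) l ∧
          IsSplit (tildeF Φ Dt) (reflexField Φ) (Ideal.span {(l : 𝓞 (tildeF Φ Dt))}) ↔
          ((Ideal.span {(l : ℤ)}).primesOver (𝓞 (tildeF Φ Dt))).ncard ≠ 2 ∧
            ((Ideal.span {(l : 𝓞 (tildeF Φ Dt))}).primesOver (𝓞 (reflexField Φ))).ncard = 2 :=
        and_congr (hR.basis.isInertPrime_iff hl hd4) Iff.rfl
      rw [hR.finprod_localCount_of_not_dvd hl hlDt hI₁0 hd,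
        localFactor, if_neg (not_not.2 hlm), ht, ht0, if_pos (by simp),
        if_congr (h.splitting_galoisClosure h1 h2 hR hξ hl hl2 hlD hlDt) rfl rfl,
        if_congr hsplit rfl rfl]
      push_cast
      rfl
  · obtain ⟨-, ht, v, hv1, -, -, -, hvo, hvα⟩ :=
      local_form_of_not_dvd h hR hm he hk hkm hI hT hlm hlQ
    rw [hv1, finprod_mem_singleton, hvo, localCount, if_congr (hvα α (hα (Or.inl hlm))) rfl rfl,
      localFactor, if_pos hlm, if_neg hlp, ht, zpow_natCast]
    split_ifs with h3 h4
    · simp only [Nat.cast_add, Nat.cast_one, Int.cast_natCast]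
    · rw [h4.neg_one_pow]; norm_num
    · rw [(Nat.not_even_iff_odd.1 h4).neg_one_pow]; norm_num

include h hR hm he hk hkm hI hT hmcop hp in
open Classical in
/-- The local factor at `p`. -/
lemma localFactor_self [Fact p.Prime] (hlQ : p ∣ Ideal.absNorm I) :
    ∃ v₀ : HeightOneSpectrum (𝓞 (tildeF Φ Dt)), factorsOver I p = {v₀} ∧
      (p : 𝓞 (tildeF Φ Dt)) ∈ v₀.asIdeal ∧
      Ideal.absNorm v₀.asIdeal = p ∧ v₀.asIdeal ∣ I ∧
      ordI v₀ I = padicValNat p (Ideal.absNorm I) ∧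
      ∀ α : ℤ_[p]ˣ, IsEquivDiag p (Tm D Dt s Δ m n μ) α →
        localFactor Φ D Dt m p n p (hilbertSymbol p (-((α : ℤ_[p]) : ℚ_[p])) p) =
          if (v₀.asIdeal.primesOver (𝓞 (reflexField Φ))).ncard = 2 then 0 else
          (localCount (𝓞 (reflexField Φ)) v₀.asIdeal (ordI v₀ I - 1) : ℚ) := by
  have hpm : ¬ p ∣ m := fun h0 => (ne_of_dvd_of_coprime hp hmcop h0).2.2.2 rfl
  have hN := hR.absNorm_numerator he hkm hI
  have hN0 : Ideal.absNorm I ≠ 0 := by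
    intro h0
    rw [h0] at hN
    simp only [CharP.cast_eq_zero, mul_zero] at hN
    linarith
  obtain ⟨-, ht, v, hv1, hv, hvI, hvN, hvo, hvα⟩ :=
      local_form_of_not_dvd h hR hm he hk hkm hI hT hpm hlQ
  refine ⟨v, hv1, hv, hvN, hvI, hvo, fun α hα => ?_⟩
  have hpos : 0 < padicValNat p (Ideal.absNorm I) := one_le_padicValNat_of_dvd hN0 hlQ
  -- The exponent at v₀ is positive, so nothing is truncated in k = ord − 1. For non-split v₀, (1 −
  -- (−1)^(k + 1))/2 is 1 exactly when k is even.
  obtain ⟨k, hk⟩ : ∃ k, padicValNat p (Ideal.absNorm I) = k + 1 := ⟨_, (Nat.sub_add_cancel hpos).symm⟩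
  rw [localFactor, if_pos hpm, if_pos rfl, ht, hvo, localCount, zpow_natCast, hk, Nat.add_sub_cancel]
  by_cases h3 : (v.asIdeal.primesOver (𝓞 (reflexField Φ))).ncard = 2
  · rw [(hvα α hα).1 h3]
    simp [h3]
  · have h4 := (hilbertSymbol_eq_one_or (l := p) (-((α : ℤ_[p]) : ℚ_[p])) p).resolve_left
      (mt (hvα α hα).2 h3)
    rw [h4]
    rcases Nat.even_or_odd k with hev | hev
    · simp [h3, hev, hev.neg_one_pow, pow_succ]
    · simp [h3, hev.neg_one_pow, pow_succ, Nat.not_even_iff_odd.2 hev]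

end Factor

open IsDedekindDomain NumberField

/-! ### The contribution of a single t -/

section Factor

set_option linter.unusedSectionVars false

variable {K : Type*} [Field K] [NumberField K] [NumberField.IsCMField K]
  {D Dt : ℕ} {s Δ : maximalRealSubfield K} {δ : K} {x y a b : ℤ}
  (h : CMData D Dt s Δ δ x y a b) {Φ : Finset (K →+* ℂ)} {σ₁ σ₂ : K →+* ℂ}
  (h1 : σ₁ s = (Real.sqrt D : ℂ)) (h2 : σ₂ s = -(Real.sqrt D : ℂ))
  {c : ℤ} {ω : 𝓞 (tildeF Φ Dt)} {ξ ζ η : 𝓞 (reflexField Φ)}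
  (hR : ReflexDatum D Dt x y c ω ξ ζ η)
  (hξ : ((algebraMap (𝓞 (reflexField Φ)) (reflexField Φ) ξ : _) : ℂ) = σ₁ δ + σ₂ δ)
  {m n p : ℕ} {μ : ℤˣ} {e : ℤ} {I : Ideal (𝓞 (tildeF Φ Dt))}
  (hm : m ≠ 0) (hmsq : Squarefree m) (hmcop : Nat.Coprime m (2 * D * Dt * p)) (hp : p.Prime)
  (he : 2 * e = m + μ * n) (hk : (D : ℤ) ∣ 2 * (μ * n) - m * x)
  (hkm : ((μ : ℤ) * n) ^ 2 < (m : ℤ) ^ 2 * Dt)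
  (hI : Ideal.span {((m : ℤ) : 𝓞 (tildeF Φ Dt)) * ω - e} = I * dIdeal' ω D x) (hI0 : I ≠ ⊥)
  (hT : ∃ T, IsTm D Dt s Δ m n μ T)

include h h1 h2 hR hξ hm he hk hkm hI hT hmsq hmcop hp in
/-- The number of ideals with norm `I v₀⁻¹`, where `v₀` is the prime divisor of `I` above `p`. -/
lemma finprod_localFactor (hpI : p ∣ Ideal.absNorm I) (α : ∀ l : Nat.Primes, ℤ_[(l : ℕ)]ˣ)
    (hα : ∀ l : Nat.Primes, (l : ℕ) ∣ Ideal.absNorm I → (¬ (l : ℕ) ∣ m ∨ 0 < tOrd D Dt m n l) →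
      IsEquivDiag l (Tm D Dt s Δ m n μ) (α l)) :
    ∃ (v₀ : HeightOneSpectrum (𝓞 (tildeF Φ Dt))) (J : Ideal (𝓞 (tildeF Φ Dt))),
      factorsOver I p = {v₀} ∧ (p : 𝓞 (tildeF Φ Dt)) ∈ v₀.asIdeal ∧
      Ideal.absNorm v₀.asIdeal = p ∧ I = v₀.asIdeal * J ∧
      ordI v₀ I = padicValNat p (Ideal.absNorm I) ∧
      ((v₀.asIdeal.primesOver (𝓞 (reflexField Φ))).ncard = 2 →
        ∏ᶠ (l : Nat.Primes) (_ : (l : ℕ) ∣ Ideal.absNorm I), localFactor Φ D Dt m p n l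
          (hilbertSymbol l (-((α l : ℤ_[(l : ℕ)]) : ℚ_[(l : ℕ)])) ((l : ℕ) : ℚ_[(l : ℕ)])) = 0) ∧
      (¬ (v₀.asIdeal.primesOver (𝓞 (reflexField Φ))).ncard = 2 →
        ∏ᶠ (l : Nat.Primes) (_ : (l : ℕ) ∣ Ideal.absNorm I), localFactor Φ D Dt m p n l
          (hilbertSymbol l (-((α l : ℤ_[(l : ℕ)]) : ℚ_[(l : ℕ)])) ((l : ℕ) : ℚ_[(l : ℕ)])) =
          normCount (𝓞 (reflexField Φ)) J) := by
  classical
  set P : Nat.Primes := ⟨p, hp⟩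
  have hpm : ¬ p ∣ m := fun h0 => (ne_of_dvd_of_coprime hp hmcop h0).2.2.2 rfl
  obtain ⟨v₀, hf, hv₀, hN, hv₀I, ho, hself⟩ :=
    @localFactor_self K _ _ _ D Dt s Δ δ x y a b h Φ c ω ξ ζ η hR m n p μ e I hm hmcop hp he hk hkm
      hI hT (factPrime P) hpI
  have hI0 : I ≠ ⊥ := by
    rintro rfl
    have := hR.absNorm_numerator he hkm hI
    simp only [Ideal.absNorm_bot, CharP.cast_eq_zero, mul_zero] at this
    linarith
  have hNI : Ideal.absNorm I ≠ 0 := by rwa [Ne, Ideal.absNorm_eq_zero_iff]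
  have hDm : ¬ (D : ℤ) ∣ m := fun h0 =>
    (ne_of_dvd_of_coprime h.prime hmcop (by exact_mod_cast h0)).2.1 rfl
  have hloc := hself (α P) (hα P hpI (Or.inl hpm))
  have hprod : ∀ f : Nat.Primes → ℚ, ∏ᶠ (l : Nat.Primes) (_ : (l : ℕ) ∣ Ideal.absNorm I), f l =
      ∏ l ∈ (finite_primes_dvd hNI).toFinset, f l := fun f =>
    finprod_mem_eq_finite_toFinset_prod f (finite_primes_dvd hNI)
  have hprodN : ∀ f : Nat.Primes → ℕ, ∏ᶠ (l : Nat.Primes) (_ : (l : ℕ) ∣ Ideal.absNorm I), f l =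
      ∏ l ∈ (finite_primes_dvd hNI).toFinset, f l := fun f =>
    finprod_mem_eq_finite_toFinset_prod f (finite_primes_dvd hNI)
  have hPmem : P ∈ (finite_primes_dvd hNI).toFinset :=
    (Set.Finite.mem_toFinset (finite_primes_dvd hNI)).2 hpI
  obtain ⟨J, hJ⟩ := hv₀I
  refine ⟨v₀, J, hf, hv₀, hN, hJ, ho, fun hs => ?_, fun hs => ?_⟩
  · rw [hprod]
    refine Finset.prod_eq_zero hPmem ?_
    rw [if_pos hs] at hloc
    exact hloc
  · rw [if_neg hs] at hloc
    rw [hR.normCount_eq_finprod hI0 (hR.numerator_dIdeal_not_dvd hDm hI) hJ, hprod, hprodN,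
      Nat.cast_prod]
    refine Finset.prod_congr rfl fun l hl => ?_
    have hlI : (l : ℕ) ∣ Ideal.absNorm I := (Set.Finite.mem_toFinset (finite_primes_dvd hNI)).1 hl
    by_cases hlp : (l : ℕ) = p
    · obtain rfl : l = P := Subtype.ext hlp
      refine hloc.trans ?_
      rw [show factorsOver I (P : ℕ) = {v₀} from hf, finprod_mem_singleton, if_pos rfl]
    · rw [localFactor_of_ne h h1 h2 hR hξ hm hmsq hmcop he hk hkm hI hT hlI hlp (α l) (hα l hlI)]
      congr 1
      refine finprod_mem_congr rfl fun v hv => ?_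
      rw [if_neg]
      rintro rfl
      exact hlp (eq_of_natCast_mem l.2 hp hv.1 hv₀)

variable {t : tildeF Φ Dt} (ht : FractionalIdeal.spanSingleton (𝓞 (tildeF Φ Dt))⁰ t *
    (relDiscr (tildeF Φ Dt) (reflexField Φ) : FractionalIdeal (𝓞 (tildeF Φ Dt))⁰ (tildeF Φ Dt)) = I)

include hR ht hp hI hmcop hI0 in
lemma finsum_Bterm_of_not_dvd (hpI : ¬ p ∣ Ideal.absNorm I) :
    ∑ᶠ (v : HeightOneSpectrum (𝓞 (tildeF Φ Dt))) (_ : (p : 𝓞 (tildeF Φ Dt)) ∈ v.asIdeal),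
      Bterm (tildeF Φ Dt) (reflexField Φ) t v = 0 := by
  have hDm : ¬ (D : ℤ) ∣ m := fun h0 =>
    (ne_of_dvd_of_coprime hR.prime hmcop (by exact_mod_cast h0)).2.1 rfl
  refine finsum_mem_eq_zero_of_forall_eq_zero fun v hv => ?_
  refine (hR.Bterm_eq hI0 (hR.numerator_dIdeal_not_dvd hDm hI) ht v).1 fun h0 => hpI ?_
  exact (dvd_absNorm_of_mem hp hv).trans (Ideal.absNorm_dvd_absNorm_of_le (Ideal.le_of_dvd h0))

-- Among the primes above p only v₀ divides I, so a single term survives. If v₀ splits, the term and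
-- the factor at p both vanish.
include h h1 h2 hR hξ hm he hk hkm hI hT hmsq hmcop hp ht hI0 in
lemma finsum_Bterm_of_dvd (hpI : p ∣ Ideal.absNorm I) (α : ∀ l : Nat.Primes, ℤ_[(l : ℕ)]ˣ)
    (hα : ∀ l : Nat.Primes, (l : ℕ) ∣ Ideal.absNorm I → (¬ (l : ℕ) ∣ m ∨ 0 < tOrd D Dt m n l) →
      IsEquivDiag l (Tm D Dt s Δ m n μ) (α l)) :
    ∑ᶠ (v : HeightOneSpectrum (𝓞 (tildeF Φ Dt))) (_ : (p : 𝓞 (tildeF Φ Dt)) ∈ v.asIdeal),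
      Bterm (tildeF Φ Dt) (reflexField Φ) t v =
    ((((padicValNat p (Ideal.absNorm I) : ℚ) + 1) *
      ∏ᶠ (l : Nat.Primes) (_ : (l : ℕ) ∣ Ideal.absNorm I), localFactor Φ D Dt m p n l
          (hilbertSymbol l (-((α l : ℤ_[(l : ℕ)]) : ℚ_[(l : ℕ)])) ((l : ℕ) : ℚ_[(l : ℕ)])) : ℚ) : ℝ) *
      Real.log p := by
  obtain ⟨v₀, J, hf, hv₀, hN, hJ, ho, hs, hns⟩ :=
    finprod_localFactor h h1 h2 hR hξ hm hmsq hmcop hp he hk hkm hI hT hpI α hα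
  have hDm : ¬ (D : ℤ) ∣ m := fun h0 =>
    (ne_of_dvd_of_coprime hR.prime hmcop (by exact_mod_cast h0)).2.1 rfl
  have hB := hR.Bterm_eq hI0 (hR.numerator_dIdeal_not_dvd hDm hI) ht
  rw [finsum_eq_single _ v₀, finsum_eq_single _ hv₀]
  · by_cases h3 : (v₀.asIdeal.primesOver (𝓞 (reflexField Φ))).ncard = 2
    · rw [hs h3, Bterm, if_pos (show IsSplit _ _ _ from h3)]
      simp
    · rw [hns h3, (hB v₀).2 J hJ h3, ho, hN]
      push_cast
      ring
  · intro h3 h4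
    exact absurd rfl h4
  · intro v hv
    refine (finsum_congr fun hpv => (hB v).1 fun hvI => hv ?_).trans finsum_zero
    have h4 : v ∈ factorsOver I p := ⟨hpv, hvI⟩
    rwa [hf] at h4

end Factor

open IsDedekindDomain NumberField

/-! ### The condition t ∈ d⁻¹ -/

section Numerator

set_option linter.unusedSectionVars false

variable {E L : Type*} [Field E] [NumberField E] [Field L] [NumberField L] [Algebra E L]

namespace ReflexDatum

variable {D Dt : ℕ} {x y c : ℤ} {ω : 𝓞 E} {ξ ζ η : 𝓞 L} (h : ReflexDatum D Dt x y c ω ξ ζ η)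
include h

lemma cast_D_ne_zero : (D : E) ≠ 0 := by exact_mod_cast h.prime.ne_zero

/-- `t d = 𝔞` for `t = ± (m r - k) / (2 D)`. -/
lemma spanSingleton_mul_relDiscr {m e : ℤ} {u : ℤˣ} {I : Ideal (𝓞 E)}
    (hI : Ideal.span {(m : 𝓞 E) * ω - e} = I * dIdeal' ω D x) {t : E}
    (ht : t * D = u * algebraMap (𝓞 E) E ((m : 𝓞 E) * ω - e)) :
    FractionalIdeal.spanSingleton (𝓞 E)⁰ t * (relDiscr E L : FractionalIdeal (𝓞 E)⁰ E) = I := by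
  have hD0 : FractionalIdeal.spanSingleton (𝓞 E)⁰ (D : E) ≠ 0 := by
    rw [Ne, FractionalIdeal.spanSingleton_eq_zero_iff]
    exact h.cast_D_ne_zero
  have hu : FractionalIdeal.spanSingleton (𝓞 E)⁰ ((u : ℤ) : E) = 1 := by
    rcases Int.units_eq_one_or u with rfl | rfl
    · simp
    · rw [show (((-1 : ℤˣ) : ℤ) : E) = algebraMap (𝓞 E) E (-1) by simp,
        ← FractionalIdeal.coeIdeal_span_singleton, Ideal.span_singleton_neg, Ideal.span_singleton_one,
        FractionalIdeal.coeIdeal_top]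
  have h1 : FractionalIdeal.spanSingleton (𝓞 E)⁰ t * FractionalIdeal.spanSingleton (𝓞 E)⁰ (D : E) =
      (I : FractionalIdeal (𝓞 E)⁰ E) * (dIdeal' ω D x : FractionalIdeal (𝓞 E)⁰ E) := by
    rw [FractionalIdeal.spanSingleton_mul_spanSingleton, ht,
      ← FractionalIdeal.spanSingleton_mul_spanSingleton, hu, one_mul,
      ← FractionalIdeal.coeIdeal_span_singleton, hI, FractionalIdeal.coeIdeal_mul]
  have h2 : (dIdeal ω D x : FractionalIdeal (𝓞 E)⁰ E) * (dIdeal' ω D x : FractionalIdeal (𝓞 E)⁰ E) =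
      FractionalIdeal.spanSingleton (𝓞 E)⁰ (D : E) := by
    rw [← FractionalIdeal.coeIdeal_mul, h.dIdeal_mul, FractionalIdeal.coeIdeal_span_singleton]
    simp
  rw [h.relDiscr_eq]
  refine mul_right_cancel₀ hD0 ?_
  calc _ = (FractionalIdeal.spanSingleton (𝓞 E)⁰ t * FractionalIdeal.spanSingleton (𝓞 E)⁰ (D : E)) *
        (dIdeal ω D x : FractionalIdeal (𝓞 E)⁰ E) := by ring
    _ = (I : FractionalIdeal (𝓞 E)⁰ E) * ((dIdeal ω D x : FractionalIdeal (𝓞 E)⁰ E) *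
        (dIdeal' ω D x : FractionalIdeal (𝓞 E)⁰ E)) := by rw [h1]; ring
    _ = _ := by rw [h2]

lemma coe_relDiscr_ne_zero : (relDiscr E L : FractionalIdeal (𝓞 E)⁰ E) ≠ 0 := by
  rw [h.relDiscr_eq]
  exact FractionalIdeal.coeIdeal_ne_zero.2 h.dIdeal_ne_bot

/-- The elements `± (m r - k) / (2 D)` of `d⁻¹`. -/
lemma mem_inv_relDiscr_iff {m k : ℤ} {u : ℤˣ} {t : E}
    (ht : 2 * D * t = u * (m * (2 * algebraMap (𝓞 E) E ω - 1) - k)) :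
    t ∈ (relDiscr E L : FractionalIdeal (𝓞 E)⁰ E)⁻¹ ↔
      2 ∣ m + k ∧ (D : ℤ) ∣ 2 * k - m * x := by
  rw [FractionalIdeal.mem_inv_iff h.coe_relDiscr_ne_zero]
  have hu2 : ((u : ℤ) : E) * ((u : ℤ) : E) = 1 := by
    rw [← Int.cast_mul, ← Units.val_mul, Int.units_mul_self]
    simp
  constructor
  · intro hall
    have hmem : ∀ z ∈ dIdeal ω D x, ∃ q : 𝓞 E, algebraMap (𝓞 E) E q =
        u * (t * algebraMap (𝓞 E) E z) := by
      intro z hz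
      obtain ⟨q, hq⟩ := (FractionalIdeal.mem_one_iff (𝓞 E)⁰).1
        (hall (algebraMap (𝓞 E) E z) (FractionalIdeal.mem_coeIdeal_of_mem _ (by rwa [h.relDiscr_eq])))
      exact ⟨u * q, by rw [map_mul, hq]; simp⟩
    -- The generator D of 𝔡 yields the parity of m + k; the generator x + 2r then yields the
    -- congruence modulo D.
    obtain ⟨q, hq⟩ := hmem D h.D_mem_dIdeal
    rw [map_natCast] at hq
    have hq2 : 2 * q = m * (2 * ω - 1) - k := by
      apply NumberField.RingOfIntegers.coe_injective
      simp only [map_mul, map_sub, map_intCast, map_ofNat, map_one]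
      rw [hq]
      linear_combination ((u : ℤ) : E) * ht + (m * (2 * algebraMap (𝓞 E) E ω - 1) - k) * hu2
    have h2 : (2 : ℤ) ∣ m + k := by
      have h3 : ((2 : ℤ) : 𝓞 E) ∣ ((-(m + k) : ℤ) : 𝓞 E) + ((2 * m : ℤ) : 𝓞 E) * ω :=
        ⟨q, by push_cast; linear_combination -hq2⟩
      have := ((h.basis.intCast_dvd_iff _ _ _).1 h3).1
      rwa [dvd_neg] at this
    refine ⟨h2, ?_⟩
    obtain ⟨e, he⟩ := h2
    have he' : ((m : 𝓞 E) + k) = 2 * e := by exact_mod_cast congrArg (Int.cast : ℤ → 𝓞 E) he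
    have hqe : q = m * ω - e := by
      have : (2 : 𝓞 E) * q = 2 * (m * ω - e) := by linear_combination hq2 - he'
      exact mul_left_cancel₀ two_ne_zero this
    obtain ⟨q', hq'⟩ := hmem _ h.add_mem_dIdeal
    have hqq : (D : 𝓞 E) * q' = q * (x + 2 * (2 * ω - 1)) := by
      apply NumberField.RingOfIntegers.coe_injective
      rw [map_mul, map_mul, hq', hq, map_natCast]
      ring
    -- These are the coordinates of (mω − e)(x + 2r); the coefficient of ω equals m x − 2k.
    have h3 : ((D : ℤ) : 𝓞 E) ∣ ((-4 * m * c - e * x + 2 * e : ℤ) : 𝓞 E) +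
        ((m * x + 2 * m - 4 * e : ℤ) : 𝓞 E) * ω := by
      refine ⟨q', ?_⟩
      push_cast
      rw [hqq, hqe]
      linear_combination (-4 * m) * h.basis.eq
    have h4 := ((h.basis.intCast_dvd_iff _ _ _).1 h3).2
    rw [show 2 * k - m * x = -(m * x + 2 * m - 4 * e) by linear_combination 2 * he, dvd_neg]
    exact h4
  · rintro ⟨⟨e, he⟩, hk⟩ z hz
    obtain ⟨I, hI⟩ := h.exists_numerator (e := e) he.symm hk
    have he' : ((m : E) + k) = 2 * e := by exact_mod_cast congrArg (Int.cast : ℤ → E) he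
    have h1 := h.spanSingleton_mul_relDiscr (u := u) hI (t := t) (by
      refine mul_left_cancel₀ (two_ne_zero (α := E)) ?_
      simp only [map_mul, map_sub, map_intCast]
      linear_combination ht - ((u : ℤ) : E) * he')
    have h2 : t * z ∈ (I : FractionalIdeal (𝓞 E)⁰ E) := by
      rw [← h1]
      exact FractionalIdeal.mul_mem_mul (FractionalIdeal.mem_spanSingleton_self _ t) hz
    exact FractionalIdeal.coeIdeal_le_one h2

end ReflexDatum

end Numerator

open IsDedekindDomain NumberField

/-! ### Parametrization of the elements t by integers k -/

section Reindex

set_option linter.unusedSectionVars false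

/-- The integers `k` for which `(m r - k) / (2 D)` lies in `d⁻¹` and is bounded as in `tSet`. -/
def numeratorSet (D Dt : ℕ) (x : ℤ) (m : ℕ) : Set ℤ :=
  {k | k ^ 2 < (m : ℤ) ^ 2 * Dt ∧ 2 ∣ m + k ∧ (D : ℤ) ∣ 2 * k - m * x}

lemma finite_numeratorSet (D Dt : ℕ) (x : ℤ) (m : ℕ) : (numeratorSet D Dt x m).Finite := by
  refine (Set.finite_Icc (-(m ^ 2 * Dt : ℤ)) (m ^ 2 * Dt)).subset fun k hk => ?_
  have h1 := hk.1
  constructor <;> nlinarith [sq_nonneg (k - 1), sq_nonneg (k + 1), sq_nonneg k]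

lemma abs_lt_mul_sqrt_iff (n : ℤ) (m Dt : ℕ) :
    |(n : ℝ)| < m * Real.sqrt Dt ↔ n ^ 2 < (m : ℤ) ^ 2 * Dt := by
  have h1 : (0 : ℝ) ≤ m * Real.sqrt Dt := by positivity
  rw [← abs_of_nonneg h1, ← sq_lt_sq, mul_pow, Real.sq_sqrt (by positivity)]
  exact_mod_cast Iff.rfl

variable {K : Type*} [Field K] [NumberField K] [NumberField.IsCMField K]
  {D Dt : ℕ} {x y : ℤ} {Φ : Finset (K →+* ℂ)}
  {c : ℤ} {ω : 𝓞 (tildeF Φ Dt)} {ξ ζ η : 𝓞 (reflexField Φ)}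
  (hR : ReflexDatum D Dt x y c ω ξ ζ η) {u : ℤˣ}
  (hu : (((2 * algebraMap (𝓞 (tildeF Φ Dt)) (tildeF Φ Dt) ω - 1 : tildeF Φ Dt) : reflexField Φ) : ℂ) =
    ((u : ℤ) : ℂ) * (Real.sqrt Dt : ℂ))

variable (D ω u) in
/-- The element `± (m r - k) / (2 D)`. -/
def numeratorElt (m : ℕ) (k : ℤ) : tildeF Φ Dt :=
  (u : ℤ) * (m * (2 * algebraMap (𝓞 (tildeF Φ Dt)) (tildeF Φ Dt) ω - 1) - k) / (2 * D)

include hR in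
lemma two_mul_numeratorElt (m : ℕ) (k : ℤ) : 2 * D * numeratorElt D ω u m k =
    (u : ℤ) * (m * (2 * algebraMap (𝓞 (tildeF Φ Dt)) (tildeF Φ Dt) ω - 1) - k) := by
  have : (D : tildeF Φ Dt) ≠ 0 := by exact_mod_cast hR.prime.ne_zero
  rw [numeratorElt]
  field_simp

include hR hu in
lemma coe_numeratorElt (m : ℕ) (k : ℤ) :
    ((numeratorElt D ω u m k : reflexField Φ) : ℂ) =
      (((-(u * k) : ℤ) : ℂ) + m * (Real.sqrt Dt : ℂ)) / (2 * D) := by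
  have hD0 : (D : ℂ) ≠ 0 := by exact_mod_cast hR.prime.ne_zero
  have h1 := congrArg (fun z : tildeF Φ Dt => ((z : reflexField Φ) : ℂ))
    (two_mul_numeratorElt hR (u := u) m k)
  have hu2 : ((u : ℤ) : ℂ) * ((u : ℤ) : ℂ) = 1 := by
    rw [← Int.cast_mul, ← Units.val_mul, Int.units_mul_self]
    simp
  have h2 : (2 : ℂ) * D * ((numeratorElt D ω u m k : reflexField Φ) : ℂ) =
      (u : ℤ) * (m * (((2 * algebraMap (𝓞 (tildeF Φ Dt)) (tildeF Φ Dt) ω - 1 : tildeF Φ Dt) :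
        reflexField Φ) : ℂ) - k) := h1
  rw [hu] at h2
  rw [eq_div_iff (by simpa using hD0)]
  push_cast
  linear_combination h2 + m * (Real.sqrt Dt : ℂ) * hu2

include hR hu in
lemma numeratorElt_injective (m : ℕ) : Function.Injective (numeratorElt D ω u m) := by
  intro k k' hkk
  have h1 := congrArg (fun z : tildeF Φ Dt => ((z : reflexField Φ) : ℂ)) hkk
  simp only [coe_numeratorElt hR hu] at h1
  have hD0 : (2 * D : ℂ) ≠ 0 := by simpa using hR.prime.ne_zero
  rw [div_left_inj' hD0, add_left_inj, Int.cast_inj, neg_inj] at h1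
  exact mul_left_cancel₀ u.ne_zero h1

include hR hu in
lemma tSet_eq_image (m : ℕ) :
    tSet Φ D Dt m = numeratorElt D ω u m '' numeratorSet D Dt x m := by
  have huu : ((u : ℤ)) * u = 1 := by
    rw [← Units.val_mul, Int.units_mul_self]; rfl
  have hmem : ∀ k : ℤ, numeratorElt D ω u m k ∈ ((relDiscr (tildeF Φ Dt) (reflexField Φ) :
        FractionalIdeal (𝓞 (tildeF Φ Dt))⁰ (tildeF Φ Dt))⁻¹) ↔
      2 ∣ (m : ℤ) + k ∧ (D : ℤ) ∣ 2 * k - m * x := fun k =>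
    hR.mem_inv_relDiscr_iff (by exact_mod_cast two_mul_numeratorElt hR (u := u) m k)
  ext t
  constructor
  · rintro ⟨ht, n, hn, htn⟩
    -- With r = u√D̃ and u² = 1, n + m√D̃ = u(m r − k) holds for k = −un.
    have hteq : t = numeratorElt D ω u m (-(u * n)) := by
      apply Subtype.ext
      apply Subtype.ext
      refine htn.trans ?_
      rw [coe_numeratorElt hR hu, mul_neg, neg_neg, ← mul_assoc, huu, one_mul]
    rw [hteq, hmem] at ht
    refine ⟨-(u * n), ⟨?_, ht.1, ht.2⟩, hteq.symm⟩
    rw [neg_sq, units_mul_sq]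
    exact (abs_lt_mul_sqrt_iff n m Dt).1 hn
  · rintro ⟨k, ⟨hk1, hk2, hk3⟩, rfl⟩
    refine ⟨(hmem k).2 ⟨hk2, hk3⟩, -(u * k), ?_, coe_numeratorElt hR hu m k⟩
    rw [abs_lt_mul_sqrt_iff, neg_sq, units_mul_sq]
    exact hk1

end Reindex

/-! ### From integers k to pairs (n, μ) -/

section Signs

set_option linter.unusedSectionVars false

variable {F : Type*} [Field F] [CharZero F] {s Δ : F}
  {E L : Type*} [Field E] [NumberField E] [Field L] [NumberField L] [Algebra E L]
  {D Dt : ℕ} {x y c : ℤ} {ω : 𝓞 E} {ξ ζ η : 𝓞 L} (hR : ReflexDatum D Dt x y c ω ξ ζ η)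
  (hs : s ^ 2 = D) (hΔ : 2 * Δ = x + y * s) (hx : x < 0)
  {m n p : ℕ} (hm : m ≠ 0) (hmD : ¬ D ∣ m) (hm2 : ¬ 2 ∣ m) (hDt4 : Dt % 4 = 1)

include hR in
lemma four_mul_quot (hn : n ∈ nRange D Dt m p) :
    4 * (D : ℤ) * quot D Dt m n = m ^ 2 * Dt - n ^ 2 := by
  simp only [nRange, Finset.mem_filter] at hn
  obtain ⟨-, -, hlt, q, hq⟩ := hn
  have hD := hR.prime.pos
  have h1 : quot D Dt m n = p * q := by
    rw [quot, hq, mul_assoc (4 * D), Nat.mul_div_cancel_left _ (by positivity)]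
  have h2 : (m ^ 2 * Dt - n ^ 2 : ℕ) = ((m : ℤ) ^ 2 * Dt - n ^ 2) := by
    rw [Nat.cast_sub hlt.le]; push_cast; ring
  rw [h1, ← h2, hq]
  push_cast
  ring

lemma four_dvd_sub_iff {k : ℤ} :
    4 * (D : ℤ) * p ∣ m ^ 2 * Dt - k ^ 2 ∧ k ^ 2 < (m : ℤ) ^ 2 * Dt ∧ k ≠ 0 ↔
      k.natAbs ∈ nRange D Dt m p := by
  have hsq : ((k.natAbs : ℕ) : ℤ) ^ 2 = k ^ 2 := Int.natAbs_sq k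
  simp only [nRange, Finset.mem_filter, Finset.mem_range, Int.natAbs_pos]
  have hlt : k.natAbs ^ 2 < m ^ 2 * Dt ↔ k ^ 2 < (m : ℤ) ^ 2 * Dt := by
    rw [← hsq]; exact_mod_cast Iff.rfl
  have hdvd : k.natAbs ^ 2 < m ^ 2 * Dt →
      (4 * D * p ∣ m ^ 2 * Dt - k.natAbs ^ 2 ↔ 4 * (D : ℤ) * p ∣ m ^ 2 * Dt - k ^ 2) := by
    intro h0
    rw [← Int.natCast_dvd_natCast, Nat.cast_sub h0.le, ← hsq]
    push_cast
    exact Iff.rfl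
  constructor
  · rintro ⟨h1, h2, h3⟩
    refine ⟨?_, h3, hlt.2 h2, (hdvd (hlt.2 h2)).2 h1⟩
    have h4 := hlt.2 h2
    -- This shows that the finite range in `nRange` loses no n with n² < m² D̃.
    have h5 : m ^ 2 * Dt ≤ (m * Dt) ^ 2 := by
      rw [mul_pow]
      exact Nat.mul_le_mul_left _ (Nat.le_self_pow two_ne_zero _)
    have h6 := lt_of_pow_lt_pow_left₀ 2 (Nat.zero_le _) (h4.trans_le h5)
    omega
  · rintro ⟨-, h3, h2, h1⟩
    exact ⟨(hdvd h2).1 h1, hlt.1 h2, h3⟩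

include hR hs hΔ hx hm in
lemma exists_isTm_of_dvd {μ : ℤˣ} (hn : n ∈ nRange D Dt m p)
    (hk : (D : ℤ) ∣ 2 * (μ * n) - m * x) : ∃ T, IsTm D Dt s Δ m n μ T := by
  obtain ⟨A, B, C, d, hC, hB, hd, hA⟩ := hR.exists_entries hk
  have hQ : 4 * (D : ℤ) * (quot D Dt m n : ℤ) = m ^ 2 * Dt - ((μ : ℤ) * n) ^ 2 := by
    rw [units_mul_sq, four_mul_quot hR hn]
  refine exists_isTm hR.prime hΔ hx hR.norm_eq hm ?_ hC hB hd hA hQ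
    (hR.det_entries hC hB hd hA hQ)
  simp only [nRange, Finset.mem_filter] at hn
  exact hn.2.2.1

-- If D ∣ n, then D divides D̃ and hence x, so the congruence holds for both signs. Otherwise it
-- expresses that the entry C = (2μn − m x)/D of mT is an integer.
include hR hs hΔ hx hm hmD in
lemma mem_signs_iff {μ : ℤˣ} (hn : n ∈ nRange D Dt m p) :
    μ ∈ signs D Dt s Δ m n ↔ (D : ℤ) ∣ 2 * (μ * n) - m * x := by
  have hDp := Nat.prime_iff_prime_int.1 hR.prime
  obtain ⟨d, hd⟩ : ∃ d : ℤ, (D : ℤ) = 1 + 4 * d := ⟨(D : ℤ) / 4, by have := hR.mod_four; omega⟩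
  simp only [signs, Finset.mem_filter, Finset.mem_univ, true_and]
  constructor
  · rintro (hDn | ⟨T, hT⟩)
    · have hDn' : (D : ℤ) ∣ n := by exact_mod_cast hDn
      have h1 := four_mul_quot hR hn
      have h2 : (D : ℤ) ∣ m ^ 2 * Dt := by
        rw [show (m : ℤ) ^ 2 * Dt = 4 * D * quot D Dt m n + n * n by rw [h1]; ring]
        exact dvd_add ((dvd_mul_left _ _).mul_right _) (hDn'.mul_right _)
      have h3 : (D : ℤ) ∣ Dt := (hDp.dvd_or_dvd h2).resolve_left fun h0 =>
        hmD (by exact_mod_cast hDp.dvd_of_dvd_pow h0)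
      have h4 : (D : ℤ) ∣ x := by
        refine hDp.dvd_of_dvd_pow (n := 2) ?_
        rw [show x ^ 2 = 4 * Dt + D * y ^ 2 by rw [← hR.norm_eq]; ring]
        exact dvd_add (h3.mul_left _) (dvd_mul_right _ _)
      exact dvd_sub ((hDn'.mul_left _).mul_left _) (h4.mul_left _)
    · obtain ⟨A, B, C, -, -, -, -, hC, -, -⟩ := hT.exists_entries hR.prime hs hΔ hm hd
      exact ⟨C, hC.symm⟩
  · intro hk
    exact Or.inr (exists_isTm_of_dvd hR hs hΔ hx hm hn hk)

-- Since m and D̃ are odd, k is odd; so the parity condition is automatic for the terms that matter,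
-- and k = 0 does not occur.
include hm2 hDt4 in
lemma two_dvd_add_of_dvd {k : ℤ} (h4 : 4 * (D : ℤ) * p ∣ m ^ 2 * Dt - k ^ 2) :
    2 ∣ (m : ℤ) + k ∧ k ≠ 0 := by
  have h2 : (2 : ℤ) ∣ m ^ 2 * Dt - k ^ 2 := dvd_trans ⟨2 * D * p, by ring⟩ h4
  have hmo : Odd (m : ℤ) := by
    rw [Int.odd_coe_nat, ← Nat.not_even_iff_odd, even_iff_two_dvd]
    exact hm2
  have hDo : Odd (Dt : ℤ) := by
    rw [Int.odd_coe_nat, Nat.odd_iff]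
    omega
  have hk : Odd k := by
    have h3 : Odd ((m : ℤ) ^ 2 * Dt) := hmo.pow.mul hDo
    by_contra h0
    rw [Int.not_odd_iff_even] at h0
    have h5 : Odd ((m : ℤ) ^ 2 * Dt - k ^ 2) := h3.sub_even (h0.pow_of_ne_zero two_ne_zero)
    exact (Int.not_even_iff_odd.2 h5) (even_iff_two_dvd.2 h2)
  refine ⟨even_iff_two_dvd.1 (hmo.add_odd hk), ?_⟩
  rintro rfl
  simp at hk

include hR hs hΔ hx hm hmD hm2 hDt4 in
/-- The sum over the pairs `(n, μ)` as a sum over `k = μ n`. -/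
lemma finsum_numeratorSet (f : ℤ → ℝ)
    (hf : ∀ k ∈ numeratorSet D Dt x m, ¬ 4 * (D : ℤ) * p ∣ m ^ 2 * Dt - k ^ 2 → f k = 0) :
    ∑ᶠ k ∈ numeratorSet D Dt x m, f k =
      ∑ n ∈ nRange D Dt m p, ∑ μ ∈ signs D Dt s Δ m n, f (μ * n) := by
  classical
  rw [finsum_mem_eq_finite_toFinset_sum _ (finite_numeratorSet D Dt x m), Finset.sum_sigma']
  symm
  refine Finset.sum_of_injOn (fun q : (_ : ℕ) × ℤˣ => ((q.2 : ℤ) * q.1)) ?_ ?_ ?_ fun _ _ => rfl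
  · rintro ⟨n, μ⟩ h1 ⟨n', μ'⟩ h2 heq
    simp only [Finset.coe_sigma, Set.mem_sigma_iff, Finset.mem_coe, nRange, Finset.mem_filter] at h1 h2
    have h3 : (n : ℤ) ≠ 0 := by exact_mod_cast h1.1.2.1.ne'
    have h4 : n = n' := by
      have := congrArg Int.natAbs heq
      simpa [Int.natAbs_mul] using this
    subst h4
    have h5 : μ = μ' := Units.ext (mul_right_cancel₀ h3 heq)
    subst h5
    rfl
  · rintro ⟨n, μ⟩ h1
    simp only [Finset.coe_sigma, Set.mem_sigma_iff, Finset.mem_coe] at h1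
    obtain ⟨hn, hμ⟩ := h1
    have hk := (mem_signs_iff hR hs hΔ hx hm hmD hn).1 hμ
    have h2 : ((μ : ℤ) * n).natAbs ∈ nRange D Dt m p := by
      rwa [Int.natAbs_mul, Int.units_natAbs, one_mul, Int.natAbs_natCast]
    rw [← four_dvd_sub_iff] at h2
    simp only [Set.Finite.coe_toFinset]
    exact ⟨h2.2.1, (two_dvd_add_of_dvd hm2 hDt4 h2.1).1, hk⟩
  · intro k hk hnot
    rw [Set.Finite.mem_toFinset] at hk
    refine hf k hk fun h4 => hnot ?_
    have hk0 := (two_dvd_add_of_dvd hm2 hDt4 h4).2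
    have hn := (four_dvd_sub_iff).1 ⟨h4, hk.1, hk0⟩
    obtain ⟨μ, hμ⟩ : ∃ μ : ℤˣ, (μ : ℤ) * k.natAbs = k := by
      rcases lt_or_gt_of_ne hk0 with h0 | h0
      · exact ⟨-1, by simp; rw [abs_of_neg h0]; ring⟩
      · exact ⟨1, by simp [h0.le]⟩
    refine ⟨⟨k.natAbs, μ⟩, ?_, hμ⟩
    simp only [Finset.coe_sigma, Set.mem_sigma_iff, Finset.mem_coe]
    refine ⟨hn, (mem_signs_iff hR hs hΔ hx hm hmD hn).2 ?_⟩
    rw [hμ]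
    exact hk.2.2

end Signs

end CMIntersection

end

/-! ### The formula for b_m(p) -/

open CMIntersection in
theorem mainTheorem12 {K : Type*} [Field K] [NumberField K] [NumberField.IsCMField K]
    (hdeg : Module.finrank ℚ K = 4) (hbiq : ¬ IsBiquadratic K)
    (D : ℕ) (hD : D.Prime) (hD4 : D % 4 = 1)
    (sqrtD : NumberField.maximalRealSubfield K) (hsqrtD : sqrtD ^ 2 = (D : _))
    (Δ : NumberField.maximalRealSubfield K) (sqrtΔ : K) (hsqrtΔ : sqrtΔ ^ 2 = (Δ : K))
    (w : 𝓞 (NumberField.maximalRealSubfield K))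
    (hOK : ∀ z : K, IsIntegral ℤ z ↔
      ∃ u v : 𝓞 (NumberField.maximalRealSubfield K),
        z = ((u : NumberField.maximalRealSubfield K) : K) +
          ((v : NumberField.maximalRealSubfield K) : K) *
            ((((w : NumberField.maximalRealSubfield K) : K) + sqrtΔ) / 2))
    (Dt : ℕ) (hDt : Algebra.norm ℚ Δ = (Dt : ℚ)) (hDt4 : Dt % 4 = 1) (hDtsq : Squarefree Dt)
    (Φ : Finset (K →+* ℂ)) (hΦ : IsCMType Φ)
    (p : ℕ) (hp : p.Prime)
    (m : ℕ) (hm : 0 < m) (hmsq : Squarefree m) (hmcop : Nat.Coprime m (2 * D * Dt * p)) :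
    (∀ n ∈ nRange D Dt m p, ∀ μ ∈ signs D Dt sqrtD Δ m n, ∀ l : Nat.Primes,
      (l : ℕ) ∣ quot D Dt m n → (¬ (l : ℕ) ∣ m ∨ 0 < tOrd D Dt m n l) →
        ∃ α : ℤ_[(l : ℕ)]ˣ, IsEquivDiag l (Tm D Dt sqrtD Δ m n μ) α) ∧
    ∀ α : ℕ → ℤˣ → ∀ l : Nat.Primes, ℤ_[(l : ℕ)]ˣ,
      (∀ n ∈ nRange D Dt m p, ∀ μ ∈ signs D Dt sqrtD Δ m n, ∀ l : Nat.Primes,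
        (l : ℕ) ∣ quot D Dt m n → (¬ (l : ℕ) ∣ m ∨ 0 < tOrd D Dt m n l) →
          IsEquivDiag l (Tm D Dt sqrtD Δ m n μ) (α n μ l)) →
      bm Φ D Dt m p =
        ((∑ n ∈ nRange D Dt m p, ((padicValNat p (quot D Dt m n) : ℚ) + 1) *
          ∑ μ ∈ signs D Dt sqrtD Δ m n,
            ∏ᶠ (l : Nat.Primes) (_ : (l : ℕ) ∣ quot D Dt m n),
              localFactor Φ D Dt m p n l
                (hilbertSymbol l (-((α n μ l : ℤ_[(l : ℕ)]) : ℚ_[(l : ℕ)])) ((l : ℕ) : ℚ_[(l : ℕ)])) : ℚ) : ℝ) := by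
  obtain ⟨x, y, a, b, h⟩ := exists_cmData hdeg hbiq hD hD4 hsqrtD hsqrtΔ hOK hDt hDt4 hDtsq
  obtain ⟨σ₁, σ₂, h1, h2, hsum⟩ := h.exists_cmType hΦ
  obtain ⟨c, ω, ξ, ζ, η, hR, hξ, hr⟩ := h.exists_reflexDatum h1 h2 hsum
  obtain ⟨u, hu⟩ : ∃ u : ℤˣ, σ₁ sqrtΔ * σ₂ sqrtΔ = ((u : ℤ) : ℂ) * (Real.sqrt Dt : ℂ) := by
    rcases h.r_eq h1 h2 with h0 | h0
    · exact ⟨1, by simpa using h0⟩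
    · exact ⟨-1, by simpa using h0⟩
  rw [hu] at hr
  have hm0 : m ≠ 0 := hm.ne'
  have hmD : ¬ D ∣ m := fun h0 => (ne_of_dvd_of_coprime hD hmcop h0).2.1 rfl
  have hm2 : ¬ 2 ∣ m := fun h0 => (ne_of_dvd_of_coprime Nat.prime_two hmcop h0).1 rfl
  have hs : sqrtD ^ 2 = (D : NumberField.maximalRealSubfield K) := hsqrtD
  have data : ∀ n ∈ nRange D Dt m p, ∀ μ ∈ signs D Dt sqrtD Δ m n,
      (D : ℤ) ∣ 2 * ((μ : ℤ) * n) - m * x ∧ ((μ : ℤ) * n) ^ 2 < (m : ℤ) ^ 2 * Dt ∧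
      (∃ T, IsTm D Dt sqrtD Δ m n μ T) ∧ ∃ (e : ℤ) (I : Ideal (𝓞 (tildeF Φ Dt))),
        2 * e = m + μ * n ∧
        Ideal.span {((m : ℤ) : 𝓞 (tildeF Φ Dt)) * ω - e} = I * dIdeal' ω D x ∧
        I ≠ ⊥ ∧ Ideal.absNorm I = quot D Dt m n ∧ p ∣ Ideal.absNorm I := by
    intro n hn μ hμ
    have hk := (mem_signs_iff hR hs h.two_Δ h.x_neg hm0 hmD hn).1 hμ
    have hT := exists_isTm_of_dvd hR hs h.two_Δ h.x_neg hm0 hn hk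
    have hn' : ((μ : ℤ) * n).natAbs ∈ nRange D Dt m p := by
      rwa [Int.natAbs_mul, Int.units_natAbs, one_mul, Int.natAbs_natCast]
    rw [← four_dvd_sub_iff] at hn'
    obtain ⟨h4, hlt, -⟩ := hn'
    obtain ⟨⟨e, he⟩, -⟩ := two_dvd_add_of_dvd hm2 hDt4 h4
    obtain ⟨I, hI⟩ := hR.exists_numerator he.symm hk
    have hN := hR.absNorm_numerator he.symm hlt hI
    have hD0 : (4 * D : ℤ) ≠ 0 := by exact_mod_cast (mul_pos four_pos hD.pos).ne'
    refine ⟨hk, hlt, hT, e, I, he.symm, hI, ?_, ?_, ?_⟩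
    · rintro rfl
      simp only [Ideal.absNorm_bot, CharP.cast_eq_zero, mul_zero] at hN
      linarith
    · have h5 := four_mul_quot hR hn
      rw [← units_mul_sq μ n, ← hN] at h5
      exact_mod_cast (mul_left_cancel₀ hD0 h5).symm
    · rw [← hN] at h4
      exact_mod_cast Int.dvd_of_mul_dvd_mul_left hD0 h4
  refine ⟨fun n hn μ hμ l hl hlt => ?_, fun α hα => ?_⟩
  · obtain ⟨hk, hkm, hT, e, I, he, hI, -, hQ, -⟩ := data n hn μ hμ
    rw [← hQ] at hl
    exact exists_isEquivDiag h hR hm0 hmsq hmcop he hk hkm hI hT hl hlt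
  · have hlog : Real.log p ≠ 0 := (Real.log_pos (by exact_mod_cast hp.one_lt)).ne'
    rw [bm, div_eq_iff hlog]
    have hfin : {v : IsDedekindDomain.HeightOneSpectrum (𝓞 (tildeF Φ Dt)) |
        (p : 𝓞 (tildeF Φ Dt)) ∈ v.asIdeal}.Finite := by
      refine (finite_setOf_asIdeal_dvd (span_natCast_ne_bot' hp)).subset fun v hv => ?_
      exact natCast_mem_iff_dvd.1 hv
    have htfin : (tSet Φ D Dt m).Finite := by
      rw [tSet_eq_image hR hr]
      exact (finite_numeratorSet D Dt x m).image _
    -- Both index sets are finite, so the sum over t can be taken outside and rewritten as a sum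
    -- over k.
    refine (finsum_mem_comm (fun v t => Bterm (tildeF Φ Dt) (reflexField Φ) t v) hfin htfin).trans ?_
    rw [tSet_eq_image hR hr, finsum_mem_image (numeratorElt_injective hR hr m).injOn]
    have hrel : ∀ (k e : ℤ) (I : Ideal (𝓞 (tildeF Φ Dt))), 2 * e = m + k →
        Ideal.span {((m : ℤ) : 𝓞 (tildeF Φ Dt)) * ω - e} = I * dIdeal' ω D x →
        FractionalIdeal.spanSingleton (𝓞 (tildeF Φ Dt))⁰ (numeratorElt D ω u m k) *
          (relDiscr (tildeF Φ Dt) (reflexField Φ) :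
            FractionalIdeal (𝓞 (tildeF Φ Dt))⁰ (tildeF Φ Dt)) = I := by
      intro k e I he hI
      refine hR.spanSingleton_mul_relDiscr (u := u) hI ?_
      have he' : 2 * (e : tildeF Φ Dt) = m + k := by exact_mod_cast congrArg (Int.cast) he
      refine mul_left_cancel₀ (two_ne_zero (α := tildeF Φ Dt)) ?_
      simp only [map_mul, map_sub, map_intCast, map_natCast, Int.cast_natCast]
      linear_combination two_mul_numeratorElt hR (u := u) m k + ((u : ℤ) : tildeF Φ Dt) * he'
    -- A numerator k for which p does not divide N(I) contributes nothing, as no prime above p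
    -- divides I; the other k are the products μn.
    refine (finsum_numeratorSet (p := p) hR hs h.two_Δ h.x_neg hm0 hmD hm2 hDt4 _ ?_).trans ?_
    · rintro k ⟨hlt, ⟨e, he⟩, hk⟩ hndvd
      obtain ⟨I, hI⟩ := hR.exists_numerator he.symm hk
      have hN := hR.absNorm_numerator he.symm hlt hI
      have hI0 : I ≠ ⊥ := by
        rintro rfl
        simp only [Ideal.absNorm_bot, CharP.cast_eq_zero, mul_zero] at hN
        linarith
      refine finsum_Bterm_of_not_dvd hR hmcop hp hI hI0 (hrel k e I he.symm hI) fun hpI => hndvd ?_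
      rw [← hN]
      exact mul_dvd_mul_left _ (by exact_mod_cast hpI)
    · rw [Rat.cast_sum, Finset.sum_mul]
      refine Finset.sum_congr rfl fun n hn => ?_
      rw [Finset.mul_sum, Rat.cast_sum, Finset.sum_mul]
      refine Finset.sum_congr rfl fun μ hμ => ?_
      obtain ⟨hk, hkm, hT, e, I, he, hI, hI0, hQ, hpI⟩ := data n hn μ hμ
      rw [← hQ]
      exact finsum_Bterm_of_dvd h h1 h2 hR hξ hm0 hmsq hmcop hp he hk hkm hI hI0 hT
        (hrel _ e I he hI) hpI (α n μ) fun l hl => hα n hn μ hμ l (hQ ▸ hl)
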